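/- **Model.** For a sequence of sample sizes $n\to\infty$ consider data $(x_t,y_t)$, $t=1,\dots,n$, $x_t\in\mathbb R^p$, $y_t\in\mathbb R$, where $p$, the number $m_0\ge 1$ of change points, the change points $1=t_0<t_1<\dots<t_{m_0}<t_{m_0+1}=n+1$ and the coefficient vectors $\beta_1^\star,\dots,\beta_{m_0+1}^\star\in\mathbb R^p$ ($\beta^\star_{j+1}\ne\beta^\star_j$) may all depend on $n$, and $$y_t=x_t^\top\beta_j^\star+\varepsilon_t\qquad (t_{j-1}\le t<t_j,\ 1\le j\le m_0+1).$$ Let $d_n^\star=\max_j\|\beta_j^\star\|_0$, $\nu_n=\min_{1\le j\le m_0}\|\beta_{j+1}^\star-\beta_j^\star\|_2$, $L_n=\log(p\vee n)$. A real variable $X$ is sub-Gaussian with parameter $\sigma$ if $(E|X|^q)^{1/q}\le\sigma\sqrt q$ for all $q\ge1$; a vector $X$ is sub-Gaussian with parameters $(\Sigma,\sigma^2)$ if it has mean $0$, covariance $\Sigma$ and every $u^\top X$ with $\|u\|_2=1$ is sub-Gaussian with parameter $\sigma$. **Procedure (TBFL).** Fix a block size $b_n$; let $k_n=\lfloor n/b_n\rfloor$,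 $r_i=1+ib_n$ for $i<k_n$, $r_{k_n}=n+1$. (I) $\hat\theta=(\hat\theta_1,\dots,\hat\theta_{k_n})$ is any minimizer over $(\mathbb R^p)^{k_n}$ of $$\frac1n\sum_{i=1}^{k_n}\sum_{t=r_{i-1}}^{r_i-1}\Big(y_t-x_t^\top\sum_{l\le i}\theta_l\Big)^2+\lambda_{1,n}\sum_{i=1}^{k_n}\|\theta_i\|_1+\lambda_{2,n}\sum_{i=1}^{k_n}\Big\|\sum_{l\le i}\theta_l\Big\|_1 .$$ (II) $\tilde I=\{2\le i\le k_n:\|\hat\theta_i\|_2>\omega_n\}$ and $\tilde{\mathcal A}=\{r_{i-1}:i\in\tilde I\}$, with $\omega_n=c_\omega\nu_n$. (III) $\tilde{\mathcal A}$ is partitioned, by any criterion, into nonempty sets of consecutive elements of diameter at most $\kappa_1b_n$, and then contiguous sets $C<C'$ with $\min C'-\max C\le\kappa_2b_n$ are merged, where $0\le\kappa_1\le\kappa_{\max}$, $1\le\kappa_2\le\kappa_{\max}$ may depend on $n$ and $\kappa_{\max}$ does not. Let $R_1<\dots<R_{\tilde m^f}$ be the resulting clusters, $J_1,\dots,J_{\tilde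 m^f}$ the corresponding sets of indices $i\in\tilde I$, $J_0=\{1\}$, $J_{\tilde m^f+1}=\{k_n\}$. Put $$\hat\beta_j=\sum_{i=1}^{\lfloor(\max J_{j-1}+\min J_j)/2\rfloor}\hat\theta_i\qquad(1\le j\le\tilde m^f+1),$$ let $(l_j,u_j)=(\min R_j-b_n,\max R_j+b_n)$ if $|R_j|=1$ and $(l_j,u_j)=(\min R_j,\max R_j)$ otherwise, and let $\tilde t_j$ be any minimizer over integers $s\in(l_j,u_j)$ of $$\sum_{t=\min R_j-b_n}^{s-1}(y_t-x_t^\top\hat\beta_j)^2+\sum_{t=s}^{\max R_j+b_n-1}(y_t-x_t^\top\hat\beta_{j+1})^2 .$$ Finally $\tilde\beta_j$ is $\hat\beta_j$ with every entry of absolute value at most $\eta_{n,j}$ replaced by $0$. **Assumptions.** (E1) The pairs $(x_t,\varepsilon_t)$, $1\le t\le n$, are independent. For $t$ in the $j$-th segment, $x_t$ is sub-Gaussian with parameters $(\Sigma_j,\sigma_{x,j}^2)$, and the $\varepsilon_t$ are identically distributed, centred, sub-Gaussian with parameter $\sigma_{\varepsilon,j}$ and uncorrelated with $x_t$. The eigenvalues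 of every $\Sigma_j$ lie in $[1/C_x,C_x]$, and $\sigma_{x,j}^2\in(1/C_\sigma,C_\sigma)$, $\sigma_{\varepsilon,j}^2\in(1/C_\varepsilon,C_\varepsilon)$, with positive constants. (E2) $d_n^\star/p\to0$ and $\max_j\|\beta_j^\star\|_\infty\le M_\beta$. (E3) $\min_{1\le j\le m_0+1}(t_j-t_{j-1})/b_n\to\infty$, $d_n^\star L_n/b_n\to0$, and $\nu_n\ge c_\nu\sqrt{d_n^\star L_n/b_n}$ for all large $n$. (E4) $\lambda_{i,n}=C_i\sqrt{L_n/n}\,\sqrt{b_n/n}$ for $i=1,2$. **Proposition.** For all $C_x,C_\sigma,C_\varepsilon>0$ there is $A>0$ such that for all $C_1>0$, $C_2\ge A(1+C_1)$ and $c_\omega\in(0,1/2)$ there is $c_\nu>0$ such that for every $M_\beta>0$ there is $K>0$ such that, whenever (E1)–(E4) hold with these constants, $$P\Big(\tilde m^f=m_0,\ \max_{1\le j\le m_0}|\tilde t_j-t_j|\le\frac{K\,d_n^\star\log(p\vee n)}{\nu_n^2}\Big)\to1,\qquad \max_{1\le j\le m_0+1}\|\hat\beta_j-\beta_j^\star\|_2=O_p\Big(\sqrt{\tfrac{d_n^\star\log(p\vee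 n)}{b_n}}\Big),$$ and, if $\eta_{n,j}=C_{\eta,j}\sqrt{\log(p\vee n)/b_n}$ with constants $C_{\eta,j}$ that are bounded below by a positive constant for $1\le j\le m_0+1$, uniformly in $n$, $$\max_{1\le j\le m_0+1}|\operatorname{supp}(\tilde\beta_j)\setminus\operatorname{supp}(\beta_j^\star)|=O_p(d_n^\star).$$ (The last two maxima are meaningful on the event $\tilde m^f=m_0$, whose probability tends to one. If an estimator is not measurable, probabilities of failure are outer probabilities.) -/

import Mathlib

namespace TBFL

open MeasureTheory ProbabilityTheory Finset

/-! ### Sub-Gaussian variables and vectors -/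

/-- `X` is sub-Gaussian with parameter (at most) `σ`:
`(E |X|^q)^(1/q) ≤ σ √q` for every real `q ≥ 1`. -/
def IsSubGaussian {Ω : Type*} [MeasurableSpace Ω] (P : Measure Ω) (X : Ω → ℝ) (σ : ℝ) : Prop :=
  ∀ q : ℝ, 1 ≤ q → eLpNorm X (ENNReal.ofReal q) P ≤ ENNReal.ofReal (σ * √q)

/-- `X` is a sub-Gaussian random vector with parameters `(S, σ²)`: it has mean zero and
covariance matrix `S`, and each of its one-dimensional unit projections is sub-Gaussian with
parameter at most `σ`. -/
def IsSubGaussianVec {Ω : Type*} [MeasurableSpace Ω] (P : Measure Ω) {p : ℕ}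
    (X : Ω → EuclideanSpace ℝ (Fin p)) (S : Matrix (Fin p) (Fin p) ℝ) (σ : ℝ) : Prop :=
  (∀ i, ∫ ω, X ω i ∂P = 0) ∧
  (∀ i k, covariance (fun ω => X ω i) (fun ω => X ω k) P = S i k) ∧
  ∀ u : EuclideanSpace ℝ (Fin p), ‖u‖ = 1 → IsSubGaussian P (fun ω => inner ℝ u (X ω)) σ

/-! ### Vectors -/

/-- The `ℓ¹` norm (the norm of `EuclideanSpace` is the `ℓ²` norm). -/
def l1norm {p : ℕ} (v : EuclideanSpace ℝ (Fin p)) : ℝ := ∑ i, |v i|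

/-- The support of a vector. -/
noncomputable def vsupp {p : ℕ} (v : EuclideanSpace ℝ (Fin p)) : Finset (Fin p) :=
  {i | v i ≠ 0}

/-- Entrywise hard-thresholding at level `η`. -/
noncomputable def hardThreshold {p : ℕ} (η : ℝ) (v : EuclideanSpace ℝ (Fin p)) :
    EuclideanSpace ℝ (Fin p) :=
  WithLp.toLp 2 fun i => if η < |v i| then v i else 0

/-! ### The piecewise constant linear regression model -/

/-- A linear regression with `m ≥ 1` change points in the coefficient vector, at sample size `n`
and dimension `p`. Times run over `1, …, n`; the change points are `cp 1 < ⋯ < cp m`, with the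
conventions `cp 0 = 1` and `cp (m + 1) = n + 1`; the `j`-th segment is `[cp (j-1), cp j)` and its
coefficient vector is `β j`, `j = 1, …, m + 1`. -/
structure MLRModel (Ω : Type*) where
  n : ℕ
  p : ℕ
  m : ℕ
  cp : ℕ → ℕ
  β : ℕ → EuclideanSpace ℝ (Fin p)
  x : ℕ → Ω → EuclideanSpace ℝ (Fin p)
  ε : ℕ → Ω → ℝ
  one_le_m : 1 ≤ m
  cp_zero : cp 0 = 1
  cp_last : cp (m + 1) = n + 1
  cp_lt : ∀ j ≤ m, cp j < cp (j + 1)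
  β_ne : ∀ j ∈ Icc 1 m, β (j + 1) ≠ β j

namespace MLRModel

variable {Ω : Type*} (M : MLRModel Ω)

/-- The response `y_t`. -/
noncomputable def y (t : ℕ) (ω : Ω) : ℝ :=
  ∑ j ∈ Icc 1 (M.m + 1),
    if M.cp (j - 1) ≤ t ∧ t < M.cp j then inner ℝ (M.x t ω) (M.β j) + M.ε t ω else 0

/-- The maximal sparsity `d*`: the largest number of nonzero entries of a `β j`. -/
noncomputable def dstar : ℕ := (Icc 1 (M.m + 1)).sup fun j => (vsupp (M.β j)).card

/-- The smallest jump `ν = min_{1 ≤ j ≤ m} ‖β (j+1) - β j‖₂`. -/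
noncomputable def nu : ℝ := ⨅ j : Icc 1 M.m, ‖M.β (j + 1) - M.β j‖

/-- The smallest segment length `min_{1 ≤ j ≤ m+1} (cp j - cp (j-1))`. -/
noncomputable def minSpacing : ℝ :=
  ⨅ j : Icc 1 (M.m + 1), ((M.cp j : ℝ) - (M.cp (j - 1) : ℝ))

/-- `log (p ∨ n)`. -/
noncomputable def logDim : ℝ := Real.log (max (M.p : ℝ) (M.n : ℝ))

/-- The distributional assumption on covariates and errors. -/
def AssumptionE1 [MeasurableSpace Ω] (P : Measure Ω) (C₁ C₂ C₃ : ℝ) : Prop :=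
  (∀ t ∈ Icc 1 M.n, Measurable (M.x t) ∧ Measurable (M.ε t)) ∧
  iIndepFun (fun (t : Icc 1 M.n) (ω : Ω) => (M.x t ω, M.ε t ω)) P ∧
  ∃ (S : ℕ → Matrix (Fin M.p) (Fin M.p) ℝ) (σx σε : ℕ → ℝ),
    ∀ j ∈ Icc 1 (M.m + 1),
      (∀ a : ℝ, Module.End.HasEigenvalue (Matrix.toLin' (S j)) a → 1 / C₁ ≤ a ∧ a ≤ C₁) ∧
      0 < σx j ∧ 1 / C₂ < σx j ^ 2 ∧ σx j ^ 2 < C₂ ∧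
      0 < σε j ∧ 1 / C₃ < σε j ^ 2 ∧ σε j ^ 2 < C₃ ∧
      (∀ t ∈ Ico (M.cp (j - 1)) (M.cp j),
        IsSubGaussianVec P (M.x t) (S j) (σx j) ∧
        IsSubGaussian P (M.ε t) (σε j) ∧
        ∫ ω, M.ε t ω ∂P = 0 ∧
        ∀ i, covariance (fun ω => M.x t ω i) (M.ε t) P = 0) ∧
      ∀ s ∈ Ico (M.cp (j - 1)) (M.cp j), ∀ t ∈ Ico (M.cp (j - 1)) (M.cp j),
        IdentDistrib (M.ε s) (M.ε t) P P

end MLRModel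

/-! ### Blocks and the block fused lasso -/

/-- The block end points `r_0 = 1 < r_1 < ⋯ < r_k = n + 1` with `k = ⌊n / b⌋`: all blocks have
length `b`, except that the last one also takes the remainder of `n` modulo `b`. -/
def blockEnd (n b i : ℕ) : ℕ := if i < n / b then 1 + i * b else n + 1

/-- The block fused lasso criterion at `θ_1, …, θ_k`, `k = ⌊n / b⌋`. On the `i`-th block
`[r_{i-1}, r_i)` the regression coefficient is `θ_1 + ⋯ + θ_i`. -/
noncomputable def fusedLassoObjective {p : ℕ} (n b : ℕ) (lam₁ lam₂ : ℝ)
    (x : ℕ → EuclideanSpace ℝ (Fin p)) (y : ℕ → ℝ) (θ : ℕ → EuclideanSpace ℝ (Fin p)) : ℝ :=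
  1 / (n : ℝ) * ∑ i ∈ Icc 1 (n / b), ∑ t ∈ Ico (blockEnd n b (i - 1)) (blockEnd n b i),
      (y t - inner ℝ (x t) (∑ l ∈ Icc 1 i, θ l)) ^ 2
    + lam₁ * ∑ i ∈ Icc 1 (n / b), l1norm (θ i)
    + lam₂ * ∑ i ∈ Icc 1 (n / b), l1norm (∑ l ∈ Icc 1 i, θ l)

/-- Indices of the blocks that survive the hard-thresholding of the jumps at level `w`. -/
noncomputable def candidateBlocks {p : ℕ} (k : ℕ) (w : ℝ) (θ : ℕ → EuclideanSpace ℝ (Fin p)) :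
    Finset ℕ :=
  {i ∈ Icc 2 k | w < ‖θ i‖}

/-! ### Clustering of the candidate points -/

/-- `R 1 < R 2 < ⋯ < R m` is a partition of `A` into nonempty sets of consecutive elements. -/
def IsOrderedPartition (A : Finset ℕ) (m : ℕ) (R : ℕ → Finset ℕ) : Prop :=
  (∀ j ∈ Icc 1 m, (R j).Nonempty) ∧
  (∀ i ∈ Icc 1 m, ∀ j ∈ Icc 1 m, i < j → ∀ a ∈ R i, ∀ a' ∈ R j, a < a') ∧
  (Icc 1 m).biUnion R = A

/-- `R 1, …, R m` is a result of the block clustering of `A`: starting from some partition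
`R' 1, …, R' m'` of `A` all of whose members have diameter at most `κ₁ b`, contiguous clusters
whose distance `min (R' (i+1)) - max (R' i)` is at most `κ₂ b` have been merged. Nothing is
required of the starting partition except the diameter bound, so that every criterion for choosing
the number of its clusters (gap statistics, for instance) is covered. -/
def IsBlockClustering (κ₁ κ₂ : ℝ) (b : ℕ) (A : Finset ℕ) (m : ℕ) (R : ℕ → Finset ℕ) : Prop :=
  IsOrderedPartition A m R ∧
  ∃ (m' : ℕ) (R' : ℕ → Finset ℕ), IsOrderedPartition A m' R' ∧
    (∀ i ∈ Icc 1 m', ∀ a ∈ R' i, ∀ a' ∈ R' i, (a' : ℝ) - (a : ℝ) ≤ κ₁ * b) ∧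
    (∀ i ∈ Icc 1 m', ∃ j ∈ Icc 1 m, R' i ⊆ R j) ∧
    ∀ i ∈ Icc 1 m', i + 1 ∈ Icc 1 m' →
      ((∃ j ∈ Icc 1 m, R' i ∪ R' (i + 1) ⊆ R j) ↔
        ∃ a ∈ R' i, ∃ a' ∈ R' (i + 1), (a' : ℝ) - (a : ℝ) ≤ κ₂ * b)

/-! ### The three-step procedure -/

/-- Smallest element of a finite nonempty set of natural numbers. -/
noncomputable def smallest (A : Finset ℕ) : ℕ := sInf (A : Set ℕ)

/-- Largest element of a finite nonempty set of natural numbers. -/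
def largest (A : Finset ℕ) : ℕ := A.sup id

/-- What the procedure returns: the fused lasso solution `θ`, the number `mf` of clusters, the
clusters `J 1, …, J mf` of block indices, and the final change point estimates
`tf 1, …, tf mf`. -/
structure Output (p : ℕ) where
  θ : ℕ → EuclideanSpace ℝ (Fin p)
  mf : ℕ
  J : ℕ → Finset ℕ
  tf : ℕ → ℕ

namespace Output

variable {p : ℕ} (o : Output p)

/-- The index clusters with the conventions `J 0 = {1}` and `J (mf + 1) = {k}`. -/
def Jext (k j : ℕ) : Finset ℕ := if j = 0 then {1} else if j = o.mf + 1 then {k} else o.J j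

/-- The `j`-th cluster of candidate change points: block index `i` stands for time `r_{i-1}`. -/
def R (n b j : ℕ) : Finset ℕ := (o.J j).image fun i => blockEnd n b (i - 1)

/-- The coefficient estimate of the `j`-th segment,
`θ_1 + ⋯ + θ_U` with `U = ⌊(max (J (j-1)) + min (J j)) / 2⌋`. -/
noncomputable def betaHat (n b j : ℕ) : EuclideanSpace ℝ (Fin p) :=
  ∑ i ∈ Icc 1 ((largest (o.Jext (n / b) (j - 1)) + smallest (o.Jext (n / b) j)) / 2), o.θ i

/-- The search domain `(l_j, u_j)` of the local exhaustive search. -/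
noncomputable def searchDomain (n b j : ℕ) : Finset ℕ :=
  if (o.R n b j).card = 1 then Ioo (smallest (o.R n b j) - b) (largest (o.R n b j) + b)
  else Ioo (smallest (o.R n b j)) (largest (o.R n b j))

/-- The local least squares criterion for a change at time `s` near the `j`-th cluster. -/
noncomputable def localLoss (n b : ℕ) (x : ℕ → EuclideanSpace ℝ (Fin p)) (y : ℕ → ℝ)
    (j s : ℕ) : ℝ :=
  ∑ t ∈ Ico (smallest (o.R n b j) - b) s, (y t - inner ℝ (x t) (o.betaHat n b j)) ^ 2
    + ∑ t ∈ Ico s (largest (o.R n b j) + b), (y t - inner ℝ (x t) (o.betaHat n b (j + 1))) ^ 2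

/-- `o` is an output of the threshold block fused lasso procedure for the data `(x_t, y_t)`,
`1 ≤ t ≤ n`, with block size `b`, penalties `lam₁, lam₂`, jump threshold `w` and clustering
parameters `κ₁, κ₂`. (Where a minimizer is not unique, any one may be taken.) -/
def IsTBFL (n b : ℕ) (lam₁ lam₂ w κ₁ κ₂ : ℝ) (x : ℕ → EuclideanSpace ℝ (Fin p)) (y : ℕ → ℝ) :
    Prop :=
  (∀ θ' : ℕ → EuclideanSpace ℝ (Fin p),
    fusedLassoObjective n b lam₁ lam₂ x y o.θ ≤ fusedLassoObjective n b lam₁ lam₂ x y θ') ∧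
  IsOrderedPartition (candidateBlocks (n / b) w o.θ) o.mf o.J ∧
  IsBlockClustering κ₁ κ₂ b
    ((candidateBlocks (n / b) w o.θ).image fun i => blockEnd n b (i - 1)) o.mf (o.R n b) ∧
  ∀ j ∈ Icc 1 o.mf, o.tf j ∈ o.searchDomain n b j ∧
    ∀ s ∈ o.searchDomain n b j, o.localLoss n b x y j (o.tf j) ≤ o.localLoss n b x y j s

end Output

/-! ### Asymptotic probability statements

No measurability of the events is presupposed: `P r (E r)ᶜ` is the outer probability that `E r`
fails. -/

/-- The event `E r` has probability tending to one. -/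
def ProbTendsToOne {Ω : ℕ → Type*} [∀ r, MeasurableSpace (Ω r)] (P : ∀ r, Measure (Ω r))
    (E : ∀ r, Set (Ω r)) : Prop :=
  Filter.Tendsto (fun r => P r (E r)ᶜ) Filter.atTop (nhds 0)

/-- The `O_p` pattern for a family of events `E C r`, where `E C r` is the event
`X_r ≤ C a_r`: for every `δ > 0` there is a constant `C` such that, for all large `r`, the event
fails with probability at most `δ`. -/
def BoundedInProb {Ω : ℕ → Type*} [∀ r, MeasurableSpace (Ω r)] (P : ∀ r, Measure (Ω r))
    (E : ℝ → ∀ r, Set (Ω r)) : Prop :=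
  ∀ δ : ℝ, 0 < δ → ∃ C : ℝ, 0 < C ∧ ∀ᶠ r in Filter.atTop, P r (E C r)ᶜ ≤ ENNReal.ofReal δ

end TBFL

namespace TBFL

open MeasureTheory ProbabilityTheory Finset

/-! ### Exponential moments and Chernoff bounds -/

section Moments

variable {Ω : Type*} [MeasurableSpace Ω] {P : Measure Ω}

/-! All randomness is confined to one event, `Good`, whose complement has probability at most 8/n;
on it the argument is deterministic. Write L = log(p ∨ n), and let h be the length of a window
inside one segment, at least a fixed multiple of L. On the event, the noise is correlated with each
covariate by at most a multiple of √(hL), and the quadratic form ∑⟨x_t, v⟩² is comparable to h‖v‖²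
up to a loss of order L‖v‖₁². The quadratic bounds come from a union bound over signed sums of s ≍
h/L basis vectors, extended to all v by Maurey's empirical method (`form_ge_of_signedSum`). The
jumps β_{j+1} - β_j get bounds without the ℓ¹ loss: the location step uses windows that may be much
shorter than d*L, where that loss would swallow the quadratic form.

The fused lasso is analysed one block at a time. Moving Δ from θ_i to θ_{i+1} changes the fit on
block i only and costs at most 2λ₁‖Δ‖₁ in the fusion penalty. Since λ₂ dominates both λ₁ and the
noise, every block inside a segment behaves as an ordinary lasso with error E ≍ √(d*L/b)
(`block_error`). Nothing is claimed about a block that contains a change point in its interior.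
Hence ‖θ_i‖ ≤ 2E unless a change point is less than b away, whereas across a change point two
consecutive θ's add up to the jump within 2E, so one of them exceeds the threshold c_ω ν; this uses
c_ω < 1/2 and E small compared with ν. The candidates therefore form one group of diameter at most b
per change point, with gaps larger than κ_max b, and every admissible clustering returns exactly
these groups (`IsBlockClustering.eq_of_label`). Each β̂_j is the fit on a block midway between two
groups, so it inherits the block error.

If the local search misses t_j, the observations between t_j and its estimate are fitted by the
coefficient of the wrong segment, and optimality says that this fits no worse than the right one. By
`fit_comparison` the signal h‖jump‖² is then bounded by noise and estimation error, which
`signal_dominates` excludes once h exceeds k²d*L/ν². Bounded entries give ν² ≲ d*, so windows that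
long are covered by the good event. Finally, each false positive contributes at least the threshold
to ‖β̂_j - β_j‖₁ ≲ √d* E, which bounds their number by a multiple of d*. -/

lemma natCast_pow_div_factorial_le (q : ℕ) : (q : ℝ) ^ q / (q.factorial : ℝ) ≤ Real.exp 1 ^ q := by
  have := Real.pow_div_factorial_le_exp (q : ℝ) (Nat.cast_nonneg q) q
  rwa [← Real.exp_one_pow] at this

lemma IsSubGaussian.lintegral_sq_pow_le {X : Ω → ℝ} {σ : ℝ} (hσ : 0 < σ)
    (h : IsSubGaussian P X σ) (q : ℕ) (hq : 1 ≤ q) :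
    ∫⁻ ω, ENNReal.ofReal ((X ω ^ 2) ^ q) ∂P ≤ ENNReal.ofReal ((σ ^ 2 * (2 * q)) ^ q) := by
  have hq' : (1 : ℝ) ≤ q := by exact_mod_cast hq
  have h1 := h (2 * q) (by linarith)
  have hpos : 0 < 2 * (q : ℝ) := by linarith
  rw [eLpNorm_eq_lintegral_rpow_enorm_toReal (by rw [Ne, ENNReal.ofReal_eq_zero]; exact hpos.not_ge) ENNReal.ofReal_ne_top,
    ENNReal.toReal_ofReal hpos.le] at h1
  have h2 := ENNReal.rpow_le_rpow h1 hpos.le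
  rw [← ENNReal.rpow_mul, one_div, inv_mul_cancel₀ hpos.ne', ENNReal.rpow_one,
    ENNReal.ofReal_rpow_of_nonneg (by positivity) hpos.le] at h2
  have e1 : (σ * √(2 * q)) ^ (2 * (q : ℝ)) = (σ ^ 2 * (2 * q)) ^ q := by
    rw [Real.rpow_mul (by positivity), Real.rpow_natCast]
    congr 1
    rw [Real.rpow_two, mul_pow, Real.sq_sqrt hpos.le]
  rw [e1] at h2
  refine le_trans (le_of_eq ?_) h2
  refine lintegral_congr fun ω => ?_
  rw [Real.enorm_eq_ofReal_abs, ENNReal.ofReal_rpow_of_nonneg (abs_nonneg _) hpos.le,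
    Real.rpow_mul (abs_nonneg _), Real.rpow_natCast, Real.rpow_two, sq_abs]

/-- Integrate the exponential series termwise: the moment bound and q^q/q! ≤ e^q make the q-th term
at most (2eκσ²)^q ≤ 2^(-q). -/
lemma IsSubGaussian.lintegral_exp_sq_le [IsProbabilityMeasure P] {X : Ω → ℝ} (hX : Measurable X)
    {σ κ : ℝ} (hσ : 0 < σ) (hκ : 0 ≤ κ) (hκσ : 4 * Real.exp 1 * κ * σ ^ 2 ≤ 1)
    (h : IsSubGaussian P X σ) : ∫⁻ ω, ENNReal.ofReal (Real.exp (κ * X ω ^ 2)) ∂P ≤ 2 := by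
  have hexp : ∀ ω, ENNReal.ofReal (Real.exp (κ * X ω ^ 2))
      = ∑' q : ℕ, ENNReal.ofReal ((κ * X ω ^ 2) ^ q / (q.factorial : ℝ)) := by
    intro ω
    have hs := NormedSpace.expSeries_div_hasSum_exp (κ * X ω ^ 2)
    rw [← Real.exp_eq_exp_ℝ] at hs
    rw [← hs.tsum_eq, ENNReal.ofReal_tsum_of_nonneg (fun q => by positivity) hs.summable]
  simp_rw [hexp]
  rw [lintegral_tsum (fun q => by fun_prop)]
  have hterm : ∀ q : ℕ, ∫⁻ ω, ENNReal.ofReal ((κ * X ω ^ 2) ^ q / (q.factorial : ℝ)) ∂P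
      ≤ ENNReal.ofReal ((1 / 2) ^ q) := by
    intro q
    rcases Nat.eq_zero_or_pos q with rfl | hq
    · simp
    have e : ∀ ω, ENNReal.ofReal ((κ * X ω ^ 2) ^ q / (q.factorial : ℝ))
        = ENNReal.ofReal (κ ^ q / (q.factorial : ℝ)) * ENNReal.ofReal ((X ω ^ 2) ^ q) := by
      intro ω
      rw [← ENNReal.ofReal_mul (by positivity), mul_pow]
      congr 1; ring
    simp_rw [e]
    rw [lintegral_const_mul _ (by fun_prop)]
    refine (mul_le_mul_right (h.lintegral_sq_pow_le hσ q hq) _).trans ?_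
    rw [← ENNReal.ofReal_mul (by positivity)]
    refine ENNReal.ofReal_le_ofReal ?_
    have hb := natCast_pow_div_factorial_le q
    calc κ ^ q / (q.factorial : ℝ) * (σ ^ 2 * (2 * q)) ^ q
        = (2 * κ * σ ^ 2) ^ q * ((q : ℝ) ^ q / (q.factorial : ℝ)) := by
          simp only [mul_pow]; ring
      _ ≤ (2 * κ * σ ^ 2) ^ q * Real.exp 1 ^ q := by gcongr
      _ = (2 * κ * σ ^ 2 * Real.exp 1) ^ q := by rw [mul_pow _ (Real.exp 1)]
      _ ≤ (1 / 2) ^ q := by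
          refine pow_le_pow_left₀ (by positivity) ?_ q
          linarith
  refine (ENNReal.tsum_le_tsum hterm).trans ?_
  rw [← ENNReal.ofReal_tsum_of_nonneg (fun q => by positivity) summable_geometric_two,
    tsum_geometric_two]
  simp

lemma exp_le_one_add_add_sq (y : ℝ) : Real.exp y ≤ 1 + y + y ^ 2 * Real.exp |y| := by
  have h := Complex.norm_exp_sub_sum_le_norm_mul_exp (y : ℂ) 2
  have e : Complex.exp (y : ℂ) - ∑ m ∈ range 2, (y : ℂ) ^ m / (m.factorial : ℂ)
      = ((Real.exp y - (1 + y) : ℝ) : ℂ) := by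
    simp [Finset.sum_range_succ]
  rw [e, Complex.norm_real, Complex.norm_real, Real.norm_eq_abs, Real.norm_eq_abs, sq_abs] at h
  linarith [le_abs_self (Real.exp y - (1 + y))]

/-- If `exp (2a|f|)` has expectation at most `2`, then `f` is locally sub-Gaussian. -/
lemma lintegral_exp_mul_le [IsProbabilityMeasure P] {f : Ω → ℝ} (hf : Measurable f) {a l : ℝ}
    (ha : 0 < a) (hl : |l| ≤ a)
    (h : ∫⁻ ω, ENNReal.ofReal (Real.exp (2 * a * |f ω|)) ∂P ≤ 2) :
    ∫⁻ ω, ENNReal.ofReal (Real.exp (l * f ω)) ∂P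
      ≤ ENNReal.ofReal (Real.exp (l * ∫ ω, f ω ∂P + 4 * (l / a) ^ 2)) := by
  have hG : Integrable (fun ω => Real.exp (2 * a * |f ω|)) P := by
    refine ⟨by fun_prop, ?_⟩
    rw [hasFiniteIntegral_iff_ofReal (.of_forall fun ω => (Real.exp_pos _).le)]
    exact h.trans_lt (by simp)
  have hGle : ∫ ω, Real.exp (2 * a * |f ω|) ∂P ≤ 2 := by
    rw [integral_eq_lintegral_of_nonneg_ae (.of_forall fun ω => (Real.exp_pos _).le) (by fun_prop)]
    exact ENNReal.toReal_le_of_le_ofReal (by norm_num) (by simpa using h)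
  have hfi : Integrable f P := by
    refine (hG.const_mul (1 / (2 * a))).mono (by fun_prop) (.of_forall fun ω => ?_)
    rw [Real.norm_eq_abs, Real.norm_of_nonneg (by positivity), one_div, inv_mul_eq_div,
      le_div_iff₀ (by positivity)]
    linarith [Real.add_one_le_exp (2 * a * |f ω|)]
  -- An integrable majorant of exp(l f): the Taylor remainder (lf)² exp|lf| is controlled through
  -- (a|f|)² ≤ 2 exp(a|f|) and |l| ≤ a.
  set g : Ω → ℝ := fun ω => 1 + l * f ω + 2 * (l / a) ^ 2 * Real.exp (2 * a * |f ω|) with hg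
  have hfg : ∀ ω, Real.exp (l * f ω) ≤ g ω := by
    intro ω
    refine (exp_le_one_add_add_sq _).trans ?_
    have h1 : (a * |f ω|) ^ 2 ≤ 2 * Real.exp (a * |f ω|) := by
      have := Real.quadratic_le_exp_of_nonneg (x := a * |f ω|) (by positivity)
      have : 0 ≤ a * |f ω| := by positivity
      linarith
    have h2 : Real.exp |l * f ω| ≤ Real.exp (a * |f ω|) := by
      rw [Real.exp_le_exp, abs_mul]; gcongr
    have h3 : (l * f ω) ^ 2 = (l / a) ^ 2 * (a * |f ω|) ^ 2 := by
      rw [mul_pow a, sq_abs]; field_simp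
    have h4 : Real.exp (2 * a * |f ω|) = Real.exp (a * |f ω|) * Real.exp (a * |f ω|) := by
      rw [← Real.exp_add]; ring_nf
    rw [hg]
    simp only
    rw [h3, h4]
    have : (l / a) ^ 2 * (a * |f ω|) ^ 2 * Real.exp |l * f ω|
        ≤ (l / a) ^ 2 * (2 * Real.exp (a * |f ω|)) * Real.exp (a * |f ω|) := by gcongr
    linarith
  have hgi : Integrable g P := ((integrable_const 1).add (hfi.const_mul l)).add (hG.const_mul _)
  calc ∫⁻ ω, ENNReal.ofReal (Real.exp (l * f ω)) ∂P ≤ ∫⁻ ω, ENNReal.ofReal (g ω) ∂P :=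
        lintegral_mono fun ω => ENNReal.ofReal_le_ofReal (hfg ω)
    _ = ENNReal.ofReal (∫ ω, g ω ∂P) := (ofReal_integral_eq_lintegral_ofReal hgi
        (.of_forall fun ω => (Real.exp_pos _).le.trans (hfg ω))).symm
    _ ≤ _ := by
        refine ENNReal.ofReal_le_ofReal ?_
        have e : ∫ ω, g ω ∂P
            = 1 + l * ∫ ω, f ω ∂P + 2 * (l / a) ^ 2 * ∫ ω, Real.exp (2 * a * |f ω|) ∂P := by
          have hi : Integrable (fun ω => 1 + l * f ω) P :=
            (integrable_const 1).add (hfi.const_mul l)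
          rw [hg, integral_add hi (hG.const_mul _),
            integral_add (integrable_const 1) (hfi.const_mul l), integral_const_mul,
            integral_const_mul]
          simp
        rw [e]
        have : 2 * (l / a) ^ 2 * ∫ ω, Real.exp (2 * a * |f ω|) ∂P ≤ 2 * (l / a) ^ 2 * 2 := by
          gcongr
        linarith [Real.add_one_le_exp (l * ∫ ω, f ω ∂P + 4 * (l / a) ^ 2)]

/-- Chernoff's bound with exponent 1; a free exponent is absorbed into `f` when the lemma is
applied. -/
lemma measure_sum_ge_le [IsProbabilityMeasure P] {ι : Type*} (s : Finset ι) {f : ι → Ω → ℝ}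
    (hind : iIndepFun f P) (hm : ∀ i, Measurable (f i)) {a τ : ℝ}
    (h : ∀ i ∈ s, ∫⁻ ω, ENNReal.ofReal (Real.exp (f i ω)) ∂P ≤ ENNReal.ofReal (Real.exp a)) :
    P {ω | τ + s.card * a ≤ ∑ i ∈ s, f i ω} ≤ ENNReal.ofReal (Real.exp (-τ)) := by
  have hm' : ∀ i, Measurable fun ω => ENNReal.ofReal (Real.exp (f i ω)) := fun i => by
    have := hm i; fun_prop
  have hprod : ∫⁻ ω, ∏ i ∈ s, ENNReal.ofReal (Real.exp (f i ω)) ∂P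
      ≤ ENNReal.ofReal (Real.exp (s.card * a)) := by
    rw [lintegral_prod_eq_prod_lintegral_of_indepFun s
      (fun i ω => ENNReal.ofReal (Real.exp (f i ω)))
      (hind.comp (fun _ y => ENNReal.ofReal (Real.exp y)) (fun _ => by fun_prop)) hm']
    refine (Finset.prod_le_prod' h).trans ?_
    rw [Finset.prod_const, ← ENNReal.ofReal_pow (Real.exp_pos _).le, ← Real.exp_nat_mul]
  have hmk := mul_meas_ge_le_lintegral (μ := P)
    (f := fun ω => ∏ i ∈ s, ENNReal.ofReal (Real.exp (f i ω)))
    (Finset.measurable_prod s fun i _ => hm' i) (ENNReal.ofReal (Real.exp (τ + s.card * a)))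
  have hset : {ω | ENNReal.ofReal (Real.exp (τ + s.card * a))
      ≤ ∏ i ∈ s, ENNReal.ofReal (Real.exp (f i ω))} = {ω | τ + s.card * a ≤ ∑ i ∈ s, f i ω} := by
    ext ω
    simp only [Set.mem_ofPred_eq]
    rw [← ENNReal.ofReal_prod_of_nonneg (fun i _ => (Real.exp_pos _).le), ← Real.exp_sum,
      ENNReal.ofReal_le_ofReal_iff (Real.exp_pos _).le, Real.exp_le_exp]
  rw [hset] at hmk
  have h1 := hmk.trans hprod
  have hne : ENNReal.ofReal (Real.exp (τ + s.card * a)) ≠ 0 := by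
    simpa using Real.exp_pos _
  rw [mul_comm, ← ENNReal.le_div_iff_mul_le (.inl hne) (.inl ENNReal.ofReal_ne_top),
    ← ENNReal.ofReal_div_of_pos (Real.exp_pos _), ← Real.exp_sub] at h1
  refine h1.trans (ENNReal.ofReal_le_ofReal (Real.exp_le_exp.2 ?_))
  linarith

end Moments

/-! ### Tail bounds for sums over a window -/

section Tails

variable {Ω : Type*} [MeasurableSpace Ω] {P : Measure Ω} [IsProbabilityMeasure P]
  {I s : Finset ℕ} {f : ℕ → Ω → ℝ}

lemma measure_sum_ge_le_of_subset (hs : s ⊆ I) (hind : iIndepFun (fun t : I => f t) P)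
    (hm : ∀ t ∈ I, Measurable (f t)) {a τ : ℝ}
    (h : ∀ t ∈ s, ∫⁻ ω, ENNReal.ofReal (Real.exp (f t ω)) ∂P ≤ ENNReal.ofReal (Real.exp a)) :
    P {ω | τ + s.card * a ≤ ∑ t ∈ s, f t ω} ≤ ENNReal.ofReal (Real.exp (-τ)) := by
  have h1 := measure_sum_ge_le (P := P) (s.subtype (· ∈ I)) hind (fun t => hm t t.2) (a := a)
    (τ := τ) (fun t ht => h t (Finset.mem_subtype.1 ht))
  rw [Finset.card_subtype, Finset.filter_true_of_mem (fun t ht => hs ht)] at h1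
  convert h1 using 6 with ω
  exact (Finset.sum_subtype_of_mem (fun t => f t _) (fun t ht => hs ht)).symm

lemma measure_sum_sq_ge_le (hs : s ⊆ I) (hind : iIndepFun (fun t : I => f t) P)
    (hm : ∀ t ∈ I, Measurable (f t)) {κ : ℝ} (hκ : 0 < κ)
    (h : ∀ t ∈ s, ∫⁻ ω, ENNReal.ofReal (Real.exp (κ * f t ω ^ 2)) ∂P ≤ 2) :
    P {ω | 2 / κ * s.card ≤ ∑ t ∈ s, f t ω ^ 2} ≤ ENNReal.ofReal (Real.exp (-s.card)) := by
  have h1 := measure_sum_ge_le_of_subset (P := P) (f := fun t ω => κ * f t ω ^ 2) hs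
    (hind.comp (fun _ y => κ * y ^ 2) (fun _ => by fun_prop))
    (fun t ht => by have := hm t ht; fun_prop) (a := Real.log 2) (τ := s.card)
    (fun t ht => by rw [Real.exp_log (by norm_num)]; simpa using h t ht)
  refine (measure_mono fun ω hω => ?_).trans h1
  simp only [Set.mem_ofPred_eq] at hω ⊢
  rw [← Finset.mul_sum]
  rw [div_mul_eq_mul_div, div_le_iff₀ hκ] at hω
  have hlog : Real.log 2 ≤ 1 := by linarith [Real.log_two_lt_d9]
  have : (s.card : ℝ) * Real.log 2 ≤ s.card * 1 := by gcongr
  linarith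

lemma measure_sum_sq_le_le (hs : s ⊆ I) (hind : iIndepFun (fun t : I => f t) P)
    (hm : ∀ t ∈ I, Measurable (f t)) {κ V : ℝ} (hκ : 0 < κ) (hV : 0 < V) (hVκ : V * κ ≤ 1)
    (h : ∀ t ∈ s, ∫⁻ ω, ENNReal.ofReal (Real.exp (κ * f t ω ^ 2)) ∂P ≤ 2)
    (hvar : ∀ t ∈ s, V ≤ ∫ ω, f t ω ^ 2 ∂P) :
    P {ω | ∑ t ∈ s, f t ω ^ 2 ≤ V / 2 * s.card}
      ≤ ENNReal.ofReal (Real.exp (-(V ^ 2 * κ ^ 2 / 256 * s.card))) := by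
  -- Chosen so that the second-order term 4(l/(κ/2))² equals lV/4. Each summand -l f² then has
  -- log-moment at most -3lV/4, while the threshold V/2 corresponds to -lV/2; the slack lV/4 is
  -- V²κ²/256.
  set l : ℝ := V * κ ^ 2 / 64 with hl
  have hl0 : 0 < l := by positivity
  have hla : |(-l)| ≤ κ / 2 := by
    rw [abs_neg, abs_of_pos hl0, hl]
    nlinarith
  have h1 := measure_sum_ge_le_of_subset (P := P) (f := fun t ω => -l * f t ω ^ 2) hs
    (hind.comp (fun _ y => -l * y ^ 2) (fun _ => by fun_prop))
    (fun t ht => by have := hm t ht; fun_prop) (a := -(3 / 4 * l * V))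
    (τ := l * V / 4 * s.card)
    (fun t ht => by
      have hmt := hm t (hs ht)
      refine (lintegral_exp_mul_le (f := fun ω => f t ω ^ 2) (by fun_prop)
        (half_pos hκ) hla ?_).trans ?_
      · refine le_trans (le_of_eq (lintegral_congr fun ω => ?_)) (h t ht)
        rw [abs_of_nonneg (sq_nonneg _)]; ring_nf
      · refine ENNReal.ofReal_le_ofReal (Real.exp_le_exp.2 ?_)
        have e : 4 * (-l / (κ / 2)) ^ 2 = l * V / 4 := by
          rw [hl]; field_simp; ring
        rw [e]
        have := mul_le_mul_of_nonneg_left (hvar t ht) hl0.le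
        linarith)
  refine (measure_mono fun ω hω => ?_).trans (h1.trans (le_of_eq ?_))
  · simp only [Set.mem_ofPred_eq] at hω ⊢
    rw [← Finset.mul_sum]
    have := mul_le_mul_of_nonneg_left hω hl0.le
    linarith
  · congr 2; rw [hl]; ring

lemma measure_abs_sum_ge_le (hs : s ⊆ I) (hind : iIndepFun (fun t : I => f t) P)
    (hm : ∀ t ∈ I, Measurable (f t)) {κ L : ℝ} (hκ : 0 < κ) (hL : 0 < L) (hLs : L ≤ s.card)
    (h : ∀ t ∈ s, ∫⁻ ω, ENNReal.ofReal (Real.exp (κ * |f t ω|)) ∂P ≤ 2)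
    (hmean : ∀ t ∈ s, ∫ ω, f t ω ∂P = 0) :
    P {ω | 20 / κ * √(s.card * L) ≤ |∑ t ∈ s, f t ω|}
      ≤ ENNReal.ofReal (2 * Real.exp (-(6 * L))) := by
  have hc : (0 : ℝ) < s.card := hL.trans_le hLs
  -- With this l the second-order terms add up to 4L and the threshold becomes 10L, which leaves 6L
  -- in the exponent. The assumption L ≤ `s.card` keeps l in the admissible range.
  set l : ℝ := κ / 2 * √(L / s.card) with hl
  have hl0 : 0 < l := by positivity
  have hl1 : l ≤ κ / 2 := by
    have : √(L / s.card) ≤ 1 := by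
      rw [Real.sqrt_le_one]; exact (div_le_one hc).2 hLs
    rw [hl]; nlinarith
  have hll : l * √(s.card * L) = κ / 2 * L := by
    rw [hl, mul_assoc, ← Real.sqrt_mul (by positivity)]
    congr 1
    rw [show L / s.card * (s.card * L) = L ^ 2 by field_simp, Real.sqrt_sq hL.le]
  have key : ∀ r : ℝ, |r| = l → P {ω | 10 * L ≤ r * ∑ t ∈ s, f t ω}
      ≤ ENNReal.ofReal (Real.exp (-(6 * L))) := by
    intro r hr
    have h1 := measure_sum_ge_le_of_subset (P := P) (f := fun t ω => r * f t ω) hs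
      (hind.comp (fun _ y => r * y) (fun _ => by fun_prop))
      (fun t ht => by have := hm t ht; fun_prop) (a := 4 * (L / s.card)) (τ := 6 * L)
      (fun t ht => by
        refine (lintegral_exp_mul_le (hm t (hs ht)) (half_pos hκ) (hr.trans_le hl1) ?_).trans ?_
        · refine le_trans (le_of_eq (lintegral_congr fun ω => ?_)) (h t ht)
          ring_nf
        · refine ENNReal.ofReal_le_ofReal (Real.exp_le_exp.2 ?_)
          rw [hmean t ht, mul_zero, zero_add, div_pow, ← sq_abs, hr, hl, mul_pow,
            Real.sq_sqrt (by positivity)]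
          field_simp
          exact le_rfl)
    refine (measure_mono fun ω hω => ?_).trans h1
    simp only [Set.mem_ofPred_eq] at hω ⊢
    rw [← Finset.mul_sum]
    have : (s.card : ℝ) * (4 * (L / s.card)) = 4 * L := by field_simp
    linarith
  have hsub : {ω | 20 / κ * √(s.card * L) ≤ |∑ t ∈ s, f t ω|}
      ⊆ {ω | 10 * L ≤ l * ∑ t ∈ s, f t ω} ∪ {ω | 10 * L ≤ -l * ∑ t ∈ s, f t ω} := by
    intro ω hω
    simp only [Set.mem_ofPred_eq, Set.mem_union] at hω ⊢
    have h2 := mul_le_mul_of_nonneg_left hω hl0.le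
    have h3 : l * (20 / κ * √(s.card * L)) = 10 * L := by
      rw [mul_left_comm, hll]; field_simp; ring
    rw [h3] at h2
    rcases abs_cases (∑ t ∈ s, f t ω) with ⟨h4, _⟩ | ⟨h4, _⟩
    · left; rwa [h4] at h2
    · right; rw [h4] at h2; linarith
  refine (measure_mono hsub).trans ((measure_union_le _ _).trans ?_)
  refine (add_le_add (key l (abs_of_pos hl0)) (key (-l) (by rw [abs_neg, abs_of_pos hl0]))).trans ?_
  rw [← ENNReal.ofReal_add (Real.exp_pos _).le (Real.exp_pos _).le, two_mul]

end Tails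

/-! ### Moments of linear functionals of sub-Gaussian vectors -/

section Functionals

variable {Ω : Type*} [MeasurableSpace Ω] {P : Measure Ω}

lemma IsSubGaussian.memLp_two {X : Ω → ℝ} {σ : ℝ} (hX : Measurable X)
    (h : IsSubGaussian P X σ) : MemLp X 2 P := by
  refine ⟨hX.aestronglyMeasurable, ?_⟩
  have h2 := h 2 (by norm_num)
  rw [ENNReal.ofReal_ofNat] at h2
  exact h2.trans_lt ENNReal.ofReal_lt_top

variable {p : ℕ} {x : Ω → EuclideanSpace ℝ (Fin p)} {S : Matrix (Fin p) (Fin p) ℝ} {σ : ℝ}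

lemma IsSubGaussianVec.memLp_coord (hx : Measurable x) (h : IsSubGaussianVec P x S σ)
    (i : Fin p) : MemLp (fun ω => x ω i) 2 P := by
  have h1 := h.2.2 (EuclideanSpace.single i 1) (by simp)
  have h2 := h1.memLp_two (by fun_prop)
  simpa [EuclideanSpace.inner_single_left] using h2

lemma IsSubGaussianVec.inner_left (h : IsSubGaussianVec P x S σ)
    {u : EuclideanSpace ℝ (Fin p)} (hu : ‖u‖ = 1) :
    IsSubGaussian P (fun ω => inner ℝ (x ω) u) σ := by
  have := h.2.2 u hu
  simpa only [real_inner_comm] using this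

lemma inner_eq_sum {p : ℕ} (v u : EuclideanSpace ℝ (Fin p)) : inner ℝ v u = ∑ i, v i * u i := by
  simp [PiLp.inner_apply, mul_comm]

/-- The smallest eigenvalue of a symmetric matrix bounds its quadratic form. -/
lemma le_quadratic_form_of_eigenvalues (hS : S.IsSymm) {V : ℝ}
    (h : ∀ a : ℝ, Module.End.HasEigenvalue (Matrix.toLin' S) a → V ≤ a)
    (u : EuclideanSpace ℝ (Fin p)) : V * ‖u‖ ^ 2 ≤ ∑ i, ∑ k, u i * u k * S i k := by
  have hH : (S - V • (1 : Matrix (Fin p) (Fin p) ℝ)).IsHermitian := by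
    rw [Matrix.IsHermitian, Matrix.conjTranspose_eq_transpose_of_trivial]
    simp [hS.eq]
  have hpsd := (hH.posSemidef_iff_eigenvalues_nonneg).2 (fun j => by
    have hv := hH.mulVec_eigenvectorBasis j
    have hne : (hH.eigenvectorBasis j).ofLp ≠ 0 := by
      intro h0
      have h1 := hH.eigenvectorBasis.orthonormal.1 j
      have h2 : hH.eigenvectorBasis j = 0 := by ext i; simp [h0]
      rw [h2, norm_zero] at h1
      exact zero_ne_one h1
    have hev : Module.End.HasEigenvalue (Matrix.toLin' S) (hH.eigenvalues j + V) := by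
      refine Module.End.hasEigenvalue_of_hasEigenvector
        (x := (hH.eigenvectorBasis j).ofLp) ⟨Module.End.mem_eigenspace_iff.2 ?_, hne⟩
      rw [Matrix.sub_mulVec, Matrix.smul_mulVec, Matrix.one_mulVec] at hv
      rw [Matrix.toLin'_apply, add_smul, ← hv, sub_add_cancel]
    simpa using h _ hev)
  have h1 := hpsd.dotProduct_mulVec_nonneg u.ofLp
  rw [Matrix.sub_mulVec, Matrix.smul_mulVec, Matrix.one_mulVec, dotProduct_sub,
    dotProduct_smul] at h1
  have e1 : star u.ofLp ⬝ᵥ u.ofLp = ‖u‖ ^ 2 := by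
    rw [EuclideanSpace.real_norm_sq_eq]; simp [dotProduct, sq]
  have e2 : star u.ofLp ⬝ᵥ S.mulVec u.ofLp = ∑ i, ∑ k, u i * u k * S i k := by
    simp only [dotProduct, Matrix.mulVec, Finset.mul_sum, star_trivial]
    exact Finset.sum_congr rfl fun i _ => Finset.sum_congr rfl fun k _ => by ring
  rw [e1, e2, smul_eq_mul] at h1
  linarith

lemma IsSubGaussianVec.integral_inner_sq (hx : Measurable x) (h : IsSubGaussianVec P x S σ)
    (u : EuclideanSpace ℝ (Fin p)) :
    ∫ ω, inner ℝ (x ω) u ^ 2 ∂P = ∑ i, ∑ k, u i * u k * S i k := by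
  have hint : ∀ i k, Integrable (fun ω => x ω i * x ω k) P := fun i k =>
    (h.memLp_coord hx i).integrable_mul (h.memLp_coord hx k)
  have hcov : ∀ i k, ∫ ω, x ω i * x ω k ∂P = S i k := by
    intro i k
    rw [← h.2.1 i k, covariance, h.1 i, h.1 k]
    simp
  have e : ∀ ω, inner ℝ (x ω) u ^ 2 = ∑ i, ∑ k, u i * u k * (x ω i * x ω k) := by
    intro ω
    rw [inner_eq_sum, sq, Finset.sum_mul_sum]
    exact Finset.sum_congr rfl fun i _ => Finset.sum_congr rfl fun k _ => by ring
  simp_rw [e]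
  rw [integral_finsetSum _ fun i _ => integrable_finsetSum _ fun k _ => (hint i k).const_mul _]
  refine Finset.sum_congr rfl fun i _ => ?_
  rw [integral_finsetSum _ fun k _ => (hint i k).const_mul _]
  refine Finset.sum_congr rfl fun k _ => ?_
  rw [integral_const_mul, hcov]

lemma IsSubGaussianVec.isSymm (h : IsSubGaussianVec P x S σ) : S.IsSymm := by
  ext i k
  rw [Matrix.transpose_apply, ← h.2.1, ← h.2.1, covariance_comm]

lemma IsSubGaussianVec.integral_mul_inner (hx : Measurable x) (h : IsSubGaussianVec P x S σ)
    {ε : Ω → ℝ} (hε : MemLp ε 2 P) (hmean : ∫ ω, ε ω ∂P = 0)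
    (hcov : ∀ i, covariance (fun ω => x ω i) ε P = 0) (u : EuclideanSpace ℝ (Fin p)) :
    ∫ ω, ε ω * inner ℝ (x ω) u ∂P = 0 := by
  have hint : ∀ i, Integrable (fun ω => x ω i * ε ω) P := fun i =>
    (h.memLp_coord hx i).integrable_mul hε
  have hz : ∀ i, ∫ ω, x ω i * ε ω ∂P = 0 := by
    intro i
    rw [← hcov i, covariance, h.1 i, hmean]
    simp
  have e : ∀ ω, ε ω * inner ℝ (x ω) u = ∑ i, u i * (x ω i * ε ω) := by
    intro ω
    rw [inner_eq_sum, Finset.mul_sum]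
    exact Finset.sum_congr rfl fun i _ => by ring
  simp_rw [e]
  rw [integral_finsetSum _ fun i _ => (hint i).const_mul _]
  exact Finset.sum_eq_zero fun i _ => by rw [integral_const_mul, hz, mul_zero]

/-- A product of two sub-Gaussian variables is sub-exponential: |XY| ≤ (X² + Y²)/2, followed by the
arithmetic-geometric mean inequality for the two exponentials. -/
lemma lintegral_exp_abs_mul_le {X Y : Ω → ℝ} (hX : Measurable X) (hY : Measurable Y) {κ : ℝ}
    (hκ : 0 ≤ κ)
    (h1 : ∫⁻ ω, ENNReal.ofReal (Real.exp (κ * X ω ^ 2)) ∂P ≤ 2)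
    (h2 : ∫⁻ ω, ENNReal.ofReal (Real.exp (κ * Y ω ^ 2)) ∂P ≤ 2) :
    ∫⁻ ω, ENNReal.ofReal (Real.exp (κ * |X ω * Y ω|)) ∂P ≤ 2 := by
  have hpt : ∀ ω, ENNReal.ofReal (Real.exp (κ * |X ω * Y ω|))
      ≤ ENNReal.ofReal (1 / 2) * (ENNReal.ofReal (Real.exp (κ * X ω ^ 2))
        + ENNReal.ofReal (Real.exp (κ * Y ω ^ 2))) := by
    intro ω
    rw [← ENNReal.ofReal_add (Real.exp_pos _).le (Real.exp_pos _).le,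
      ← ENNReal.ofReal_mul (by norm_num)]
    refine ENNReal.ofReal_le_ofReal ?_
    have hb : κ * |X ω * Y ω| ≤ κ * X ω ^ 2 / 2 + κ * Y ω ^ 2 / 2 := by
      rw [abs_mul]
      nlinarith [mul_nonneg hκ (sq_nonneg (|X ω| - |Y ω|)), sq_abs (X ω), sq_abs (Y ω)]
    refine (Real.exp_le_exp.2 hb).trans ?_
    rw [Real.exp_add]
    have e1 : Real.exp (κ * X ω ^ 2) = Real.exp (κ * X ω ^ 2 / 2) ^ 2 := by
      rw [← Real.exp_nat_mul]; congr 1; push_cast; ring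
    have e2 : Real.exp (κ * Y ω ^ 2) = Real.exp (κ * Y ω ^ 2 / 2) ^ 2 := by
      rw [← Real.exp_nat_mul]; congr 1; push_cast; ring
    rw [e1, e2]
    nlinarith [sq_nonneg (Real.exp (κ * X ω ^ 2 / 2) - Real.exp (κ * Y ω ^ 2 / 2))]
  refine (lintegral_mono hpt).trans ?_
  rw [lintegral_const_mul _ (by fun_prop), lintegral_add_left (by fun_prop)]
  refine (mul_le_mul_right (add_le_add h1 h2) _).trans (le_of_eq ?_)
  rw [show (2 : ENNReal) + 2 = ENNReal.ofReal 4 by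
    rw [ENNReal.ofReal_ofNat]; norm_num, ← ENNReal.ofReal_mul (by norm_num)]
  norm_num

end Functionals

/-! ### Maurey's empirical method for quadratic forms -/

section Maurey

/-- Bias-variance identity: for s independent draws from the points z_i with weights q_i, the mean
of the form at the shifted sum is its value at the mean plus s times the variance. Induction removes
the first draw and moves it into the shift a. -/
lemma sum_prod_weight_mul_form {V ι : Type*} [AddCommGroup V] [Module ℝ V] [Fintype ι]
    (B : V →ₗ[ℝ] V →ₗ[ℝ] ℝ) {q : ι → ℝ} (hq : ∑ i, q i = 1) (z : ι → V) (s : ℕ) (a : V) :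
    ∑ f : Fin s → ι, (∏ k, q (f k)) * B (a + ∑ k, z (f k)) (a + ∑ k, z (f k))
      = B (a + (s : ℝ) • ∑ i, q i • z i) (a + (s : ℝ) • ∑ i, q i • z i)
        + s * (∑ i, q i * B (z i) (z i) - B (∑ i, q i • z i) (∑ i, q i • z i)) := by
  set μ := ∑ i, q i • z i with hμ
  have step : ∀ c : V, ∑ i, q i * B (c + z i) (c + z i)
      = B (c + μ) (c + μ) + (∑ i, q i * B (z i) (z i) - B μ μ) := by
    intro c
    have e1 : B c μ = ∑ i, q i * B c (z i) := by simp [hμ, map_sum]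
    have e2 : B μ c = ∑ i, q i * B (z i) c := by simp [hμ, map_sum]
    have e3 : B c c = ∑ i, q i * B c c := by rw [← Finset.sum_mul, hq, one_mul]
    simp only [map_add, LinearMap.add_apply]
    rw [e1, e2]
    simp only [mul_add, Finset.sum_add_distrib]
    rw [← e3]
    ring
  induction s generalizing a with
  | zero => simp
  | succ s ih =>
    rw [← (Fin.consEquiv fun _ => ι).sum_comp, Fintype.sum_prod_type]
    have h1 : ∀ i : ι, ∑ f : Fin s → ι,
        (∏ k, q ((Fin.consEquiv fun _ => ι) (i, f) k))
          * B (a + ∑ k, z ((Fin.consEquiv fun _ => ι) (i, f) k))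
            (a + ∑ k, z ((Fin.consEquiv fun _ => ι) (i, f) k))
        = q i * (B (a + (s : ℝ) • μ + z i) (a + (s : ℝ) • μ + z i)
          + s * (∑ i, q i * B (z i) (z i) - B μ μ)) := by
      intro i
      rw [show a + (s : ℝ) • μ + z i = (a + z i) + (s : ℝ) • μ by abel, ← ih (a + z i),
        Finset.mul_sum]
      refine Finset.sum_congr rfl fun f _ => ?_
      simp only [Fin.consEquiv_apply, Fin.prod_univ_succ, Fin.sum_univ_succ, Fin.cons_zero,
        Fin.cons_succ]
      rw [mul_assoc, add_assoc]
    simp_rw [h1, mul_add (q _)]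
    rw [Finset.sum_add_distrib, step, ← Finset.sum_mul, hq]
    push_cast
    rw [add_smul, one_smul, ← add_assoc]
    ring

/-- The vectors `∑ ± e_i` with `s` summands. -/
noncomputable def signedSum {p s : ℕ} (g : Fin s → Fin p × Bool) : EuclideanSpace ℝ (Fin p) :=
  ∑ k, EuclideanSpace.single (g k).1 (if (g k).2 then (1 : ℝ) else -1)

lemma l1norm_nonneg {p : ℕ} (v : EuclideanSpace ℝ (Fin p)) : 0 ≤ l1norm v :=
  Finset.sum_nonneg fun _ _ => abs_nonneg _

/-- A quadratic form that is nonnegative at all signed sums of `s` basis vectors is almost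
nonnegative. -/
lemma form_ge_of_signedSum {p s : ℕ} (hs : 2 ≤ s)
    (B : EuclideanSpace ℝ (Fin p) →ₗ[ℝ] EuclideanSpace ℝ (Fin p) →ₗ[ℝ] ℝ)
    (hB : ∀ g : Fin s → Fin p × Bool, 0 ≤ B (signedSum g) (signedSum g)) {C : ℝ} (hC0 : 0 ≤ C)
    (hC : ∀ i, B (EuclideanSpace.single i 1) (EuclideanSpace.single i 1) ≤ C)
    (v : EuclideanSpace ℝ (Fin p)) : -(2 * C / s * l1norm v ^ 2) ≤ B v v := by
  rcases (l1norm_nonneg v).eq_or_lt with h0 | hr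
  · have hv : v = 0 := by
      ext i
      have := (Finset.sum_eq_zero_iff_of_nonneg (fun i _ => abs_nonneg (v i))).1 h0.symm i
        (Finset.mem_univ i)
      simpa using this
    rw [← h0, hv]; simp
  set r := l1norm v with hrdef
  set σ : Fin p → Bool := fun i => decide (0 ≤ v i) with hσ
  set e : Fin p → EuclideanSpace ℝ (Fin p) :=
    fun i => EuclideanSpace.single i (if σ i then (1 : ℝ) else -1) with he
  have hes : ∀ i, e i = (if σ i then (1 : ℝ) else -1) • EuclideanSpace.single i (1 : ℝ) := by
    intro i
    simp only [he]
    split_ifs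
    · ext j; simp
    · ext j
      simp only [PiLp.single_apply, PiLp.smul_apply, smul_eq_mul]
      split_ifs <;> simp
  have heB : ∀ i, B (e i) (e i) ≤ C := by
    intro i
    rw [hes]
    simp only [map_smul, LinearMap.smul_apply, smul_eq_mul]
    split_ifs <;> simpa using hC i
  have hq : ∑ i, |v i| / r = 1 := by
    rw [← Finset.sum_div]; exact div_self hr.ne'
  have hμ : ∑ i, (|v i| / r) • (r • e i) = v := by
    ext j
    simp only [WithLp.ofLp_sum, Finset.sum_apply, PiLp.smul_apply, smul_eq_mul, he,
      PiLp.single_apply]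
    rw [Finset.sum_eq_single j (fun i _ hij => by simp [hij.symm]) (by simp)]
    simp only [hσ, if_true]
    rcases le_or_gt 0 (v j) with h | h
    · simp [h, abs_of_nonneg h]; field_simp
    · simp [not_le.2 h, abs_of_neg h]; field_simp
  -- Draw r·sign(v_i)e_i with probability |v_i|/r. The mean is v, and every outcome of the sum is r
  -- times a signed sum, where the form is nonnegative.
  have key := sum_prod_weight_mul_form B hq (fun i => r • e i) s 0
  rw [hμ] at key
  have hnn : 0 ≤ ∑ f : Fin s → Fin p, (∏ k, |v (f k)| / r)
      * B (0 + ∑ k, r • e (f k)) (0 + ∑ k, r • e (f k)) := by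
    refine Finset.sum_nonneg fun f _ => mul_nonneg (Finset.prod_nonneg fun k _ => by positivity) ?_
    have : (0 : EuclideanSpace ℝ (Fin p)) + ∑ k, r • e (f k)
        = r • signedSum (fun k => (f k, σ (f k))) := by
      rw [zero_add, signedSum, ← Finset.smul_sum]
    rw [this]
    simp only [map_smul, LinearMap.smul_apply, smul_eq_mul]
    have := hB (fun k => (f k, σ (f k)))
    positivity
  rw [key] at hnn
  simp only [zero_add, map_smul, LinearMap.smul_apply, smul_eq_mul] at hnn
  have hsum : ∑ i, |v i| / r * (r * (r * B (e i) (e i))) ≤ C * r ^ 2 := by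
    calc ∑ i, |v i| / r * (r * (r * B (e i) (e i))) ≤ ∑ i, |v i| / r * (r * (r * C)) := by
          refine Finset.sum_le_sum fun i _ => ?_
          have := heB i
          gcongr
      _ = C * r ^ 2 := by rw [← Finset.sum_mul, hq]; ring
  have hs' : (2 : ℝ) ≤ s := by exact_mod_cast hs
  -- The identity gives s²B(v,v) + s(Cr² - B(v,v)) ≥ 0. Dividing by s and using s - 1 ≥ s/2 explains
  -- the factor 2 in the conclusion.
  have h1 : 0 ≤ ((s : ℝ) - 1) * B v v + C * r ^ 2 := by
    have : 0 ≤ (s : ℝ) * (((s : ℝ) - 1) * B v v + C * r ^ 2) := by nlinarith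
    exact nonneg_of_mul_nonneg_right this (by linarith)
  rcases le_or_gt 0 (B v v) with h2 | h2
  · refine le_trans ?_ h2
    have : 0 ≤ 2 * C / s * r ^ 2 := by positivity
    linarith
  · rw [neg_le_iff_add_nonneg, show 2 * C / s * r ^ 2 = 2 * (C * r ^ 2) / s by ring]
    have : 0 ≤ s * (B v v + 2 * (C * r ^ 2) / s) := by
      rw [mul_add, mul_div_cancel₀ _ (by linarith : (s : ℝ) ≠ 0)]
      nlinarith
    exact nonneg_of_mul_nonneg_right this (by linarith)

/-- Two-sided bounds for a sum of squares on signed sums extend to all vectors. -/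
lemma sum_sq_bounds_of_signedSum {p s : ℕ} (hs : 2 ≤ s) (W : Finset ℕ)
    (x : ℕ → EuclideanSpace ℝ (Fin p)) {c C : ℝ} (hc : 0 ≤ c) (hC : 0 ≤ C)
    (h : ∀ g : Fin s → Fin p × Bool,
      c * ‖signedSum g‖ ^ 2 ≤ ∑ t ∈ W, inner ℝ (x t) (signedSum g) ^ 2 ∧
      ∑ t ∈ W, inner ℝ (x t) (signedSum g) ^ 2 ≤ C * ‖signedSum g‖ ^ 2)
    (v : EuclideanSpace ℝ (Fin p)) :
    c * ‖v‖ ^ 2 - 2 * C / s * l1norm v ^ 2 ≤ ∑ t ∈ W, inner ℝ (x t) v ^ 2 ∧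
    ∑ t ∈ W, inner ℝ (x t) v ^ 2 ≤ C * ‖v‖ ^ 2 + 2 * C / s * l1norm v ^ 2 := by
  -- The pencil α∑⟨x_t,·⟩² + β‖·‖²: the pair (1, -c) yields the lower bound and (-1, C) the upper
  -- one. Diagonal entries are controlled by the constant signed sum s·e_i.
  set B : ℝ → ℝ → EuclideanSpace ℝ (Fin p) →ₗ[ℝ] EuclideanSpace ℝ (Fin p) →ₗ[ℝ] ℝ :=
    fun α β => α • ∑ t ∈ W, (innerₗ (EuclideanSpace ℝ (Fin p)) (x t)).smulRight
      (innerₗ (EuclideanSpace ℝ (Fin p)) (x t)) + β • innerₗ (EuclideanSpace ℝ (Fin p)) with hBdef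
  have hB : ∀ α β w, B α β w w = α * ∑ t ∈ W, inner ℝ (x t) w ^ 2 + β * ‖w‖ ^ 2 := by
    intro α β w
    simp [hBdef, LinearMap.sum_apply, sq]
  have hsingle : ∀ i : Fin p, ∑ t ∈ W, inner ℝ (x t) (EuclideanSpace.single i (1 : ℝ)) ^ 2 ≤ C := by
    intro i
    have h1 := (h (fun _ => (i, true))).2
    have e1 : signedSum (fun _ : Fin s => (i, true))
        = (s : ℝ) • EuclideanSpace.single i (1 : ℝ) := by
      simp [signedSum, Nat.cast_smul_eq_nsmul]
    rw [e1] at h1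
    simp only [inner_smul_right, mul_pow, ← Finset.mul_sum, norm_smul] at h1
    have hs' : (0 : ℝ) < s := by positivity
    rw [Real.norm_of_nonneg hs'.le, PiLp.norm_single, norm_one, one_pow, mul_one,
      mul_comm C] at h1
    exact le_of_mul_le_mul_left h1 (by positivity)
  constructor
  · have := form_ge_of_signedSum hs (B 1 (-c))
      (fun g => by rw [hB]; linarith [(h g).1]) hC
      (fun i => by
        rw [hB, PiLp.norm_single, norm_one]
        linarith [hsingle i]) v
    rw [hB] at this
    linarith
  · have := form_ge_of_signedSum hs (B (-1) C)
      (fun g => by rw [hB]; linarith [(h g).2]) hC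
      (fun i => by
        rw [hB, PiLp.norm_single, norm_one]
        have : 0 ≤ ∑ t ∈ W, inner ℝ (x t) (EuclideanSpace.single i (1 : ℝ)) ^ 2 :=
          Finset.sum_nonneg fun _ _ => sq_nonneg _
        linarith) v
    rw [hB] at this
    linarith

end Maurey

/-! ### Good windows -/

namespace MLRModel

variable {Ω : Type*} (M : MLRModel Ω)

/-- The regularity properties of the data in the window `[s, e)` which the analysis of the
procedure relies on. -/
def GoodAt (T c C : ℝ) (s e : ℕ) (ω : Ω) : Prop :=
  (∀ i, |∑ t ∈ Ico s e, M.ε t ω * M.x t ω i| ≤ T * √(((e : ℝ) - s) * M.logDim)) ∧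
  (∀ v, c * ((e : ℝ) - s) * ‖v‖ ^ 2 - C * M.logDim * l1norm v ^ 2
      ≤ ∑ t ∈ Ico s e, inner ℝ (M.x t ω) v ^ 2) ∧
  (∀ v, ∑ t ∈ Ico s e, inner ℝ (M.x t ω) v ^ 2
      ≤ C * (((e : ℝ) - s) * ‖v‖ ^ 2 + M.logDim * l1norm v ^ 2)) ∧
  (∀ l ∈ Icc 1 M.m, c * ((e : ℝ) - s) * ‖M.β (l + 1) - M.β l‖ ^ 2
      ≤ ∑ t ∈ Ico s e, inner ℝ (M.x t ω) (M.β (l + 1) - M.β l) ^ 2) ∧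
  ∀ l ∈ Icc 1 M.m, |∑ t ∈ Ico s e, M.ε t ω * inner ℝ (M.x t ω) (M.β (l + 1) - M.β l)|
      ≤ T * √(((e : ℝ) - s) * M.logDim) * ‖M.β (l + 1) - M.β l‖

/-- All sufficiently long windows inside a segment are good. -/
def Good (K T c C : ℝ) (ω : Ω) : Prop :=
  ∀ j ∈ Icc 1 (M.m + 1), ∀ s e : ℕ, M.cp (j - 1) ≤ s → s < e → e ≤ M.cp j →
    K * M.logDim ≤ (e : ℝ) - s → M.GoodAt T c C s e ω

lemma cp_lt_cp {i j : ℕ} (hij : i < j) (hj : j ≤ M.m + 1) : M.cp i < M.cp j := by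
  induction j, hij using Nat.le_induction with
  | base => exact M.cp_lt i (by omega)
  | succ j hij ih => exact (ih (by omega)).trans (M.cp_lt j (by omega))

lemma cp_le_cp {i j : ℕ} (hij : i ≤ j) (hj : j ≤ M.m + 1) : M.cp i ≤ M.cp j := by
  rcases hij.eq_or_lt with rfl | h
  · exact le_rfl
  · exact (M.cp_lt_cp h hj).le

lemma succ_le_cp {i : ℕ} (hi : i ≤ M.m + 1) : i + 1 ≤ M.cp i := by
  induction i with
  | zero => simp [M.cp_zero]
  | succ i ih =>
    have := M.cp_lt i (by omega)
    have := ih (by omega)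
    omega

lemma m_lt_n : M.m < M.n := by
  have := M.succ_le_cp le_rfl
  rw [M.cp_last] at this
  omega

lemma window_subset {j s e : ℕ} (hj : j ∈ Icc 1 (M.m + 1)) (hs : M.cp (j - 1) ≤ s)
    (he : e ≤ M.cp j) : Ico s e ⊆ Icc 1 M.n := by
  have hj' := Finset.mem_Icc.1 hj
  have h1 : 1 ≤ M.cp (j - 1) := by
    have := M.succ_le_cp (i := j - 1) (by omega); omega
  have h2 : M.cp j ≤ M.n + 1 := by
    rw [← M.cp_last]; exact M.cp_le_cp hj'.2 le_rfl
  intro t ht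
  rw [Finset.mem_Ico] at ht
  rw [Finset.mem_Icc]
  omega

/-- Moment bounds in a window that follow from the distributional assumption. -/
def WindowMoments [MeasurableSpace Ω] (P : Measure Ω) (κ V : ℝ) (s e : ℕ) : Prop :=
  ∀ t ∈ Ico s e, ∫⁻ ω, ENNReal.ofReal (Real.exp (κ * M.ε t ω ^ 2)) ∂P ≤ 2 ∧
    ∀ u : EuclideanSpace ℝ (Fin M.p), ‖u‖ = 1 →
      ∫⁻ ω, ENNReal.ofReal (Real.exp (κ * inner ℝ (M.x t ω) u ^ 2)) ∂P ≤ 2 ∧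
      V ≤ ∫ ω, inner ℝ (M.x t ω) u ^ 2 ∂P ∧
      ∫ ω, M.ε t ω * inner ℝ (M.x t ω) u ∂P = 0

variable [MeasurableSpace Ω] {P : Measure Ω} [IsProbabilityMeasure P] {M}

lemma AssumptionE1.windowMoments {Cx Csx Cse κ V : ℝ} (h : M.AssumptionE1 P Cx Csx Cse)
    (hκ : 0 ≤ κ) (h1 : 4 * Real.exp 1 * κ * Csx ≤ 1) (h2 : 4 * Real.exp 1 * κ * Cse ≤ 1)
    (hV : V ≤ 1 / Cx) {j s e : ℕ} (hj : j ∈ Icc 1 (M.m + 1)) (hs : M.cp (j - 1) ≤ s)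
    (he : e ≤ M.cp j) : M.WindowMoments P κ V s e := by
  obtain ⟨hmeas, -, S, σx, σε, hseg⟩ := h
  obtain ⟨hev, hσx, -, hσx2, hσε, -, hσε2, ht, -⟩ := hseg j hj
  intro t hts
  have htI := M.window_subset hj hs he hts
  rw [Finset.mem_Ico] at hts
  obtain ⟨hvec, hsub, hmean, hcov⟩ := ht t (Finset.mem_Ico.2 ⟨hs.trans hts.1, hts.2.trans_le he⟩)
  obtain ⟨hxm, hεm⟩ := hmeas t htI
  refine ⟨hsub.lintegral_exp_sq_le hεm hσε hκ ?_, fun u hu => ⟨?_, ?_, ?_⟩⟩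
  · refine le_trans ?_ h2
    gcongr
  · refine (hvec.inner_left hu).lintegral_exp_sq_le (by fun_prop) hσx hκ (le_trans ?_ h1)
    gcongr
  · rw [hvec.integral_inner_sq hxm]
    have := le_quadratic_form_of_eigenvalues hvec.isSymm (fun a ha => hV.trans (hev a ha).1) u
    rwa [hu, one_pow, mul_one] at this
  · exact hvec.integral_mul_inner hxm (hsub.memLp_two hεm) hmean hcov u

section Window

variable {κ V : ℝ} {s e : ℕ}
  (hmeas : ∀ t ∈ Icc 1 M.n, Measurable (M.x t) ∧ Measurable (M.ε t))
  (hind : iIndepFun (fun (t : Icc 1 M.n) (ω : Ω) => (M.x t ω, M.ε t ω)) P)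
  (hκ : 0 < κ) (hsub : Ico s e ⊆ Icc 1 M.n) (hse : s < e) (hmom : M.WindowMoments P κ V s e)

include hmeas hind hκ hsub hse hmom

lemma measure_quadratic_bad_le (hV : 0 < V) (hVκ : V * κ ≤ 1) (u : EuclideanSpace ℝ (Fin M.p)) :
    P {ω | ¬ (V / 2 * ((e : ℝ) - s) * ‖u‖ ^ 2 ≤ ∑ t ∈ Ico s e, inner ℝ (M.x t ω) u ^ 2 ∧
      ∑ t ∈ Ico s e, inner ℝ (M.x t ω) u ^ 2 ≤ 2 / κ * ((e : ℝ) - s) * ‖u‖ ^ 2)}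
      ≤ ENNReal.ofReal (2 * Real.exp (-(V ^ 2 * κ ^ 2 / 256 * ((e : ℝ) - s)))) := by
  rcases eq_or_ne u 0 with rfl | hu
  · simp
  have hcard : ((Ico s e).card : ℝ) = (e : ℝ) - s := by
    rw [Nat.card_Ico, Nat.cast_sub hse.le]
  have hh : (0 : ℝ) < (e : ℝ) - s := by
    rw [sub_pos]; exact_mod_cast hse
  set w := ‖u‖⁻¹ • u with hw
  have hw1 : ‖w‖ = 1 := norm_smul_inv_norm hu
  have hun : 0 < ‖u‖ := norm_pos_iff.2 hu
  have huw : u = ‖u‖ • w := by rw [hw, smul_smul, mul_inv_cancel₀ hun.ne', one_smul]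
  have hsum : ∀ ω, ∑ t ∈ Ico s e, inner ℝ (M.x t ω) u ^ 2
      = ‖u‖ ^ 2 * ∑ t ∈ Ico s e, inner ℝ (M.x t ω) w ^ 2 := by
    intro ω
    rw [Finset.mul_sum]
    refine Finset.sum_congr rfl fun t _ => ?_
    conv_lhs => rw [huw]
    rw [inner_smul_right, mul_pow]
  have hind' : iIndepFun (fun (t : Icc 1 M.n) (ω : Ω) => inner ℝ (M.x t ω) w) P :=
    hind.comp (fun _ z => inner ℝ z.1 w) (fun _ => by fun_prop)
  have hm' : ∀ t ∈ Icc 1 M.n, Measurable fun ω => inner ℝ (M.x t ω) w := fun t ht => by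
    have := (hmeas t ht).1; fun_prop
  have hA := measure_sum_sq_ge_le (f := fun t ω => inner ℝ (M.x t ω) w) hsub hind' hm' hκ
    (fun t ht => ((hmom t ht).2 w hw1).1)
  have hB := measure_sum_sq_le_le (f := fun t ω => inner ℝ (M.x t ω) w) hsub hind' hm' hκ hV hVκ
    (fun t ht => ((hmom t ht).2 w hw1).1) (fun t ht => ((hmom t ht).2 w hw1).2.1)
  rw [hcard] at hA hB
  refine (measure_mono (fun ω hω => ?_)).trans ((measure_union_le _ _).trans
    ((add_le_add hB hA).trans ?_))
  · simp only [Set.mem_ofPred_eq, Set.mem_union, hsum] at hω ⊢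
    by_contra hcon
    push Not at hcon
    refine hω ⟨?_, ?_⟩
    · rw [mul_comm]; gcongr; exact hcon.1.le
    · rw [mul_comm]; gcongr; exact hcon.2.le
  · rw [← ENNReal.ofReal_add (Real.exp_pos _).le (Real.exp_pos _).le, two_mul]
    refine ENNReal.ofReal_le_ofReal ?_
    gcongr
    have : V ^ 2 * κ ^ 2 ≤ 1 := by rw [← mul_pow]; exact pow_le_one₀ (by positivity) hVκ
    nlinarith

lemma measure_noise_bad_le {L : ℝ} (hL : 0 < L) (hLh : L ≤ (e : ℝ) - s)
    (u : EuclideanSpace ℝ (Fin M.p)) :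
    P {ω | ¬ |∑ t ∈ Ico s e, M.ε t ω * inner ℝ (M.x t ω) u|
        ≤ 20 / κ * √(((e : ℝ) - s) * L) * ‖u‖}
      ≤ ENNReal.ofReal (2 * Real.exp (-(6 * L))) := by
  rcases eq_or_ne u 0 with rfl | hu
  · simp
  have hcard : ((Ico s e).card : ℝ) = (e : ℝ) - s := by
    rw [Nat.card_Ico, Nat.cast_sub hse.le]
  set w := ‖u‖⁻¹ • u with hw
  have hw1 : ‖w‖ = 1 := norm_smul_inv_norm hu
  have hun : 0 < ‖u‖ := norm_pos_iff.2 hu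
  have huw : u = ‖u‖ • w := by rw [hw, smul_smul, mul_inv_cancel₀ hun.ne', one_smul]
  have hsum : ∀ ω, ∑ t ∈ Ico s e, M.ε t ω * inner ℝ (M.x t ω) u
      = ‖u‖ * ∑ t ∈ Ico s e, M.ε t ω * inner ℝ (M.x t ω) w := by
    intro ω
    rw [Finset.mul_sum]
    refine Finset.sum_congr rfl fun t _ => ?_
    conv_lhs => rw [huw]
    rw [inner_smul_right]; ring
  have hA := measure_abs_sum_ge_le (P := P)
    (f := fun t ω => M.ε t ω * inner ℝ (M.x t ω) w) hsub
    (hind.comp (fun _ z => z.2 * inner ℝ z.1 w) (fun _ => by fun_prop))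
    (fun t ht => by have := (hmeas t ht).1; have := (hmeas t ht).2; fun_prop) hκ hL
    (hLh.trans_eq hcard.symm)
    (fun t ht => by
      have h1 := (hmeas t (hsub ht)).1
      exact lintegral_exp_abs_mul_le (hmeas t (hsub ht)).2 (by fun_prop) hκ.le (hmom t ht).1
        ((hmom t ht).2 w hw1).1)
    (fun t ht => ((hmom t ht).2 w hw1).2.2)
  rw [hcard] at hA
  refine (measure_mono (fun ω hω => ?_)).trans hA
  simp only [Set.mem_ofPred_eq, hsum, not_le, abs_mul, abs_norm] at hω ⊢
  rw [mul_comm] at hω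
  exact (lt_of_mul_lt_mul_left hω hun.le).le

end Window
end MLRModel

/-! ### Union bounds for the good event. -/

lemma measure_biUnion_le_card_mul {Ω ι : Type*} [MeasurableSpace Ω] {P : Measure Ω} (s : Finset ι)
    (B : ι → Set Ω) {q N : ℝ} (hq : 0 ≤ q) (h : ∀ i ∈ s, P (B i) ≤ ENNReal.ofReal q)
    (hN : (s.card : ℝ) ≤ N) : P (⋃ i ∈ s, B i) ≤ ENNReal.ofReal (N * q) := by
  refine (measure_biUnion_finset_le s B).trans ((Finset.sum_le_card_nsmul s _ _ h).trans ?_)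
  rw [nsmul_eq_mul, ← ENNReal.ofReal_natCast, ← ENNReal.ofReal_mul (Nat.cast_nonneg _)]
  exact ENNReal.ofReal_le_ofReal (by gcongr)

namespace MLRModel

section LogDim

variable {Ω : Type*} {M : MLRModel Ω}

lemma exp_logDim (hn : 2 ≤ M.n) : Real.exp M.logDim = max (M.p : ℝ) (M.n : ℝ) := by
  have : (0 : ℝ) < M.n := by exact_mod_cast (by omega : 0 < M.n)
  exact Real.exp_log (lt_max_of_lt_right this)

lemma p_le_exp_logDim (hn : 2 ≤ M.n) : (M.p : ℝ) ≤ Real.exp M.logDim := by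
  rw [exp_logDim hn]; exact le_max_left _ _

lemma n_le_exp_logDim (hn : 2 ≤ M.n) : (M.n : ℝ) ≤ Real.exp M.logDim := by
  rw [exp_logDim hn]; exact le_max_right _ _

lemma two_le_exp_logDim (hn : 2 ≤ M.n) : 2 ≤ Real.exp M.logDim :=
  le_trans (by exact_mod_cast hn) (n_le_exp_logDim hn)

lemma logDim_pos (hn : 2 ≤ M.n) : 0 < M.logDim := by
  rw [← Real.exp_lt_exp, Real.exp_zero]
  linarith [two_le_exp_logDim hn]

end LogDim

variable {Ω : Type*} {M : MLRModel Ω} [MeasurableSpace Ω] {P : Measure Ω} [IsProbabilityMeasure P]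

lemma measure_not_goodAt_le {κ V : ℝ} {s e : ℕ}
    (hmeas : ∀ t ∈ Icc 1 M.n, Measurable (M.x t) ∧ Measurable (M.ε t))
    (hind : iIndepFun (fun (t : Icc 1 M.n) (ω : Ω) => (M.x t ω, M.ε t ω)) P)
    (hκ : 0 < κ) (hsub : Ico s e ⊆ Icc 1 M.n) (hse : s < e) (hmom : M.WindowMoments P κ V s e)
    (hV : 0 < V) (hVκ : V * κ ≤ 1) {ρ : ℝ} (hρ : ρ = V ^ 2 * κ ^ 2 / 256) (hn : 2 ≤ M.n)
    (hlen : 8 / ρ * M.logDim ≤ (e : ℝ) - s) :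
    P {ω | ¬ M.GoodAt (20 / κ) (V / 2) (32 / (κ * ρ)) s e ω}
      ≤ ENNReal.ofReal (8 * Real.exp (-(4 * M.logDim))) := by
  have hL := logDim_pos hn
  set L := M.logDim with hLdef
  set h : ℝ := (e : ℝ) - s with hh
  have hρ0 : 0 < ρ := by rw [hρ]; positivity
  have hρ1 : ρ ≤ 1 := by
    have : V ^ 2 * κ ^ 2 ≤ 1 := by rw [← mul_pow]; exact pow_le_one₀ (by positivity) hVκ
    rw [hρ]; linarith
  have hρh : 8 * L ≤ ρ * h := by
    rw [div_mul_eq_mul_div, div_le_iff₀ hρ0] at hlen; linarith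
  have hh0 : 0 < h := by
    by_contra hcon
    push Not at hcon
    nlinarith
  have hLh : L ≤ h := by nlinarith
  -- The largest sparsity the union bound can afford: there are (2p)^S ≤ exp(2LS) ≤ exp(ρh/2) signed
  -- sums, half of the available exponent ρh. The length condition gives S ≥ 2 and leaves exp(-ρh/2)
  -- ≤ exp(-4L); the Maurey loss 2(2h/κ)/S is then at most 32L/(κρ).
  set S : ℕ := ⌊ρ * h / (4 * L)⌋₊ with hS
  have hquot : 2 ≤ ρ * h / (4 * L) := by
    rw [le_div_iff₀ (by positivity)]; linarith
  have hS2 : 2 ≤ S := Nat.le_floor (by exact_mod_cast hquot)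
  have hSle : (S : ℝ) * (4 * L) ≤ ρ * h := by
    rw [← le_div_iff₀ (by positivity)]; exact Nat.floor_le (by linarith)
  have hSge : ρ * h / (8 * L) ≤ S := by
    have h1 := Nat.lt_floor_add_one (ρ * h / (4 * L))
    rw [← hS] at h1
    have h2 : ρ * h / (8 * L) = ρ * h / (4 * L) / 2 := by field_simp; norm_num
    linarith
  have hS0 : (0 : ℝ) < S := by positivity
  set BQ : EuclideanSpace ℝ (Fin M.p) → Set Ω := fun u =>
    {ω | ¬ (V / 2 * h * ‖u‖ ^ 2 ≤ ∑ t ∈ Ico s e, inner ℝ (M.x t ω) u ^ 2 ∧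
      ∑ t ∈ Ico s e, inner ℝ (M.x t ω) u ^ 2 ≤ 2 / κ * h * ‖u‖ ^ 2)} with hBQ
  set BN : EuclideanSpace ℝ (Fin M.p) → Set Ω := fun u =>
    {ω | ¬ |∑ t ∈ Ico s e, M.ε t ω * inner ℝ (M.x t ω) u| ≤ 20 / κ * √(h * L) * ‖u‖} with hBN
  have hQ : ∀ u, P (BQ u) ≤ ENNReal.ofReal (2 * Real.exp (-(ρ * h))) := by
    intro u
    have := measure_quadratic_bad_le hmeas hind hκ hsub hse hmom hV hVκ u
    rwa [← hρ] at this
  have hN : ∀ u, P (BN u) ≤ ENNReal.ofReal (2 * Real.exp (-(6 * L))) := fun u =>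
    measure_noise_bad_le hmeas hind hκ hsub hse hmom hL hLh u
  set D : ℕ → EuclideanSpace ℝ (Fin M.p) := fun l => M.β (l + 1) - M.β l with hD
  have hcover : {ω | ¬ M.GoodAt (20 / κ) (V / 2) (32 / (κ * ρ)) s e ω} ⊆
      (⋃ i ∈ (Finset.univ : Finset (Fin M.p)), BN (EuclideanSpace.single i 1)) ∪
      (⋃ l ∈ Icc 1 M.m, BN (D l)) ∪ (⋃ l ∈ Icc 1 M.m, BQ (D l)) ∪
      ⋃ g ∈ (Finset.univ : Finset (Fin S → Fin M.p × Bool)), BQ (signedSum g) := by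
    intro ω hω
    by_contra hcon
    simp only [Set.mem_union, Set.mem_iUnion, not_or, not_exists, hBN, hBQ,
      Set.mem_ofPred_eq, not_not] at hcon
    obtain ⟨⟨⟨h1, h2⟩, h3⟩, h4⟩ := hcon
    have hb := sum_sq_bounds_of_signedSum hS2 (Ico s e) (fun t => M.x t ω)
      (c := V / 2 * h) (C := 2 / κ * h) (by positivity) (by positivity)
      (fun g => h4 g (Finset.mem_univ g))
    have hC : 2 * (2 / κ * h) / S ≤ 32 / (κ * ρ) * L := by
      rw [div_le_iff₀ hS0]
      have : 32 / (κ * ρ) * L * (ρ * h / (8 * L)) = 2 * (2 / κ * h) := by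
        field_simp; norm_num
      rw [← this]
      gcongr
    refine hω ⟨fun i => ?_, fun v => ?_, fun v => ?_, fun l hl => (h3 l hl).1, h2⟩
    · have := h1 i (Finset.mem_univ i)
      simpa [EuclideanSpace.inner_single_right] using this
    · refine le_trans ?_ (hb v).1
      gcongr
    · have h5 : 2 / κ ≤ 32 / (κ * ρ) := by
        rw [div_le_div_iff₀ hκ (by positivity)]
        nlinarith
      have h6 := mul_le_mul_of_nonneg_right hC (sq_nonneg (l1norm v))
      have h7 := mul_le_mul_of_nonneg_right h5 (by positivity : 0 ≤ h * ‖v‖ ^ 2)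
      have h8 := (hb v).2
      change _ ≤ 32 / (κ * ρ) * (h * ‖v‖ ^ 2 + L * l1norm v ^ 2)
      linarith
  have hE := two_le_exp_logDim hn
  rw [← hLdef] at hE
  have hmE : ((Icc 1 M.m).card : ℝ) ≤ Real.exp L := by
    refine le_trans ?_ (n_le_exp_logDim hn)
    rw [Nat.card_Icc]
    have := M.m_lt_n
    exact_mod_cast (by omega)
  have hpE : ((Finset.univ : Finset (Fin M.p)).card : ℝ) ≤ Real.exp L := by
    rw [Finset.card_univ, Fintype.card_fin]; exact p_le_exp_logDim hn
  have hgE : ((Finset.univ : Finset (Fin S → Fin M.p × Bool)).card : ℝ)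
      ≤ Real.exp (ρ * h / 2) := by
    rw [Finset.card_univ, Fintype.card_fun, Fintype.card_prod, Fintype.card_fin,
      Fintype.card_fin, Fintype.card_bool]
    push_cast
    have h1 : (M.p : ℝ) * 2 ≤ Real.exp (2 * L) := by
      rw [two_mul, Real.exp_add]
      exact mul_le_mul (p_le_exp_logDim hn) hE (by norm_num) (Real.exp_pos _).le
    calc ((M.p : ℝ) * 2) ^ S ≤ Real.exp (2 * L) ^ S := by gcongr
      _ = Real.exp (S * (2 * L)) := by rw [← Real.exp_nat_mul]
      _ ≤ _ := Real.exp_le_exp.2 (by linarith)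
  have b1 := measure_biUnion_le_card_mul (P := P) (Finset.univ : Finset (Fin M.p))
    (fun i => BN (EuclideanSpace.single i 1)) (by positivity) (fun i _ => hN _) hpE
  have b2 := measure_biUnion_le_card_mul (P := P) (Icc 1 M.m) (fun l => BN (D l))
    (by positivity) (fun i _ => hN _) hmE
  have b3 := measure_biUnion_le_card_mul (P := P) (Icc 1 M.m) (fun l => BQ (D l))
    (by positivity) (fun i _ => hQ _) hmE
  have b4 := measure_biUnion_le_card_mul (P := P)
    (Finset.univ : Finset (Fin S → Fin M.p × Bool)) (fun g => BQ (signedSum g))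
    (by positivity) (fun i _ => hQ _) hgE
  refine (measure_mono hcover).trans ((measure_union_le _ _).trans ((add_le_add
    ((measure_union_le _ _).trans (add_le_add ((measure_union_le _ _).trans
      (add_le_add b1 b2)) b3)) b4).trans ?_))
  rw [← ENNReal.ofReal_add (by positivity) (by positivity),
    ← ENNReal.ofReal_add (by positivity) (by positivity),
    ← ENNReal.ofReal_add (by positivity) (by positivity)]
  refine ENNReal.ofReal_le_ofReal ?_
  have a1 : Real.exp L * (2 * Real.exp (-(6 * L))) ≤ 2 * Real.exp (-(4 * L)) := by
    rw [mul_left_comm, ← Real.exp_add]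
    have := Real.exp_le_exp.2 (show L + -(6 * L) ≤ -(4 * L) by linarith)
    linarith
  have a3 : Real.exp L * (2 * Real.exp (-(ρ * h))) ≤ 2 * Real.exp (-(4 * L)) := by
    rw [mul_left_comm, ← Real.exp_add]
    have := Real.exp_le_exp.2 (show L + -(ρ * h) ≤ -(4 * L) by linarith)
    linarith
  have a4 : Real.exp (ρ * h / 2) * (2 * Real.exp (-(ρ * h))) ≤ 2 * Real.exp (-(4 * L)) := by
    rw [mul_left_comm, ← Real.exp_add]
    have := Real.exp_le_exp.2 (show ρ * h / 2 + -(ρ * h) ≤ -(4 * L) by linarith)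
    linarith
  linarith

/-- At most n² ≤ exp(2L) windows, each failing with probability at most 8 exp(-4L), leave 8 exp(-2L)
≤ 8/n. -/
lemma measure_not_good_le {Cx Csx Cse κ V : ℝ} (hE1 : M.AssumptionE1 P Cx Csx Cse)
    (hκ : 0 < κ) (h1 : 4 * Real.exp 1 * κ * Csx ≤ 1) (h2 : 4 * Real.exp 1 * κ * Cse ≤ 1)
    (hV : 0 < V) (hVx : V ≤ 1 / Cx) (hVκ : V * κ ≤ 1) {ρ : ℝ} (hρ : ρ = V ^ 2 * κ ^ 2 / 256)
    (hn : 2 ≤ M.n) :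
    P {ω | ¬ M.Good (8 / ρ) (20 / κ) (V / 2) (32 / (κ * ρ)) ω}
      ≤ ENNReal.ofReal (8 / (M.n : ℝ)) := by
  classical
  set B : ℕ × ℕ → Set Ω := fun z =>
    {ω | (∃ j ∈ Icc 1 (M.m + 1), M.cp (j - 1) ≤ z.1 ∧ z.1 < z.2 ∧ z.2 ≤ M.cp j ∧
      8 / ρ * M.logDim ≤ (z.2 : ℝ) - z.1) ∧ ¬ M.GoodAt (20 / κ) (V / 2) (32 / (κ * ρ)) z.1 z.2 ω}
    with hB
  have hBz : ∀ z ∈ Icc 1 M.n ×ˢ Icc 2 (M.n + 1), P (B z)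
      ≤ ENNReal.ofReal (8 * Real.exp (-(4 * M.logDim))) := by
    rintro ⟨s, e⟩ -
    by_cases hz : ∃ j ∈ Icc 1 (M.m + 1), M.cp (j - 1) ≤ s ∧ s < e ∧ e ≤ M.cp j ∧
      8 / ρ * M.logDim ≤ (e : ℝ) - s
    · obtain ⟨j, hj, hs, hse, he, hlen⟩ := hz
      refine (measure_mono fun ω hω => hω.2).trans
        (measure_not_goodAt_le hE1.1 hE1.2.1 hκ (M.window_subset hj hs he) hse
          (hE1.windowMoments hκ.le h1 h2 hVx hj hs he) hV hVκ hρ hn hlen)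
    · have : B (s, e) = ∅ := by
        ext ω
        simp only [hB, Set.mem_ofPred_eq, Set.mem_empty_iff_false, iff_false]
        exact fun hω => hz hω.1
      rw [this, measure_empty]
      exact zero_le
  have hcover : {ω | ¬ M.Good (8 / ρ) (20 / κ) (V / 2) (32 / (κ * ρ)) ω}
      ⊆ ⋃ z ∈ Icc 1 M.n ×ˢ Icc 2 (M.n + 1), B z := by
    intro ω hω
    simp only [Good, Set.mem_ofPred_eq, not_forall] at hω
    obtain ⟨j, hj, s, e, hs, hse, he, hlen, hbad⟩ := hω
    have hwin := M.window_subset hj hs he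
    have m1 := Finset.mem_Icc.1 (hwin (Finset.left_mem_Ico.2 hse))
    have m2 := Finset.mem_Icc.1 (hwin (Finset.mem_Ico.2 (⟨by omega, by omega⟩ : s ≤ e - 1 ∧ e - 1 < e)))
    simp only [Set.mem_iUnion]
    exact ⟨(s, e), Finset.mem_product.2 ⟨Finset.mem_Icc.2 m1, Finset.mem_Icc.2 (by
      constructor <;> simp only <;> omega)⟩, ⟨j, hj, hs, hse, he, hlen⟩, hbad⟩
  have hE := n_le_exp_logDim hn
  have hn0 : (0 : ℝ) < M.n := by exact_mod_cast (by omega : 0 < M.n)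
  refine (measure_mono hcover).trans ((measure_biUnion_le_card_mul _ B (by positivity) hBz
    (N := Real.exp M.logDim * Real.exp M.logDim) ?_).trans (ENNReal.ofReal_le_ofReal ?_))
  · rw [Finset.card_product, Nat.card_Icc, Nat.card_Icc]
    rw [show M.n + 1 - 1 = M.n by omega, show M.n + 1 + 1 - 2 = M.n by omega]
    push_cast
    gcongr
  · have e1 : Real.exp M.logDim * Real.exp M.logDim * (8 * Real.exp (-(4 * M.logDim)))
        = 8 * Real.exp (-(2 * M.logDim)) := by
      rw [← Real.exp_add, mul_left_comm, ← Real.exp_add]; ring_nf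
    rw [e1, div_eq_mul_inv]
    have e2 : Real.exp (-(2 * M.logDim)) ≤ Real.exp (-M.logDim) :=
      Real.exp_le_exp.2 (by linarith [logDim_pos hn])
    rw [Real.exp_neg M.logDim] at e2
    have e3 : (Real.exp M.logDim)⁻¹ ≤ (M.n : ℝ)⁻¹ := by gcongr
    linarith

end MLRModel

/-! ### The block fused lasso on a block inside a segment -/

section Norms

variable {p : ℕ}

lemma l1norm_add_le (v w : EuclideanSpace ℝ (Fin p)) : l1norm (v + w) ≤ l1norm v + l1norm w := by
  rw [l1norm, l1norm, l1norm, ← Finset.sum_add_distrib]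
  exact Finset.sum_le_sum fun i _ => abs_add_le _ _

lemma l1norm_neg (v : EuclideanSpace ℝ (Fin p)) : l1norm (-v) = l1norm v := by
  simp [l1norm]

lemma l1norm_zero : l1norm (0 : EuclideanSpace ℝ (Fin p)) = 0 := by simp [l1norm]

lemma abs_sum_mul_inner_le (W : Finset ℕ) (x : ℕ → EuclideanSpace ℝ (Fin p)) (ε : ℕ → ℝ) {T : ℝ}
    (h : ∀ i, |∑ t ∈ W, ε t * x t i| ≤ T) (v : EuclideanSpace ℝ (Fin p)) :
    |∑ t ∈ W, ε t * inner ℝ (x t) v| ≤ T * l1norm v := by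
  have e : ∑ t ∈ W, ε t * inner ℝ (x t) v = ∑ i, (∑ t ∈ W, ε t * x t i) * v i := by
    simp_rw [inner_eq_sum, Finset.mul_sum, Finset.sum_mul]
    rw [Finset.sum_comm]
    exact Finset.sum_congr rfl fun i _ => Finset.sum_congr rfl fun t _ => by ring
  rw [e, l1norm, Finset.mul_sum]
  refine (Finset.abs_sum_le_sum_abs _ _).trans (Finset.sum_le_sum fun i _ => ?_)
  rw [abs_mul]
  have := h i
  gcongr

lemma sum_abs_le_sqrt_card_mul_norm (S : Finset (Fin p)) {d : ℕ} (hS : S.card ≤ d)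
    (v : EuclideanSpace ℝ (Fin p)) : ∑ i ∈ S, |v i| ≤ √d * ‖v‖ := by
  have h1 : (∑ i ∈ S, |v i|) ^ 2 ≤ d * ‖v‖ ^ 2 := by
    refine sq_sum_le_card_mul_sum_sq.trans ?_
    rw [EuclideanSpace.real_norm_sq_eq]
    have h2 : ∑ i ∈ S, |v i| ^ 2 ≤ ∑ i, v i ^ 2 := by
      simp_rw [sq_abs]
      exact Finset.sum_le_univ_sum_of_nonneg fun i => sq_nonneg _
    have h3 : (S.card : ℝ) ≤ d := by exact_mod_cast hS
    have h0 : 0 ≤ ∑ i ∈ S, |v i| ^ 2 := Finset.sum_nonneg fun _ _ => sq_nonneg _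
    exact mul_le_mul h3 h2 h0 (Nat.cast_nonneg d)
  refine le_of_sq_le_sq ?_ (by positivity)
  rwa [mul_pow, Real.sq_sqrt (Nat.cast_nonneg d)]

/-- The cone condition for an `ℓ¹`-penalized minimizer `β + Δ`. -/
lemma lasso_cone {β Δ : EuclideanSpace ℝ (Fin p)} {d : ℕ} (hd : (vsupp β).card ≤ d) {Q a : ℝ}
    (hQ : 0 ≤ Q) (ha : 0 < a)
    (h : Q + a * (l1norm (β + Δ) - l1norm β) ≤ a / 2 * l1norm Δ) :
    l1norm Δ ≤ 4 * √d * ‖Δ‖ ∧ Q ≤ 3 / 2 * a * √d * ‖Δ‖ := by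
  have hsplit : ∀ v : EuclideanSpace ℝ (Fin p),
      l1norm v = ∑ i ∈ vsupp β, |v i| + ∑ i ∈ (vsupp β)ᶜ, |v i| := fun v =>
    (Finset.sum_add_sum_compl _ _).symm
  have hz : ∀ i ∈ (vsupp β)ᶜ, β i = 0 := by
    intro i hi
    simpa [vsupp] using hi
  have hβ : ∑ i ∈ (vsupp β)ᶜ, |β i| = 0 :=
    Finset.sum_eq_zero fun i hi => by rw [hz i hi, abs_zero]
  have hβΔ : ∑ i ∈ (vsupp β)ᶜ, |(β + Δ) i| = ∑ i ∈ (vsupp β)ᶜ, |Δ i| :=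
    Finset.sum_congr rfl fun i hi => by rw [PiLp.add_apply, hz i hi, zero_add]
  have hS : ∑ i ∈ vsupp β, |β i| - ∑ i ∈ vsupp β, |Δ i| ≤ ∑ i ∈ vsupp β, |(β + Δ) i| := by
    rw [← Finset.sum_sub_distrib]
    refine Finset.sum_le_sum fun i _ => ?_
    have := abs_sub_abs_le_abs_sub (β i) (-(Δ i))
    rw [abs_neg, sub_neg_eq_add] at this
    simpa using this
  have hb := sum_abs_le_sqrt_card_mul_norm (vsupp β) hd Δ
  have e1 := hsplit (β + Δ)
  have e2 := hsplit β
  have e3 := hsplit Δ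
  rw [hβΔ] at e1
  rw [hβ] at e2
  set A := ∑ i ∈ vsupp β, |Δ i|
  set C := ∑ i ∈ (vsupp β)ᶜ, |Δ i| with hC
  have hC0 : 0 ≤ C := Finset.sum_nonneg fun _ _ => abs_nonneg _
  -- Off the support of β the penalty charges all of Δ; on it, at most the mass of Δ is refunded.
  have h1 : C - A ≤ l1norm (β + Δ) - l1norm β := by linarith
  have h2 : Q ≤ a * (3 / 2 * A - C / 2) := by
    have := mul_le_mul_of_nonneg_left h1 ha.le
    rw [e3] at h
    linarith
  constructor
  · have h3 : 0 ≤ 3 / 2 * A - C / 2 := nonneg_of_mul_nonneg_right (hQ.trans h2) ha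
    rw [e3]; linarith
  · refine h2.trans ?_
    have : a * (3 / 2 * A - C / 2) ≤ a * (3 / 2 * (√d * ‖Δ‖)) := by
      gcongr; linarith
    linarith

end Norms

/-! ### Perturbing a single block. -/

section Objective

variable {p : ℕ} {n b : ℕ} {lam₁ lam₂ : ℝ} {x : ℕ → EuclideanSpace ℝ (Fin p)} {y : ℕ → ℝ}
  {θ : ℕ → EuclideanSpace ℝ (Fin p)}

/-- Changing the coefficient vector of one block only cannot improve on a minimizer. -/
lemma fusedLasso_single_block (h1 : 0 ≤ lam₁)
    (hmin : ∀ θ', fusedLassoObjective n b lam₁ lam₂ x y θ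
      ≤ fusedLassoObjective n b lam₁ lam₂ x y θ')
    {i : ℕ} (hi : i ∈ Icc 1 (n / b)) (Δ : EuclideanSpace ℝ (Fin p)) :
    1 / (n : ℝ) * ∑ t ∈ Ico (blockEnd n b (i - 1)) (blockEnd n b i),
        (y t - inner ℝ (x t) (∑ l ∈ Icc 1 i, θ l)) ^ 2 + lam₂ * l1norm (∑ l ∈ Icc 1 i, θ l)
      ≤ 1 / (n : ℝ) * ∑ t ∈ Ico (blockEnd n b (i - 1)) (blockEnd n b i),
        (y t - inner ℝ (x t) (∑ l ∈ Icc 1 i, θ l - Δ)) ^ 2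
        + lam₂ * l1norm (∑ l ∈ Icc 1 i, θ l - Δ) + 2 * lam₁ * l1norm Δ := by
  -- Subtracting Δ at i and restoring it at i + 1 alters only the i-th partial sum. For the last
  -- block, i + 1 falls outside the range and the restoring term is not counted.
  set θ' : ℕ → EuclideanSpace ℝ (Fin p) := fun l =>
    θ l + ((if l = i then -Δ else 0) + if l = i + 1 then Δ else 0) with hθ'
  have hi1 := (Finset.mem_Icc.1 hi).1
  have hpart : ∀ m, ∑ l ∈ Icc 1 m, θ' l = ∑ l ∈ Icc 1 m, θ l - if m = i then Δ else 0 := by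
    intro m
    simp only [hθ', Finset.sum_add_distrib, Finset.sum_ite_eq', Finset.mem_Icc]
    rcases lt_trichotomy m i with h | h | h
    · simp [h.ne, not_le.2 h, not_le.2 (h.trans (Nat.lt_succ_self i))]
    · subst h; simp [hi1, sub_eq_add_neg]
    · simp [h.ne', hi1, h.le, Nat.succ_le_of_lt h]
  have hl1 : ∀ l, l1norm (θ' l) ≤ l1norm (θ l)
      + ((if l = i then l1norm Δ else 0) + if l = i + 1 then l1norm Δ else 0) := by
    intro l
    refine (l1norm_add_le _ _).trans (add_le_add le_rfl ((l1norm_add_le _ _).trans ?_))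
    refine add_le_add ?_ ?_ <;> split_ifs <;> simp [l1norm_neg, l1norm_zero]
  have hpen : ∑ l ∈ Icc 1 (n / b), l1norm (θ' l)
      ≤ ∑ l ∈ Icc 1 (n / b), l1norm (θ l) + 2 * l1norm Δ := by
    refine (Finset.sum_le_sum fun l _ => hl1 l).trans ?_
    rw [Finset.sum_add_distrib, Finset.sum_add_distrib, Finset.sum_ite_eq', Finset.sum_ite_eq']
    have := l1norm_nonneg Δ
    split_ifs <;> linarith
  have hm := hmin θ'
  have hsplit : ∀ f : ℕ → ℝ, ∑ l ∈ Icc 1 (n / b), f l = f i + ∑ l ∈ (Icc 1 (n / b)).erase i, f l :=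
    fun f => (Finset.add_sum_erase _ f hi).symm
  simp only [fusedLassoObjective, hpart] at hm
  rw [hsplit (fun i => ∑ t ∈ Ico (blockEnd n b (i - 1)) (blockEnd n b i),
      (y t - inner ℝ (x t) (∑ l ∈ Icc 1 i, θ l)) ^ 2),
    hsplit (fun j => ∑ t ∈ Ico (blockEnd n b (j - 1)) (blockEnd n b j),
      (y t - inner ℝ (x t) (∑ l ∈ Icc 1 j, θ l - if j = i then Δ else 0)) ^ 2),
    hsplit (fun i => l1norm (∑ l ∈ Icc 1 i, θ l)),
    hsplit (fun j => l1norm (∑ l ∈ Icc 1 j, θ l - if j = i then Δ else 0))] at hm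
  have r1 : ∑ j ∈ (Icc 1 (n / b)).erase i, ∑ t ∈ Ico (blockEnd n b (j - 1)) (blockEnd n b j),
      (y t - inner ℝ (x t) (∑ l ∈ Icc 1 j, θ l - if j = i then Δ else 0)) ^ 2
      = ∑ j ∈ (Icc 1 (n / b)).erase i, ∑ t ∈ Ico (blockEnd n b (j - 1)) (blockEnd n b j),
      (y t - inner ℝ (x t) (∑ l ∈ Icc 1 j, θ l)) ^ 2 :=
    Finset.sum_congr rfl fun j hj => by simp [Finset.ne_of_mem_erase hj]
  have r2 : ∑ j ∈ (Icc 1 (n / b)).erase i, l1norm (∑ l ∈ Icc 1 j, θ l - if j = i then Δ else 0)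
      = ∑ j ∈ (Icc 1 (n / b)).erase i, l1norm (∑ l ∈ Icc 1 j, θ l) :=
    Finset.sum_congr rfl fun j hj => by simp [Finset.ne_of_mem_erase hj]
  rw [r1, r2] at hm
  simp only [if_true] at hm
  have := mul_le_mul_of_nonneg_left hpen h1
  linarith

end Objective

namespace MLRModel

variable {Ω : Type*} (M : MLRModel Ω)

lemma y_eq {j t : ℕ} (hj : j ∈ Icc 1 (M.m + 1)) (h1 : M.cp (j - 1) ≤ t) (h2 : t < M.cp j) (ω : Ω) :
    M.y t ω = inner ℝ (M.x t ω) (M.β j) + M.ε t ω := by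
  have hj' := Finset.mem_Icc.1 hj
  rw [y, Finset.sum_eq_single_of_mem j hj]
  · simp [h1, h2]
  · intro i hi hij
    have hi' := Finset.mem_Icc.1 hi
    rw [if_neg]
    rintro ⟨h3, h4⟩
    rcases lt_or_gt_of_ne hij with h | h
    · have := M.cp_le_cp (show i ≤ j - 1 by omega) (by omega)
      omega
    · have := M.cp_le_cp (show j ≤ i - 1 by omega) (by omega)
      omega

lemma card_vsupp_le_dstar {j : ℕ} (hj : j ∈ Icc 1 (M.m + 1)) :
    (vsupp (M.β j)).card ≤ M.dstar :=
  Finset.le_sup (f := fun j => (vsupp (M.β j)).card) hj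

/-- If all coefficient vectors vanished there would be no jump at the first change point. -/
lemma one_le_dstar : 1 ≤ M.dstar := by
  by_contra h
  have h0 : M.dstar = 0 := by omega
  have hz : ∀ j ∈ Icc 1 (M.m + 1), M.β j = 0 := by
    intro j hj
    have h1 := M.card_vsupp_le_dstar hj
    rw [h0, Nat.le_zero, Finset.card_eq_zero] at h1
    ext i
    by_contra hi
    have : i ∈ vsupp (M.β j) := by simpa [vsupp] using hi
    rw [h1] at this
    simp at this
  have := M.one_le_m
  refine M.β_ne 1 (Finset.mem_Icc.2 ⟨le_rfl, this⟩) ?_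
  rw [hz 1 (Finset.mem_Icc.2 ⟨le_rfl, by omega⟩),
    hz (1 + 1) (Finset.mem_Icc.2 ⟨by omega, by omega⟩)]

/-- Estimation error of the block fused lasso on a block contained in a segment. -/
lemma block_error {ω : Ω} {K T c C C₁ C₂ : ℝ} {b : ℕ} {θ : ℕ → EuclideanSpace ℝ (Fin M.p)}
    (hT : 0 < T) (hc : 0 < c) (hC : 0 < C) (hC₁ : 0 ≤ C₁) (hC₂ : 4 * C₁ + 8 * T ≤ C₂) (hb : 0 < b)
    (hn : 2 ≤ M.n)
    (hmin : ∀ θ', fusedLassoObjective M.n b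
        (C₁ * √(M.logDim / (M.n : ℝ)) * √((b : ℝ) / (M.n : ℝ)))
        (C₂ * √(M.logDim / (M.n : ℝ)) * √((b : ℝ) / (M.n : ℝ)))
        (fun t => M.x t ω) (fun t => M.y t ω) θ
      ≤ fusedLassoObjective M.n b
        (C₁ * √(M.logDim / (M.n : ℝ)) * √((b : ℝ) / (M.n : ℝ)))
        (C₂ * √(M.logDim / (M.n : ℝ)) * √((b : ℝ) / (M.n : ℝ)))
        (fun t => M.x t ω) (fun t => M.y t ω) θ')
    (hgood : M.Good K T c C ω) (hKb : K * M.logDim ≤ b)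
    (hdb : 32 * C * (M.dstar * M.logDim) ≤ c * b)
    {i j : ℕ} (hi : i ∈ Icc 1 (M.n / b)) (hj : j ∈ Icc 1 (M.m + 1))
    (h1 : M.cp (j - 1) ≤ blockEnd M.n b (i - 1)) (h2 : blockEnd M.n b i ≤ M.cp j)
    (hlen1 : blockEnd M.n b (i - 1) + b ≤ blockEnd M.n b i)
    (hlen2 : blockEnd M.n b i ≤ blockEnd M.n b (i - 1) + 2 * b) :
    ‖∑ l ∈ Icc 1 i, θ l - M.β j‖ ≤ 3 * C₂ / c * √(M.dstar * M.logDim / b) ∧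
    l1norm (∑ l ∈ Icc 1 i, θ l - M.β j)
      ≤ 4 * √M.dstar * (3 * C₂ / c * √(M.dstar * M.logDim / b)) := by
  have hL := logDim_pos hn
  have hn0 : (0 : ℝ) < M.n := by exact_mod_cast (by omega : 0 < M.n)
  have hb0 : (0 : ℝ) < b := by exact_mod_cast hb
  have hC₂0 : 0 < C₂ := by linarith
  set s := blockEnd M.n b (i - 1) with hs
  set e := blockEnd M.n b i with he
  set L := M.logDim with hLdef
  set Bh := ∑ l ∈ Icc 1 i, θ l with hBh
  set Δ := Bh - M.β j with hΔ
  have hl1 : (b : ℝ) ≤ (e : ℝ) - s := by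
    have : (s : ℝ) + b ≤ e := by exact_mod_cast hlen1
    linarith
  have hl2 : (e : ℝ) - s ≤ 2 * b := by
    have : (e : ℝ) ≤ s + 2 * b := by exact_mod_cast hlen2
    linarith
  obtain ⟨g1, g2, -, -, -⟩ := hgood j hj s e h1 (by omega) h2 (hKb.trans hl1)
  -- After multiplication by n the penalty levels become C₁√(Lb) and C₂√(Lb), the noise level of a
  -- block.
  have hrate : √(L / (M.n : ℝ)) * √((b : ℝ) / (M.n : ℝ)) = √(L * b) / M.n := by
    rw [← Real.sqrt_mul (by positivity), div_mul_div_comm, Real.sqrt_div (by positivity),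
      Real.sqrt_mul_self hn0.le]
  set μ := √(L * b) with hμ
  have hμ0 : 0 < μ := Real.sqrt_pos.2 (by positivity)
  have hobj := fusedLasso_single_block (by positivity) hmin hi Δ
  rw [← hBh, show Bh - Δ = M.β j by rw [hΔ]; abel, mul_assoc C₁, mul_assoc C₂, hrate] at hobj
  set Q := ∑ t ∈ Ico s e, inner ℝ (M.x t ω) Δ ^ 2 with hQ
  set N := ∑ t ∈ Ico s e, M.ε t ω * inner ℝ (M.x t ω) Δ with hN
  have hdiff : ∑ t ∈ Ico s e, (M.y t ω - inner ℝ (M.x t ω) Bh) ^ 2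
      = ∑ t ∈ Ico s e, (M.y t ω - inner ℝ (M.x t ω) (M.β j)) ^ 2 + Q - 2 * N := by
    rw [hQ, hN, Finset.mul_sum, ← Finset.sum_add_distrib, ← Finset.sum_sub_distrib]
    refine Finset.sum_congr rfl fun t ht => ?_
    rw [Finset.mem_Ico] at ht
    rw [M.y_eq hj (h1.trans ht.1) (ht.2.trans_le h2),
      show Bh = M.β j + Δ by rw [hΔ]; abel, inner_add_right]
    ring
  have hobj' : Q + C₂ * μ * (l1norm Bh - l1norm (M.β j)) ≤ 2 * N + 2 * C₁ * μ * l1norm Δ := by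
    rw [hdiff] at hobj
    have := mul_le_mul_of_nonneg_left hobj hn0.le
    field_simp at this
    linarith
  have hNle : N ≤ 2 * T * μ * l1norm Δ := by
    have h3 := abs_sum_mul_inner_le (Ico s e) (fun t => M.x t ω) (fun t => M.ε t ω) g1 Δ
    refine (le_abs_self N).trans (h3.trans ?_)
    have h4 : √(((e : ℝ) - s) * L) ≤ 2 * μ := by
      rw [Real.sqrt_le_left (by positivity), mul_pow, hμ, Real.sq_sqrt (by positivity)]
      nlinarith
    have h5 := l1norm_nonneg Δ
    calc T * √(((e : ℝ) - s) * L) * l1norm Δ ≤ T * (2 * μ) * l1norm Δ := by gcongr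
      _ = _ := by ring
  -- The noise contributes 4T and the fusion penalty 2C₁; together they are at most C₂/2, half of
  -- the lasso penalty, as the cone condition requires.
  have hcone := lasso_cone (β := M.β j) (Δ := Δ) (M.card_vsupp_le_dstar hj) (Q := Q)
    (a := C₂ * μ) (Finset.sum_nonneg fun _ _ => sq_nonneg _) (by positivity) (by
      rw [show M.β j + Δ = Bh by rw [hΔ]; abel]
      have h5 := l1norm_nonneg Δ
      have h6 : (2 * C₁ + 4 * T) * (μ * l1norm Δ) ≤ C₂ / 2 * (μ * l1norm Δ) := by
        gcongr; linarith
      linarith)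
  obtain ⟨hcone1, hcone2⟩ := hcone
  have hd0 : (0 : ℝ) < M.dstar := by exact_mod_cast M.one_le_dstar
  -- Restricted eigenvalue bound: in the cone ‖Δ‖₁² ≤ 16d*‖Δ‖², so the ℓ¹ loss takes at most half of
  -- the quadratic form.
  have hlow : c * b / 2 * ‖Δ‖ ^ 2 ≤ Q := by
    have h7 := g2 Δ
    have h8 : l1norm Δ ^ 2 ≤ 16 * M.dstar * ‖Δ‖ ^ 2 := by
      refine (pow_le_pow_left₀ (l1norm_nonneg Δ) hcone1 2).trans (le_of_eq ?_)
      rw [mul_pow, mul_pow, Real.sq_sqrt hd0.le]; ring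
    have h9 : C * L * l1norm Δ ^ 2 ≤ C * L * (16 * M.dstar * ‖Δ‖ ^ 2) := by gcongr
    have h10 : C * L * (16 * M.dstar * ‖Δ‖ ^ 2) ≤ c * b / 2 * ‖Δ‖ ^ 2 := by
      have := mul_le_mul_of_nonneg_right hdb (sq_nonneg ‖Δ‖)
      linarith
    have h11 : c * b * ‖Δ‖ ^ 2 ≤ c * ((e : ℝ) - s) * ‖Δ‖ ^ 2 := by gcongr
    linarith
  have hfin : ‖Δ‖ ≤ 3 * C₂ / c * √(M.dstar * L / b) := by
    have e1 : √(M.dstar * L / b) = μ * √M.dstar / b := by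
      rw [hμ, ← Real.sqrt_mul (by positivity), eq_div_iff hb0.ne']
      nth_rewrite 2 [← Real.sqrt_sq hb0.le]
      rw [← Real.sqrt_mul (by positivity)]
      congr 1; field_simp
    rw [e1]
    rcases (norm_nonneg Δ).eq_or_lt with h0 | h0
    · rw [← h0]; positivity
    · have h12 : c * b / 2 * ‖Δ‖ * ‖Δ‖ ≤ 3 / 2 * (C₂ * μ) * √M.dstar * ‖Δ‖ := by
        linarith [hlow.trans hcone2]
      have h13 := le_of_mul_le_mul_right h12 h0
      rw [div_mul_div_comm, le_div_iff₀ (by positivity)]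
      linarith
  exact ⟨hfin, hcone1.trans (by gcongr)⟩

end MLRModel

/-! ### Ordered partitions and clusterings -/

namespace IsOrderedPartition

variable {A : Finset ℕ} {m m' : ℕ} {R S : ℕ → Finset ℕ}

lemma mem_of_mem (h : IsOrderedPartition A m R) {i a : ℕ} (hi : i ∈ Icc 1 m) (ha : a ∈ R i) :
    a ∈ A := by
  rw [← h.2.2]; exact Finset.mem_biUnion.2 ⟨i, hi, ha⟩

lemma exists_mem (h : IsOrderedPartition A m R) {a : ℕ} (ha : a ∈ A) :
    ∃ i ∈ Icc 1 m, a ∈ R i := by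
  rw [← h.2.2] at ha; exact Finset.mem_biUnion.1 ha

lemma index_le (h : IsOrderedPartition A m R) {i j a a' : ℕ} (hi : i ∈ Icc 1 m)
    (hj : j ∈ Icc 1 m) (ha : a ∈ R i) (ha' : a' ∈ R j) (haa : a ≤ a') : i ≤ j := by
  by_contra hcon
  exact absurd (h.2.1 j hj i hi (not_le.1 hcon) a' ha' a ha) (not_lt.2 haa)

lemma index_eq (h : IsOrderedPartition A m R) {i j a : ℕ} (hi : i ∈ Icc 1 m)
    (hj : j ∈ Icc 1 m) (ha : a ∈ R i) (ha' : a ∈ R j) : i = j :=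
  le_antisymm (h.index_le hi hj ha ha' le_rfl) (h.index_le hj hi ha' ha le_rfl)

/-- The matching of members is strictly increasing because both families are ordered, hence i ≤ f i.
Applied in both directions this forces the matching to be the identity. -/
lemma exists_index_map (hR : IsOrderedPartition A m R) (hS : IsOrderedPartition A m' S)
    (h : ∀ i ∈ Icc 1 m, ∃ j ∈ Icc 1 m', R i = S j) :
    ∃ f : ℕ → ℕ, ∀ i ∈ Icc 1 m, f i ∈ Icc 1 m' ∧ R i = S (f i) ∧ i ≤ f i := by
  have h' : ∀ i, ∃ j, i ∈ Icc 1 m → j ∈ Icc 1 m' ∧ R i = S j := by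
    intro i
    by_cases hi : i ∈ Icc 1 m
    · obtain ⟨j, hj, e⟩ := h i hi
      exact ⟨j, fun _ => ⟨hj, e⟩⟩
    · exact ⟨0, fun h => absurd h hi⟩
  choose f hf using h'
  refine ⟨f, fun i hi => ⟨(hf i hi).1, (hf i hi).2, ?_⟩⟩
  induction i with
  | zero => exact Nat.zero_le _
  | succ i ih =>
    rcases Nat.eq_zero_or_pos i with rfl | hpos
    · exact (Finset.mem_Icc.1 (hf 1 hi).1).1
    · have hi0 : i ∈ Icc 1 m := by
        rw [Finset.mem_Icc] at hi ⊢; omega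
      have h1 := ih hi0
      obtain ⟨a, ha⟩ := hR.1 i hi0
      obtain ⟨a', ha'⟩ := hR.1 (i + 1) hi
      have hlt := hR.2.1 i hi0 (i + 1) hi (Nat.lt_succ_self i) a ha a' ha'
      have h2 := hS.index_le (hf i hi0).1 (hf _ hi).1 ((hf i hi0).2 ▸ ha) ((hf _ hi).2 ▸ ha')
        hlt.le
      have h3 : f i ≠ f (i + 1) := by
        intro he
        have : R i = R (i + 1) := by rw [(hf i hi0).2, (hf _ hi).2, he]
        have := hR.index_eq hi0 hi ha (this ▸ ha)
        omega
      omega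

/-- Two ordered partitions with the same members coincide. -/
lemma unique (hR : IsOrderedPartition A m R) (hS : IsOrderedPartition A m' S)
    (h : ∀ i ∈ Icc 1 m, ∃ j ∈ Icc 1 m', R i = S j)
    (h' : ∀ j ∈ Icc 1 m', ∃ i ∈ Icc 1 m, S j = R i) :
    m = m' ∧ ∀ i ∈ Icc 1 m, R i = S i := by
  obtain ⟨f, hf⟩ := hR.exists_index_map hS h
  obtain ⟨g, hg⟩ := hS.exists_index_map hR h'
  have hm : ∀ {k l : ℕ} {f : ℕ → ℕ}, (∀ i ∈ Icc 1 k, f i ∈ Icc 1 l ∧ i ≤ f i) → k ≤ l := by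
    intro k l f hf
    rcases Nat.eq_zero_or_pos k with h0 | h0
    · omega
    · have := hf k (Finset.mem_Icc.2 ⟨h0, le_rfl⟩)
      rw [Finset.mem_Icc] at this
      omega
  refine ⟨le_antisymm (hm fun i hi => ⟨(hf i hi).1, (hf i hi).2.2⟩)
    (hm fun i hi => ⟨(hg i hi).1, (hg i hi).2.2⟩), fun i hi => ?_⟩
  obtain ⟨h1, h2, h3⟩ := hf i hi
  obtain ⟨h4, h5, h6⟩ := hg _ h1
  obtain ⟨a, ha⟩ := hR.1 i hi
  have h7 : g (f i) = i := hR.index_eq h4 hi (by rw [← h5, ← h2]; exact ha) ha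
  have h8 : f i = i := by omega
  rw [h2, h8]

end IsOrderedPartition

/-- Monotonicity squeezes f to be constant between i and j, so equality for g propagates along
consecutive indices. -/
lemma eq_iff_of_consecutive {f g : ℕ → ℕ} {m : ℕ}
    (hf : ∀ i ∈ Icc 1 m, ∀ j ∈ Icc 1 m, i ≤ j → f i ≤ f j)
    (hfg : ∀ i ∈ Icc 1 m, i + 1 ∈ Icc 1 m → f i = f (i + 1) → g i = g (i + 1))
    {i j : ℕ} (hi : i ∈ Icc 1 m) (hj : j ∈ Icc 1 m) (hij : i ≤ j) (h : f i = f j) : g i = g j := by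
  induction j, hij using Nat.le_induction with
  | base => rfl
  | succ j hij ih =>
    have hj0 : j ∈ Icc 1 m := by rw [Finset.mem_Icc] at hi hj ⊢; omega
    have h1 := hf i hi j hj0 hij
    have h2 := hf j hj0 (j + 1) hj (Nat.le_succ j)
    rw [ih hj0 (by omega), hfg j hj0 hj (by omega)]

/-- If the points of `A` form well separated groups of small diameter, then every block clustering
of `A` returns these groups. -/
lemma IsBlockClustering.eq_of_label {κ₁ κ₂ κmax : ℝ} {b m m' : ℕ} {A : Finset ℕ}
    {R : ℕ → Finset ℕ} (h : IsBlockClustering κ₁ κ₂ b A m' R) {lab : ℕ → ℕ}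
    (hlab : ∀ a ∈ A, lab a ∈ Icc 1 m) (hsurj : ∀ j ∈ Icc 1 m, ∃ a ∈ A, lab a = j)
    (hmono : ∀ a ∈ A, ∀ a' ∈ A, a ≤ a' → lab a ≤ lab a')
    (hsame : ∀ a ∈ A, ∀ a' ∈ A, lab a = lab a' → (a' : ℝ) - a ≤ b)
    (hdiff : ∀ a ∈ A, ∀ a' ∈ A, a ≤ a' → (a' : ℝ) - a ≤ κmax * b → lab a = lab a')
    (hκ₁ : κ₁ ≤ κmax) (hκ₂ : 1 ≤ κ₂) (hκ₂m : κ₂ ≤ κmax) :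
    m' = m ∧ ∀ j ∈ Icc 1 m', R j = A.filter fun a => lab a = j := by
  obtain ⟨hR, m'', R', hR', hdiam, hsub, hmerge⟩ := h
  have hb0 : (0 : ℝ) ≤ b := Nat.cast_nonneg b
  have hlabR' : ∀ i ∈ Icc 1 m'', ∀ a ∈ R' i, ∀ a' ∈ R' i, lab a = lab a' := by
    intro i hi a ha a' ha'
    have hA := hR'.mem_of_mem hi ha
    have hA' := hR'.mem_of_mem hi ha'
    rcases le_total a a' with hle | hle
    · exact hdiff a hA a' hA' hle ((hdiam i hi a ha a' ha').trans (by gcongr))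
    · exact (hdiff a' hA' a hA hle ((hdiam i hi a' ha' a ha).trans (by gcongr))).symm
  have hsel : ∀ i, ∃ z : ℕ × ℕ, i ∈ Icc 1 m'' → z.1 ∈ Icc 1 m' ∧ R' i ⊆ R z.1 ∧ z.2 ∈ R' i := by
    intro i
    by_cases hi : i ∈ Icc 1 m''
    · obtain ⟨j, hj, hs⟩ := hsub i hi
      obtain ⟨a, ha⟩ := hR'.1 i hi
      exact ⟨(j, a), fun _ => ⟨hj, hs, ha⟩⟩
    · exact ⟨(0, 0), fun h => absurd h hi⟩
  choose z hz using hsel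
  -- For each initial cluster, r is the final cluster containing it and l is its label. Both are
  -- monotone and stay constant at the same consecutive pairs: a merge means a gap of at most κ₂b ≤
  -- κ_max b, hence one label, and one label means a gap of at most b ≤ κ₂b, hence a merge. So they
  -- have the same level sets.
  set r : ℕ → ℕ := fun i => (z i).1 with hr
  set l : ℕ → ℕ := fun i => lab (z i).2 with hl
  have hrmono : ∀ i ∈ Icc 1 m'', ∀ j ∈ Icc 1 m'', i ≤ j → r i ≤ r j := by
    intro i hi j hj hij
    rcases hij.eq_or_lt with rfl | hij
    · exact le_rfl
    exact hR.index_le (hz i hi).1 (hz j hj).1 ((hz i hi).2.1 (hz i hi).2.2)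
      ((hz j hj).2.1 (hz j hj).2.2)
      (hR'.2.1 i hi j hj hij _ (hz i hi).2.2 _ (hz j hj).2.2).le
  have hlmono : ∀ i ∈ Icc 1 m'', ∀ j ∈ Icc 1 m'', i ≤ j → l i ≤ l j := by
    intro i hi j hj hij
    rcases hij.eq_or_lt with rfl | hij
    · exact le_rfl
    exact hmono _ (hR'.mem_of_mem hi (hz i hi).2.2) _ (hR'.mem_of_mem hj (hz j hj).2.2)
      (hR'.2.1 i hi j hj hij _ (hz i hi).2.2 _ (hz j hj).2.2).le
  have hrl : ∀ i ∈ Icc 1 m'', i + 1 ∈ Icc 1 m'' → r i = r (i + 1) → l i = l (i + 1) := by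
    intro i hi hi1 he
    obtain ⟨a, ha, a', ha', hle⟩ := (hmerge i hi hi1).1 ⟨r i, (hz i hi).1,
      Finset.union_subset (hz i hi).2.1 (he ▸ (hz _ hi1).2.1)⟩
    have hlt := hR'.2.1 i hi _ hi1 (Nat.lt_succ_self i) a ha a' ha'
    have h1 := hdiff a (hR'.mem_of_mem hi ha) a' (hR'.mem_of_mem hi1 ha') hlt.le
      (hle.trans (by gcongr))
    calc l i = lab a := hlabR' i hi _ (hz i hi).2.2 a ha
      _ = lab a' := h1
      _ = l (i + 1) := hlabR' _ hi1 a' ha' _ (hz _ hi1).2.2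
  have hlr : ∀ i ∈ Icc 1 m'', i + 1 ∈ Icc 1 m'' → l i = l (i + 1) → r i = r (i + 1) := by
    intro i hi hi1 he
    have h1 := hsame _ (hR'.mem_of_mem hi (hz i hi).2.2) _ (hR'.mem_of_mem hi1 (hz _ hi1).2.2) he
    obtain ⟨j, hj, hs⟩ := (hmerge i hi hi1).2 ⟨_, (hz i hi).2.2, _, (hz _ hi1).2.2,
      h1.trans (le_mul_of_one_le_left hb0 hκ₂)⟩
    change (z i).1 = (z (i + 1)).1
    rw [hR.index_eq (hz i hi).1 hj ((hz i hi).2.1 (hz i hi).2.2)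
        (hs (Finset.mem_union_left _ (hz i hi).2.2)),
      hR.index_eq (hz _ hi1).1 hj ((hz _ hi1).2.1 (hz _ hi1).2.2)
        (hs (Finset.mem_union_right _ (hz _ hi1).2.2))]
  have hiff : ∀ j ∈ Icc 1 m', ∀ j' ∈ Icc 1 m', ∀ a ∈ R j, ∀ a' ∈ R j',
      (j = j' ↔ lab a = lab a') := by
    intro j hj j' hj' a ha a' ha'
    obtain ⟨i, hi, hai⟩ := hR'.exists_mem (hR.mem_of_mem hj ha)
    obtain ⟨i', hi', hai'⟩ := hR'.exists_mem (hR.mem_of_mem hj' ha')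
    have e1 : r i = j := hR.index_eq (hz i hi).1 hj ((hz i hi).2.1 hai) ha
    have e2 : r i' = j' := hR.index_eq (hz i' hi').1 hj' ((hz i' hi').2.1 hai') ha'
    have e3 : l i = lab a := hlabR' i hi _ (hz i hi).2.2 a hai
    have e4 : l i' = lab a' := hlabR' i' hi' _ (hz i' hi').2.2 a' hai'
    rw [← e1, ← e2, ← e3, ← e4]
    rcases le_total i i' with hle | hle
    · exact ⟨eq_iff_of_consecutive hrmono hrl hi hi' hle,
        eq_iff_of_consecutive hlmono hlr hi hi' hle⟩
    · exact ⟨fun h => (eq_iff_of_consecutive hrmono hrl hi' hi hle h.symm).symm,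
        fun h => (eq_iff_of_consecutive hlmono hlr hi' hi hle h.symm).symm⟩
  have hS : IsOrderedPartition A m (fun j => A.filter fun a => lab a = j) := by
    refine ⟨fun j hj => ?_, fun i _ j _ hij a ha a' ha' => ?_, ?_⟩
    · obtain ⟨a, ha, e⟩ := hsurj j hj
      exact ⟨a, Finset.mem_filter.2 ⟨ha, e⟩⟩
    · rw [Finset.mem_filter] at ha ha'
      by_contra hcon
      have := hmono a' ha'.1 a ha.1 (not_lt.1 hcon)
      omega
    · ext a
      simp only [Finset.mem_biUnion, Finset.mem_filter]
      exact ⟨fun ⟨_, _, h, _⟩ => h, fun h => ⟨lab a, hlab a h, h, rfl⟩⟩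
  have hRS : ∀ j ∈ Icc 1 m', ∀ a ∈ R j, R j = A.filter fun a' => lab a' = lab a := by
    intro j hj a ha
    ext a'
    rw [Finset.mem_filter]
    constructor
    · intro ha'
      exact ⟨hR.mem_of_mem hj ha', (hiff j hj j hj a' ha' a ha).1 rfl⟩
    · rintro ⟨hA, he⟩
      obtain ⟨j', hj', ha'⟩ := hR.exists_mem hA
      rwa [← (hiff j' hj' j hj a' ha' a ha).2 he]
  refine hR.unique hS (fun j hj => ?_) (fun j hj => ?_)
  · obtain ⟨a, ha⟩ := hR.1 j hj
    exact ⟨lab a, hlab a (hR.mem_of_mem hj ha), hRS j hj a ha⟩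
  · obtain ⟨a, ha, e⟩ := hsurj j hj
    obtain ⟨i, hi, hai⟩ := hR.exists_mem ha
    exact ⟨i, hi, by rw [hRS i hi a hai, e]⟩

/-! ### Candidate blocks and their clusters -/

lemma smallest_mem {A : Finset ℕ} (h : A.Nonempty) : smallest A ∈ A := by
  have := Nat.sInf_mem (s := (A : Set ℕ)) (by exact_mod_cast h)
  exact_mod_cast this

lemma smallest_le {A : Finset ℕ} {a : ℕ} (h : a ∈ A) : smallest A ≤ a :=
  Nat.sInf_le (by exact_mod_cast h)

lemma largest_mem {A : Finset ℕ} (h : A.Nonempty) : largest A ∈ A := by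
  obtain ⟨a, ha, e⟩ := Finset.exists_mem_eq_sup A h id
  rw [largest, e]; exact ha

lemma le_largest {A : Finset ℕ} {a : ℕ} (h : a ∈ A) : a ≤ largest A :=
  Finset.le_sup (f := id) h

lemma blockEnd_of_lt {n b i : ℕ} (h : i < n / b) : blockEnd n b i = 1 + i * b := if_pos h

lemma blockEnd_of_ge {n b i : ℕ} (h : n / b ≤ i) : blockEnd n b i = n + 1 := if_neg (not_lt.2 h)

lemma blockEnd_le {n b i : ℕ} : blockEnd n b i ≤ n + 1 := by
  rcases lt_or_ge i (n / b) with h | h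
  · rw [blockEnd_of_lt h]
    have h1 : i * b ≤ n / b * b := Nat.mul_le_mul_right b h.le
    have h2 := Nat.div_mul_le_self n b
    omega
  · rw [blockEnd_of_ge h]

/-- The block lengths are between `b` and `2b`. -/
lemma blockEnd_length {n b i : ℕ} (hb : 0 < b) (hi : i ∈ Icc 1 (n / b)) :
    blockEnd n b (i - 1) + b ≤ blockEnd n b i ∧
      blockEnd n b i ≤ blockEnd n b (i - 1) + 2 * b := by
  obtain ⟨h1, h2⟩ := Finset.mem_Icc.1 hi
  obtain ⟨i, rfl⟩ : ∃ l, i = l + 1 := ⟨i - 1, by omega⟩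
  rw [Nat.add_sub_cancel, blockEnd_of_lt (show i < n / b by omega)]
  rcases lt_or_ge (i + 1) (n / b) with h | h
  · rw [blockEnd_of_lt h, add_one_mul]; omega
  · rw [blockEnd_of_ge h]
    have e : n / b = i + 1 := by omega
    have h3 := Nat.div_mul_le_self n b
    have h4 := Nat.lt_mul_div_succ n hb
    rw [e] at h3 h4
    have e2 : b * (i + 1 + 1) = i * b + 2 * b := by ring
    have e3 : (i + 1) * b = i * b + b := by ring
    omega

namespace MLRModel

variable {Ω : Type*} (M : MLRModel Ω)

lemma exists_segment {t : ℕ} (h1 : 1 ≤ t) (h2 : t < M.n + 1) :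
    ∃ j ∈ Icc 1 (M.m + 1), M.cp (j - 1) ≤ t ∧ t < M.cp j := by
  have hex : ∃ j, t < M.cp j := ⟨M.m + 1, by rw [M.cp_last]; exact h2⟩
  classical
  refine ⟨Nat.find hex, Finset.mem_Icc.2 ⟨?_, Nat.find_min' hex (by rw [M.cp_last]; exact h2)⟩,
    ?_, Nat.find_spec hex⟩
  · by_contra h
    have h0 : Nat.find hex = 0 := by omega
    have := Nat.find_spec hex
    rw [h0, M.cp_zero] at this
    omega
  · by_contra h
    rcases Nat.eq_zero_or_pos (Nat.find hex) with h0 | h0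
    · have := Nat.find_spec hex
      rw [h0, M.cp_zero] at this
      omega
    · exact Nat.find_min hex (by omega : Nat.find hex - 1 < Nat.find hex) (not_le.1 h)

lemma spacing_of_lt {D b : ℕ} (hsp : ∀ j ≤ M.m, M.cp j + D * b ≤ M.cp (j + 1)) {i j : ℕ}
    (hij : i < j) (hj : j ≤ M.m + 1) : M.cp i + D * b ≤ M.cp j :=
  (hsp i (by omega)).trans (M.cp_le_cp hij hj)

/-- Accuracy of the fused lasso on all blocks inside a segment. -/
def BlockAccurate (b : ℕ) (θ : ℕ → EuclideanSpace ℝ (Fin M.p)) (E F : ℝ) : Prop :=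
  ∀ i ∈ Icc 1 (M.n / b), ∀ j ∈ Icc 1 (M.m + 1), M.cp (j - 1) ≤ blockEnd M.n b (i - 1) →
    blockEnd M.n b i ≤ M.cp j →
    ‖∑ l ∈ Icc 1 i, θ l - M.β j‖ ≤ E ∧ l1norm (∑ l ∈ Icc 1 i, θ l - M.β j) ≤ F

variable {M} {b D : ℕ} {θ : ℕ → EuclideanSpace ℝ (Fin M.p)} {E F w ν : ℝ}

lemma mem_candidateBlocks {p k : ℕ} {w : ℝ} {θ : ℕ → EuclideanSpace ℝ (Fin p)} {i : ℕ} :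
    i ∈ candidateBlocks k w θ ↔ (2 ≤ i ∧ i ≤ k) ∧ w < ‖θ i‖ := by
  simp [candidateBlocks]

/-- If no change point is that close, the blocks on both sides of the boundary lie in one segment;
then θ_i is the difference of two estimates of the same coefficient and has norm at most 2E ≤ w. -/
lemma candidate_near (hb : 0 < b) (hD : 8 ≤ D)
    (hsp : ∀ j ≤ M.m, M.cp j + D * b ≤ M.cp (j + 1)) (hacc : M.BlockAccurate b θ E F)
    (hEw : 2 * E ≤ w) {i : ℕ} (hi : i ∈ candidateBlocks (M.n / b) w θ) :
    ∃ j ∈ Icc 1 M.m, 1 + (i - 1) * b < M.cp j + b ∧ M.cp j < 1 + (i - 1) * b + b := by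
  obtain ⟨⟨h2, hk⟩, hw⟩ := mem_candidateBlocks.1 hi
  obtain ⟨i, rfl⟩ : ∃ l, i = l + 2 := ⟨i - 2, by omega⟩
  rw [show i + 2 - 1 = i + 1 by omega]
  by_contra hcon
  push Not at hcon
  have e1 : (i + 1) * b = i * b + b := by ring
  have e2 : (i + 2) * b = i * b + 2 * b := by ring
  have hDb : 8 * b ≤ D * b := Nat.mul_le_mul_right b hD
  have hkb : (i + 2) * b ≤ M.n := (Nat.mul_le_mul_right b hk).trans (Nat.div_mul_le_self _ _)
  obtain ⟨j, hj, hj1, hj2⟩ := M.exists_segment (t := 1 + (i + 1) * b) (by omega) (by omega)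
  obtain ⟨hj3, hj4⟩ := Finset.mem_Icc.1 hj
  have hlow : M.cp (j - 1) ≤ blockEnd M.n b i := by
    rw [blockEnd_of_lt (by omega)]
    rcases Nat.eq_zero_or_pos (j - 1) with h0 | h0
    · rw [h0, M.cp_zero]; omega
    · have := hcon (j - 1) (Finset.mem_Icc.2 ⟨h0, by omega⟩)
      by_contra hlt
      have := this (by omega)
      omega
  have hhigh : blockEnd M.n b (i + 2) ≤ M.cp j := by
    rcases Nat.lt_or_ge M.m j with h | h
    · rw [show j = M.m + 1 by omega, M.cp_last]; exact blockEnd_le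
    · have h5 := hcon j (Finset.mem_Icc.2 ⟨hj3, h⟩) (by omega)
      rcases Nat.lt_or_ge (i + 2) (M.n / b) with h6 | h6
      · rw [blockEnd_of_lt h6]; omega
      · exfalso
        have h7 := M.spacing_of_lt hsp (show j < M.m + 1 by omega) le_rfl
        rw [M.cp_last] at h7
        have h8 := Nat.lt_mul_div_succ M.n hb
        rw [show M.n / b = i + 2 by omega] at h8
        have e3 : b * (i + 2 + 1) = i * b + 3 * b := by ring
        omega
  have hmid : blockEnd M.n b (i + 1) = 1 + (i + 1) * b := blockEnd_of_lt (by omega)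
  have a1 := (hacc (i + 1) (Finset.mem_Icc.2 ⟨by omega, by omega⟩) j hj hlow
    (by rw [hmid]; omega)).1
  have a2 := (hacc (i + 2) (Finset.mem_Icc.2 ⟨by omega, hk⟩) j hj
    (by rw [show i + 2 - 1 = i + 1 by omega, hmid]; omega) hhigh).1
  have hθ : θ (i + 2) = (∑ l ∈ Icc 1 (i + 2), θ l - M.β j) - (∑ l ∈ Icc 1 (i + 1), θ l - M.β j) := by
    rw [Finset.sum_Icc_succ_top (by omega : 1 ≤ i + 1 + 1)]; abel
  have := norm_sub_le (∑ l ∈ Icc 1 (i + 2), θ l - M.β j) (∑ l ∈ Icc 1 (i + 1), θ l - M.β j)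
  rw [← hθ] at this
  linarith

/-- The last block before and the first block after the change point estimate the two neighbouring
coefficients, and their fits differ by two consecutive θ's. If both were below the threshold, the
jump would be at most 2E + 2w. -/
lemma exists_candidate_near (hb : 0 < b) (hD : 8 ≤ D)
    (hsp : ∀ j ≤ M.m, M.cp j + D * b ≤ M.cp (j + 1)) (hacc : M.BlockAccurate b θ E F)
    (hEw : 2 * E ≤ w) (hν : ∀ j ∈ Icc 1 M.m, ν ≤ ‖M.β (j + 1) - M.β j‖)
    (hEν : 2 * E + 2 * w < ν) {j : ℕ} (hj : j ∈ Icc 1 M.m) :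
    ∃ i ∈ candidateBlocks (M.n / b) w θ,
      1 + (i - 1) * b < M.cp j + b ∧ M.cp j < 1 + (i - 1) * b + b := by
  obtain ⟨hj1, hj2⟩ := Finset.mem_Icc.1 hj
  have hDb : 8 * b ≤ D * b := Nat.mul_le_mul_right b hD
  have s1 := hsp (j - 1) (by omega)
  rw [show j - 1 + 1 = j by omega] at s1
  have s2 := hsp j hj2
  have s0 : 1 ≤ M.cp (j - 1) := by
    have := M.succ_le_cp (show j - 1 ≤ M.m + 1 by omega); omega
  have s3 : M.cp (j + 1) ≤ M.n + 1 := by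
    rw [← M.cp_last]; exact M.cp_le_cp (by omega) le_rfl
  -- q is the index with 1 + qb ≤ t_j < 1 + (q + 1)b: block q ends by t_j, and block q + 2 starts
  -- after it.
  have hq1 := Nat.div_mul_le_self (M.cp j - 1) b
  have hq2 := Nat.lt_mul_div_succ (M.cp j - 1) hb
  generalize (M.cp j - 1) / b = q at hq1 hq2
  have e0 : b * (q + 1) = q * b + b := by ring
  have e1 : (q + 1) * b = q * b + b := by ring
  have e2 : (q + 2) * b = q * b + 2 * b := by ring
  have e3 : (q + 3) * b = q * b + 3 * b := by ring
  have hqpos : 1 ≤ q := by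
    by_contra h
    have : q = 0 := by omega
    rw [this, zero_add, mul_one] at hq2
    omega
  have hk : q + 3 ≤ M.n / b := (Nat.le_div_iff_mul_le hb).2 (by omega)
  obtain ⟨r, hr⟩ : ∃ r, q = r + 1 := ⟨q - 1, by omega⟩
  have e4 : q * b = r * b + b := by rw [hr]; ring
  have a1 := (hacc q (Finset.mem_Icc.2 ⟨hqpos, by omega⟩) j
    (Finset.mem_Icc.2 ⟨hj1, by omega⟩)
    (by rw [show q - 1 = r by omega, blockEnd_of_lt (by omega)]; omega)
    (by rw [blockEnd_of_lt (by omega)]; omega)).1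
  have a2 := (hacc (q + 2) (Finset.mem_Icc.2 ⟨by omega, by omega⟩) (j + 1)
    (Finset.mem_Icc.2 ⟨by omega, by omega⟩)
    (by rw [show q + 2 - 1 = q + 1 by omega, blockEnd_of_lt (by omega), Nat.add_sub_cancel]; omega)
    (by rw [blockEnd_of_lt (by omega)]; omega)).1
  have hsum : M.β (j + 1) - M.β j = θ (q + 1) + θ (q + 2)
      - (∑ l ∈ Icc 1 (q + 2), θ l - M.β (j + 1)) + (∑ l ∈ Icc 1 q, θ l - M.β j) := by
    rw [Finset.sum_Icc_succ_top (by omega : 1 ≤ q + 1 + 1),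
      Finset.sum_Icc_succ_top (by omega : 1 ≤ q + 1)]
    abel
  have hbig : w < ‖θ (q + 1)‖ ∨ w < ‖θ (q + 2)‖ := by
    by_contra h
    push Not at h
    have t1 := hν j hj
    rw [hsum] at t1
    have t2 := norm_add_le (θ (q + 1) + θ (q + 2) - (∑ l ∈ Icc 1 (q + 2), θ l - M.β (j + 1)))
      (∑ l ∈ Icc 1 q, θ l - M.β j)
    have t3 := norm_sub_le (θ (q + 1) + θ (q + 2)) (∑ l ∈ Icc 1 (q + 2), θ l - M.β (j + 1))
    have t4 := norm_add_le (θ (q + 1)) (θ (q + 2))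
    linarith [h.1, h.2]
  have hfin : ∀ i, i = q + 1 ∨ i = q + 2 → w < ‖θ i‖ → ∃ i ∈ candidateBlocks (M.n / b) w θ,
      1 + (i - 1) * b < M.cp j + b ∧ M.cp j < 1 + (i - 1) * b + b := by
    intro i hi hwi
    have hc : i ∈ candidateBlocks (M.n / b) w θ :=
      mem_candidateBlocks.2 ⟨⟨by omega, by omega⟩, hwi⟩
    obtain ⟨j', hj', h1, h2⟩ := candidate_near hb hD hsp hacc hEw hc
    have hj'' := Finset.mem_Icc.1 hj'
    -- Only a weak inequality is available on the left, since t_j may be a block boundary.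
    -- `candidate_near` supplies strictness for some change point, which the spacing identifies as
    -- the j-th.
    have hnear : 1 + (i - 1) * b ≤ M.cp j + b ∧ M.cp j < 1 + (i - 1) * b + b := by
      rcases hi with rfl | rfl
      · rw [show q + 1 - 1 = q by omega]; omega
      · rw [show q + 2 - 1 = q + 1 by omega]; omega
    have : j' = j := by
      rcases lt_trichotomy j' j with h | h | h
      · have := M.spacing_of_lt hsp h (by omega); omega
      · exact h
      · have := M.spacing_of_lt hsp h (by omega); omega
    subst this
    exact ⟨i, hc, h1, h2⟩
  rcases hbig with h | h
  · exact hfin _ (.inl rfl) h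
  · exact hfin _ (.inr rfl) h

/-- The clustering step recovers the number of change points, and every cluster consists of block
end points near one change point. -/
lemma clusters_near {κ₁ κ₂ κmax : ℝ} {mf : ℕ} {J : ℕ → Finset ℕ} (hb : 0 < b) (hD : 8 ≤ D)
    (hDκ : κmax + 2 ≤ D)
    (hsp : ∀ j ≤ M.m, M.cp j + D * b ≤ M.cp (j + 1)) (hacc : M.BlockAccurate b θ E F)
    (hEw : 2 * E ≤ w) (hν : ∀ j ∈ Icc 1 M.m, ν ≤ ‖M.β (j + 1) - M.β j‖)
    (hEν : 2 * E + 2 * w < ν) (hκ₁ : κ₁ ≤ κmax) (hκ₂ : 1 ≤ κ₂) (hκ₂m : κ₂ ≤ κmax)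
    (hJ : IsOrderedPartition (candidateBlocks (M.n / b) w θ) mf J)
    (hcl : IsBlockClustering κ₁ κ₂ b
      ((candidateBlocks (M.n / b) w θ).image fun i => blockEnd M.n b (i - 1)) mf
      fun j => (J j).image fun i => blockEnd M.n b (i - 1)) :
    mf = M.m ∧ ∀ j ∈ Icc 1 M.m, ∀ i ∈ J j, (2 ≤ i ∧ i ≤ M.n / b) ∧
      1 + (i - 1) * b < M.cp j + b ∧ M.cp j < 1 + (i - 1) * b + b := by
  have hDb : 8 * b ≤ D * b := Nat.mul_le_mul_right b hD
  have hend : ∀ i ∈ candidateBlocks (M.n / b) w θ, blockEnd M.n b (i - 1) = 1 + (i - 1) * b := by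
    intro i hi
    obtain ⟨⟨h2, hk⟩, -⟩ := mem_candidateBlocks.1 hi
    exact blockEnd_of_lt (by omega)
  set A := (candidateBlocks (M.n / b) w θ).image fun i => blockEnd M.n b (i - 1) with hA
  have hAmem : ∀ a ∈ A, ∃ i ∈ candidateBlocks (M.n / b) w θ, a = 1 + (i - 1) * b := by
    intro a ha
    obtain ⟨i, hi, e⟩ := Finset.mem_image.1 ha
    exact ⟨i, hi, by rw [← e, hend i hi]⟩
  have hsel : ∀ a, ∃ j, a ∈ A → j ∈ Icc 1 M.m ∧ a < M.cp j + b ∧ M.cp j < a + b := by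
    intro a
    by_cases ha : a ∈ A
    · obtain ⟨i, hi, rfl⟩ := hAmem a ha
      obtain ⟨j, hj, h⟩ := candidate_near hb hD hsp hacc hEw hi
      exact ⟨j, fun _ => ⟨hj, h⟩⟩
    · exact ⟨0, fun h => absurd h ha⟩
  choose lab hlab using hsel
  have huniq : ∀ {j j' a : ℕ}, j ∈ Icc 1 M.m → j' ∈ Icc 1 M.m → a < M.cp j + b → M.cp j < a + b →
      a < M.cp j' + b → M.cp j' < a + b → j = j' := by
    intro j j' a hj hj' h1 h2 h3 h4
    rw [Finset.mem_Icc] at hj hj'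
    rcases lt_trichotomy j j' with h | h | h
    · have := M.spacing_of_lt hsp h (by omega); omega
    · exact h
    · have := M.spacing_of_lt hsp h (by omega); omega
  have hmono : ∀ a ∈ A, ∀ a' ∈ A, a ≤ a' → lab a ≤ lab a' := by
    intro a ha a' ha' hle
    obtain ⟨h1, h2, h3⟩ := hlab a ha
    obtain ⟨h4, h5, h6⟩ := hlab a' ha'
    rw [Finset.mem_Icc] at h1 h4
    by_contra hcon
    have := M.spacing_of_lt hsp (not_le.1 hcon) (by omega)
    omega
  have hb0 : (0 : ℝ) < b := by exact_mod_cast hb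
  have hmain := hcl.eq_of_label (lab := lab) (κmax := κmax) (m := M.m)
    (fun a ha => (hlab a ha).1)
    (fun j hj => by
      obtain ⟨i, hi, h1, h2⟩ := exists_candidate_near hb hD hsp hacc hEw hν hEν hj
      have hmem : 1 + (i - 1) * b ∈ A := by
        rw [← hend i hi]; exact Finset.mem_image_of_mem _ hi
      obtain ⟨h3, h4, h5⟩ := hlab _ hmem
      exact ⟨_, hmem, huniq h3 hj h4 h5 h1 h2⟩)
    hmono
    (fun a ha a' ha' he => by
      obtain ⟨h1, h2, h3⟩ := hlab a ha
      obtain ⟨h4, h5, h6⟩ := hlab a' ha'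
      rw [← he] at h5 h6
      obtain ⟨i, hi, rfl⟩ := hAmem a ha
      obtain ⟨i', hi', rfl⟩ := hAmem a' ha'
      -- Both points are less than b from one change point, so they are less than 2b apart; being on
      -- a grid of mesh b, they are at most b apart.
      have hle : i' - 1 ≤ i - 1 + 1 := by
        by_contra hcon
        have : (i - 1 + 2) * b ≤ (i' - 1) * b := Nat.mul_le_mul_right b (by omega)
        rw [add_mul] at this
        omega
      have : (i' - 1) * b ≤ (i - 1 + 1) * b := Nat.mul_le_mul_right b hle
      rw [add_one_mul] at this
      have h7 : 1 + (i' - 1) * b ≤ 1 + (i - 1) * b + b := by omega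
      have h8 : ((1 + (i' - 1) * b : ℕ) : ℝ) ≤ ((1 + (i - 1) * b : ℕ) : ℝ) + b := by
        exact_mod_cast h7
      linarith)
    (fun a ha a' ha' hle hdist => by
      obtain ⟨h1, h2, h3⟩ := hlab a ha
      obtain ⟨h4, h5, h6⟩ := hlab a' ha'
      rw [Finset.mem_Icc] at h1 h4
      by_contra hne
      have hlt := lt_of_le_of_ne (hmono a ha a' ha' hle) hne
      have := M.spacing_of_lt hsp hlt (by omega)
      -- Different labels force a distance above (D - 2)b ≥ κ_max b.
      have h7 : a + D * b < a' + 2 * b := by omega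
      have h8 : (a : ℝ) + D * b < a' + 2 * b := by exact_mod_cast h7
      nlinarith)
    hκ₁ hκ₂ hκ₂m
  obtain ⟨hm, hR⟩ := hmain
  refine ⟨hm, fun j hj i hi => ?_⟩
  have hj' : j ∈ Icc 1 mf := by rwa [hm]
  have hic := hJ.mem_of_mem hj' hi
  refine ⟨(mem_candidateBlocks.1 hic).1, ?_⟩
  have h1 : blockEnd M.n b (i - 1) ∈ A.filter fun a => lab a = j := by
    rw [← hR j hj']
    exact Finset.mem_image_of_mem _ hi
  rw [hend i hic] at h1
  obtain ⟨h2, h3⟩ := Finset.mem_filter.1 h1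
  have h4 := hlab _ h2
  rw [h3] at h4
  exact h4.2

end MLRModel

/-! ### Coefficient estimates and the local search -/

namespace MLRModel

variable {Ω : Type*} {M : MLRModel Ω} {b D : ℕ} {o : Output M.p} {E F : ℝ}

/-- The clusters `J 1, …, J m` of block indices belong to the change points. -/
def ClustersNear (M : MLRModel Ω) (b : ℕ) (o : Output M.p) : Prop :=
  o.mf = M.m ∧ ∀ j ∈ Icc 1 M.m, (o.J j).Nonempty ∧ ∀ i ∈ o.J j, (2 ≤ i ∧ i ≤ M.n / b) ∧
    1 + (i - 1) * b < M.cp j + b ∧ M.cp j < 1 + (i - 1) * b + b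

/-- Extends the localization to the conventions J_0 and J_{m+1}. The last block can have length
almost 2b, hence the tolerance 2b instead of b. -/
lemma Jext_near (hb : 0 < b) (hD : 8 ≤ D) (hsp : ∀ j ≤ M.m, M.cp j + D * b ≤ M.cp (j + 1))
    (h : M.ClustersNear b o) {j : ℕ} (hj : j ≤ M.m + 1) :
    (o.Jext (M.n / b) j).Nonempty ∧ ∀ i ∈ o.Jext (M.n / b) j, (1 ≤ i ∧ i ≤ M.n / b) ∧
      1 + (i - 1) * b < M.cp j + 2 * b ∧ M.cp j < 1 + (i - 1) * b + 2 * b := by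
  have hDb : 8 * b ≤ D * b := Nat.mul_le_mul_right b hD
  have hk : 1 ≤ M.n / b := by
    rw [Nat.le_div_iff_mul_le hb]
    have h1 := hsp 0 (Nat.zero_le _)
    have h2 := M.cp_le_cp (show 1 ≤ M.m + 1 by omega) le_rfl
    rw [M.cp_zero] at h1
    rw [M.cp_last] at h2
    simp only [zero_add] at h1
    omega
  obtain ⟨hm, hJ⟩ := h
  unfold Output.Jext
  split_ifs with h0 h1
  · subst h0
    refine ⟨Finset.singleton_nonempty _, fun i hi => ?_⟩
    rw [Finset.mem_singleton] at hi
    subst hi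
    rw [M.cp_zero]
    simp [hk, hb]
  · subst h1
    refine ⟨Finset.singleton_nonempty _, fun i hi => ?_⟩
    rw [Finset.mem_singleton] at hi
    subst hi
    rw [hm, M.cp_last]
    have h3 := Nat.div_mul_le_self M.n b
    have h4 := Nat.lt_mul_div_succ M.n hb
    obtain ⟨q, hq⟩ : ∃ q, M.n / b = q + 1 := ⟨M.n / b - 1, by omega⟩
    rw [hq] at h3 h4 ⊢
    have e1 : (q + 1) * b = q * b + b := by ring
    have e2 : b * (q + 1 + 1) = q * b + 2 * b := by ring
    rw [Nat.add_sub_cancel]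
    omega
  · obtain ⟨hne, hi⟩ := hJ j (Finset.mem_Icc.2 ⟨by omega, by omega⟩)
    refine ⟨hne, fun i hi' => ?_⟩
    have := hi i hi'
    omega

/-- The index in the definition of β̂_j is midway between two clusters that lie near the ends of a
segment of length at least 8b, so its block is inside the segment and the block estimate applies. -/
lemma betaHat_accurate (hb : 0 < b) (hD : 8 ≤ D)
    (hsp : ∀ j ≤ M.m, M.cp j + D * b ≤ M.cp (j + 1)) (hacc : M.BlockAccurate b o.θ E F)
    (h : M.ClustersNear b o) {j : ℕ} (hj : j ∈ Icc 1 (M.m + 1)) :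
    ‖o.betaHat M.n b j - M.β j‖ ≤ E ∧ l1norm (o.betaHat M.n b j - M.β j) ≤ F := by
  obtain ⟨hj1, hj2⟩ := Finset.mem_Icc.1 hj
  have hDb : 8 * b ≤ D * b := Nat.mul_le_mul_right b hD
  obtain ⟨ne1, near1⟩ := Jext_near hb hD hsp h (show j - 1 ≤ M.m + 1 by omega)
  obtain ⟨ne2, near2⟩ := Jext_near hb hD hsp h hj2
  have n1 := near1 _ (largest_mem ne1)
  have n2 := near2 _ (smallest_mem ne2)
  have hs := hsp (j - 1) (by omega)
  rw [show j - 1 + 1 = j by omega] at hs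
  have hn : M.cp j ≤ M.n + 1 := by
    rw [← M.cp_last]; exact M.cp_le_cp hj2 le_rfl
  rw [Output.betaHat]
  generalize largest (o.Jext (M.n / b) (j - 1)) = u at n1
  generalize smallest (o.Jext (M.n / b) j) = v at n2
  obtain ⟨u, rfl⟩ : ∃ u', u = u' + 1 := ⟨u - 1, by omega⟩
  obtain ⟨v, rfl⟩ : ∃ v', v = v' + 1 := ⟨v - 1, by omega⟩
  rw [Nat.add_sub_cancel] at n1 n2
  obtain ⟨q, hq⟩ : ∃ q, (u + 1 + (v + 1)) / 2 = q + 1 := ⟨(u + 1 + (v + 1)) / 2 - 1, by omega⟩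
  rw [hq]
  have l1 : 2 * (q * b) ≤ u * b + v * b := by
    have : 2 * q * b ≤ (u + v) * b := Nat.mul_le_mul_right b (by omega)
    linarith
  have l2 : u * b + v * b ≤ 2 * (q * b) + b := by
    have : (u + v) * b ≤ (2 * q + 1) * b := Nat.mul_le_mul_right b (by omega)
    linarith
  have e1 : (q + 1) * b = q * b + b := by ring
  have e2 : (q + 2) * b = q * b + 2 * b := by ring
  have hk : q + 2 ≤ M.n / b := (Nat.le_div_iff_mul_le hb).2 (by omega)
  refine hacc (q + 1) (Finset.mem_Icc.2 ⟨by omega, by omega⟩) j hj ?_ ?_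
  · rw [Nat.add_sub_cancel, blockEnd_of_lt (by omega)]; omega
  · rw [blockEnd_of_lt (by omega)]; omega

/-- A singleton cluster is less than b from the change point. A larger cluster has extreme points at
least b apart, each less than b from the change point, which must therefore lie strictly between
them. -/
lemma searchDomain_near (hb : 0 < b) (h : M.ClustersNear b o) {j : ℕ} (hj : j ∈ Icc 1 M.m) :
    M.cp j ∈ o.searchDomain M.n b j ∧ ∀ s ∈ o.searchDomain M.n b j,
      s < M.cp j + 2 * b ∧ M.cp j < s + 2 * b ∧ smallest (o.R M.n b j) - b ≤ s ∧
        s ≤ largest (o.R M.n b j) + b := by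
  obtain ⟨hne, hnear⟩ := h.2 j hj
  -- Keeps t_j strictly above the lower end of the search domain even if the natural-number
  -- subtraction of b truncates to 0.
  have hpos : 1 ≤ M.cp j := by
    have := M.succ_le_cp (show j ≤ M.m + 1 by rw [Finset.mem_Icc] at hj; omega); omega
  have hR : ∀ a ∈ o.R M.n b j, ∃ q, a = 1 + q * b ∧ a < M.cp j + b ∧ M.cp j < a + b := by
    intro a ha
    obtain ⟨i, hi, rfl⟩ := Finset.mem_image.1 ha
    obtain ⟨⟨h1, h2⟩, h3⟩ := hnear i hi
    refine ⟨i - 1, blockEnd_of_lt (by omega), ?_⟩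
    rw [blockEnd_of_lt (by omega)]
    exact h3
  have hRne : (o.R M.n b j).Nonempty := hne.image _
  have m1 := smallest_mem hRne
  have m2 := largest_mem hRne
  obtain ⟨q1, a1, a2, a3⟩ := hR _ m1
  obtain ⟨q2, c1, c2, c3⟩ := hR _ m2
  have hle := smallest_le m2
  unfold Output.searchDomain
  split_ifs with hcard
  · simp only [Finset.mem_Ioo]
    obtain ⟨a, ha⟩ := Finset.card_eq_one.1 hcard
    have heq : smallest (o.R M.n b j) = largest (o.R M.n b j) :=
      (Finset.mem_singleton.1 (ha ▸ m1 : smallest (o.R M.n b j) ∈ ({a} : Finset ℕ))).trans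
        (Finset.mem_singleton.1 (ha ▸ m2 : largest (o.R M.n b j) ∈ ({a} : Finset ℕ))).symm
    refine ⟨⟨by omega, by omega⟩, fun s hs => ⟨by omega, by omega, by omega, by omega⟩⟩
  · have hlt : smallest (o.R M.n b j) + b ≤ largest (o.R M.n b j) := by
      have hne' : smallest (o.R M.n b j) ≠ largest (o.R M.n b j) := by
        intro heq
        refine hcard (Finset.card_eq_one.2 ⟨_, Finset.eq_singleton_iff_unique_mem.2
          ⟨m1, fun a ha => le_antisymm (heq ▸ le_largest ha) (smallest_le ha)⟩⟩)
      have hq : q1 + 1 ≤ q2 := by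
        by_contra hcon
        have : q2 * b ≤ q1 * b := Nat.mul_le_mul_right b (by omega)
        omega
      have : (q1 + 1) * b ≤ q2 * b := Nat.mul_le_mul_right b hq
      rw [add_one_mul] at this
      omega
    simp only [Finset.mem_Ioo]
    refine ⟨⟨by omega, by omega⟩, fun s hs => ⟨by omega, by omega, by omega, by omega⟩⟩

/-- On a window where the true coefficient is `M.β i`, a vector at distance about `D` from it
cannot fit better than a vector close to it, unless the window is short. -/
lemma fit_comparison {ω : Ω} {T c C : ℝ} {i s e : ℕ} (hC : 0 < C)
    (hi : i ∈ Icc 1 (M.m + 1)) (hs : M.cp (i - 1) ≤ s) (he : e ≤ M.cp i) (hse : s < e)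
    (hL : 0 ≤ M.logDim)
    (hgood : M.GoodAt T c C s e ω) {Dv βw βr : EuclideanSpace ℝ (Fin M.p)}
    (hD1 : c * ((e : ℝ) - s) * ‖Dv‖ ^ 2 ≤ ∑ t ∈ Ico s e, inner ℝ (M.x t ω) Dv ^ 2)
    (hD2 : |∑ t ∈ Ico s e, M.ε t ω * inner ℝ (M.x t ω) Dv|
      ≤ T * √(((e : ℝ) - s) * M.logDim) * ‖Dv‖)
    (hT : 0 ≤ T)
    (hw1 : ‖βw - (M.β i + Dv)‖ ≤ E) (hw2 : l1norm (βw - (M.β i + Dv)) ≤ F)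
    (hr1 : ‖βr - M.β i‖ ≤ E) (hr2 : l1norm (βr - M.β i) ≤ F)
    (hfit : ∑ t ∈ Ico s e, (M.y t ω - inner ℝ (M.x t ω) βw) ^ 2
      ≤ ∑ t ∈ Ico s e, (M.y t ω - inner ℝ (M.x t ω) βr) ^ 2) :
    c / 2 * ((e : ℝ) - s) * ‖Dv‖ ^ 2 ≤ 2 * C * (((e : ℝ) - s) * E ^ 2 + M.logDim * F ^ 2)
      + 2 * T * √(((e : ℝ) - s) * M.logDim) * ‖Dv‖
      + 4 * T * √(((e : ℝ) - s) * M.logDim) * F := by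
  set h : ℝ := (e : ℝ) - s with hh
  have hh0 : 0 ≤ h := by
    rw [hh, sub_nonneg]; exact_mod_cast hse.le
  set δw := βw - (M.β i + Dv) with hδw
  set δr := βr - M.β i with hδr
  obtain ⟨g1, -, g3, -, -⟩ := hgood
  rw [← hh] at g1 g3
  have hquad : ∀ δ : EuclideanSpace ℝ (Fin M.p), ‖δ‖ ≤ E → l1norm δ ≤ F →
      ∑ t ∈ Ico s e, inner ℝ (M.x t ω) δ ^ 2 ≤ C * (h * E ^ 2 + M.logDim * F ^ 2) := by
    intro δ h1 h2
    refine (g3 δ).trans ?_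
    have := l1norm_nonneg δ
    gcongr
  have hlin : ∀ δ : EuclideanSpace ℝ (Fin M.p), l1norm δ ≤ F →
      |∑ t ∈ Ico s e, M.ε t ω * inner ℝ (M.x t ω) δ| ≤ T * √(h * M.logDim) * F := by
    intro δ h2
    refine (abs_sum_mul_inner_le _ (fun t => M.x t ω) (fun t => M.ε t ω) g1 δ).trans ?_
    gcongr
  -- The cross term between the jump and the error δw is absorbed by the square (⟨x, Dv⟩ + 2⟨x,
  -- δw⟩)²/2 ≥ 0, at the price of half the signal.
  have key : ∑ t ∈ Ico s e, (M.y t ω - inner ℝ (M.x t ω) βr) ^ 2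
      - ∑ t ∈ Ico s e, (M.y t ω - inner ℝ (M.x t ω) βw) ^ 2
      ≤ ∑ t ∈ Ico s e, inner ℝ (M.x t ω) δr ^ 2 + ∑ t ∈ Ico s e, inner ℝ (M.x t ω) δw ^ 2
        - 1 / 2 * ∑ t ∈ Ico s e, inner ℝ (M.x t ω) Dv ^ 2
        + 2 * ∑ t ∈ Ico s e, M.ε t ω * inner ℝ (M.x t ω) Dv
        + 2 * ∑ t ∈ Ico s e, M.ε t ω * inner ℝ (M.x t ω) δw
        - 2 * ∑ t ∈ Ico s e, M.ε t ω * inner ℝ (M.x t ω) δr := by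
    simp only [Finset.mul_sum]
    rw [← Finset.sum_sub_distrib, ← Finset.sum_add_distrib, ← Finset.sum_sub_distrib,
      ← Finset.sum_add_distrib, ← Finset.sum_add_distrib, ← Finset.sum_sub_distrib]
    refine Finset.sum_le_sum fun t ht => ?_
    rw [Finset.mem_Ico] at ht
    rw [M.y_eq hi (hs.trans ht.1) (ht.2.trans_le he), show βw = M.β i + Dv + δw by rw [hδw]; abel,
      show βr = M.β i + δr by rw [hδr]; abel, inner_add_right, inner_add_right, inner_add_right]
    nlinarith [sq_nonneg (inner ℝ (M.x t ω) Dv + 2 * inner ℝ (M.x t ω) δw)]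
  have q1 := hquad δw hw1 hw2
  have q2 := hquad δr hr1 hr2
  have l1 := (le_abs_self _).trans (hlin δw hw2)
  have l2 := (neg_le_abs _).trans (hlin δr hr2)
  have l3 := (le_abs_self _).trans hD2
  linarith

end MLRModel

/-- Here h is the window length and N the size of the jump. Small γ makes h E² negligible; large k
handles the noise terms, through √(hLd) ≤ hν/k, and the ℓ¹ error dL, through E ≤ 1. Each of the four
terms is at most c/16 of hN², which totals less than c/2. -/
lemma signal_dominates {c C T k γ E L h ν N d : ℝ} (hc : 0 < c) (hC : 0 < C) (hT : 0 < T)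
    (hk : 0 < k) (hγ : γ ≤ 1) (hE0 : 0 ≤ E) (hE1 : E ≤ 1) (hEγ : E ≤ γ * ν)
    (hγC : 32 * C * γ ^ 2 ≤ c) (hkC : 512 * C ≤ c * k ^ 2) (hkT : 256 * T ≤ c * k)
    (hL : 0 < L) (hh : 0 < h) (hν : 0 < ν) (hνN : ν ≤ N) (hd : 1 ≤ d)
    (hsig : k ^ 2 * (d * L) ≤ h * ν ^ 2) :
    2 * C * (h * E ^ 2 + L * (4 * √d * E) ^ 2) + 2 * T * √(h * L) * N
      + 4 * T * √(h * L) * (4 * √d * E) < c / 2 * h * N ^ 2 := by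
  have hN : 0 < N := hν.trans_le hνN
  have hγ0 : 0 ≤ γ := by
    by_contra hcon
    push Not at hcon
    nlinarith
  have hνN2 : ν ^ 2 ≤ N ^ 2 := pow_le_pow_left₀ hν.le hνN 2
  have hZ : 0 < h * N ^ 2 := by positivity
  have hsd : √(h * L) * √d ≤ h * ν / k := by
    rw [← Real.sqrt_mul (by positivity), Real.sqrt_le_left (by positivity), div_pow, mul_pow,
      le_div_iff₀ (by positivity)]
    have := mul_le_mul_of_nonneg_left hsig hh.le
    linarith
  have hs1 : √(h * L) ≤ h * ν / k := by
    refine le_trans ?_ hsd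
    exact le_mul_of_one_le_right (Real.sqrt_nonneg _) (Real.one_le_sqrt.2 hd)
  have hTk : T / k ≤ c / 256 := by
    rw [div_le_div_iff₀ hk (by norm_num)]; linarith
  have t1 : 2 * C * (h * E ^ 2) ≤ c / 16 * (h * N ^ 2) := by
    have h1 : E ^ 2 ≤ γ ^ 2 * N ^ 2 := by
      refine (pow_le_pow_left₀ hE0 hEγ 2).trans ?_
      rw [mul_pow]; gcongr
    calc 2 * C * (h * E ^ 2) ≤ 2 * C * (h * (γ ^ 2 * N ^ 2)) := by gcongr
      _ = 32 * C * γ ^ 2 / 16 * (h * N ^ 2) := by ring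
      _ ≤ c / 16 * (h * N ^ 2) := by gcongr
  have t2 : 2 * C * (L * (4 * √d * E) ^ 2) ≤ c / 16 * (h * N ^ 2) := by
    have h1 : (4 * √d * E) ^ 2 ≤ 16 * d := by
      rw [mul_pow, mul_pow, Real.sq_sqrt (by linarith)]
      have : E ^ 2 ≤ 1 := pow_le_one₀ hE0 hE1
      nlinarith
    have h2 : 2 * C * (L * (4 * √d * E) ^ 2) ≤ 2 * C * (L * (16 * d)) := by gcongr
    have h3 : 512 * C * (d * L) ≤ c * k ^ 2 * (d * L) := by gcongr
    have h4 : c * (k ^ 2 * (d * L)) ≤ c * (h * N ^ 2) := by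
      refine mul_le_mul_of_nonneg_left (hsig.trans ?_) hc.le
      gcongr
    linarith
  have t3 : 2 * T * √(h * L) * N ≤ c / 128 * (h * N ^ 2) := by
    calc 2 * T * √(h * L) * N ≤ 2 * T * (h * ν / k) * N := by gcongr
      _ ≤ 2 * T * (h * N / k) * N := by gcongr
      _ = 2 * (T / k) * (h * N ^ 2) := by ring
      _ ≤ 2 * (c / 256) * (h * N ^ 2) := by gcongr
      _ = _ := by ring
  have t4 : 4 * T * √(h * L) * (4 * √d * E) ≤ c / 16 * (h * N ^ 2) := by
    have h1 : E ≤ N := hEγ.trans ((mul_le_of_le_one_left hν.le hγ).trans hνN)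
    calc 4 * T * √(h * L) * (4 * √d * E) = 16 * T * (√(h * L) * √d) * E := by ring
      _ ≤ 16 * T * (h * ν / k) * N := by gcongr
      _ ≤ 16 * T * (h * N / k) * N := by gcongr
      _ = 16 * (T / k) * (h * N ^ 2) := by ring
      _ ≤ 16 * (c / 256) * (h * N ^ 2) := by gcongr
      _ = _ := by ring
  nlinarith [mul_pos hc hZ]

namespace MLRModel

variable {Ω : Type*} {M : MLRModel Ω} {b D : ℕ} {o : Output M.p} {E : ℝ}

/-- Accuracy of the change point estimates. -/
lemma location_error {ω : Ω} {K₀ T c C k γ ν : ℝ} (hb : 0 < b) (hD : 8 ≤ D)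
    (hsp : ∀ j ≤ M.m, M.cp j + D * b ≤ M.cp (j + 1)) (h : M.ClustersNear b o)
    (hβ : ∀ j ∈ Icc 1 (M.m + 1), ‖o.betaHat M.n b j - M.β j‖ ≤ E ∧
      l1norm (o.betaHat M.n b j - M.β j) ≤ 4 * √M.dstar * E)
    (hgood : M.Good K₀ T c C ω) (hn : 2 ≤ M.n)
    (hc : 0 < c) (hC : 0 < C) (hT : 0 < T)
    (hk : 0 < k) (hγ : γ ≤ 1) (hE1 : E ≤ 1) (hEγ : E ≤ γ * ν)
    (hγC : 32 * C * γ ^ 2 ≤ c) (hkC : 512 * C ≤ c * k ^ 2) (hkT : 256 * T ≤ c * k)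
    (hν : 0 < ν) (hνj : ∀ j ∈ Icc 1 M.m, ν ≤ ‖M.β (j + 1) - M.β j‖)
    (hK₀ : K₀ * ν ^ 2 ≤ k ^ 2 * M.dstar)
    {j : ℕ} (hj : j ∈ Icc 1 M.m) (htf : o.tf j ∈ o.searchDomain M.n b j)
    (hmin : o.localLoss M.n b (fun t => M.x t ω) (fun t => M.y t ω) j (o.tf j)
      ≤ o.localLoss M.n b (fun t => M.x t ω) (fun t => M.y t ω) j (M.cp j)) :
    |(o.tf j : ℝ) - M.cp j| ≤ k ^ 2 * M.dstar * M.logDim / ν ^ 2 := by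
  have hL := logDim_pos hn
  have hd : (1 : ℝ) ≤ M.dstar := by exact_mod_cast M.one_le_dstar
  have hDb : 8 * b ≤ D * b := Nat.mul_le_mul_right b hD
  obtain ⟨hj1, hj2⟩ := Finset.mem_Icc.1 hj
  obtain ⟨hcp, hdom⟩ := searchDomain_near hb h hj
  obtain ⟨s1, s2, s3, s4⟩ := hdom _ htf
  obtain ⟨-, -, c3, c4⟩ := hdom _ hcp
  have hE0 : 0 ≤ E := (norm_nonneg _).trans
    (hβ 1 (Finset.mem_Icc.2 ⟨le_rfl, by omega⟩)).1
  have hsp1 := hsp (j - 1) (by omega)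
  rw [show j - 1 + 1 = j by omega] at hsp1
  have hsp2 := hsp j hj2
  have hjm : j ∈ Icc 1 (M.m + 1) := Finset.mem_Icc.2 ⟨hj1, by omega⟩
  have hjm' : j + 1 ∈ Icc 1 (M.m + 1) := Finset.mem_Icc.2 ⟨by omega, by omega⟩
  have hb1 := hβ j hjm
  have hb2 := hβ (j + 1) hjm'
  simp only [Output.localLoss] at hmin
  by_contra hcon
  push Not at hcon
  -- A violating window is long enough both for the good event and for the signal condition; the
  -- first uses K₀ν² ≤ k²d*.
  have hshort : ∀ l : ℝ, k ^ 2 * M.dstar * M.logDim / ν ^ 2 < l →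
      K₀ * M.logDim ≤ l ∧ k ^ 2 * (M.dstar * M.logDim) ≤ l * ν ^ 2 ∧ 0 < l := by
    intro l hl
    have hl0 : 0 < l := lt_of_le_of_lt (by positivity) hl
    rw [div_lt_iff₀ (by positivity)] at hl
    refine ⟨?_, by linarith, hl0⟩
    have h1 := mul_le_mul_of_nonneg_right hK₀ hL.le
    have h2 : K₀ * M.logDim * ν ^ 2 ≤ l * ν ^ 2 := by linarith
    exact le_of_mul_le_mul_right h2 (by positivity)
  rcases lt_trichotomy (M.cp j) (o.tf j) with hlt | heq | hlt
  · have hlt' : (M.cp j : ℝ) < o.tf j := by exact_mod_cast hlt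
    rw [abs_of_pos (by linarith)] at hcon
    obtain ⟨w1, w2, w3⟩ := hshort _ hcon
    have hg := hgood (j + 1) hjm' (M.cp j) (o.tf j) le_rfl hlt (by omega) w1
    -- The losses at the two split points agree outside the window between them, so optimality
    -- compares the two fits on that window alone.
    have hfit : ∑ t ∈ Ico (M.cp j) (o.tf j), (M.y t ω - inner ℝ (M.x t ω) (o.betaHat M.n b j)) ^ 2
        ≤ ∑ t ∈ Ico (M.cp j) (o.tf j),
          (M.y t ω - inner ℝ (M.x t ω) (o.betaHat M.n b (j + 1))) ^ 2 := by
      rw [← Finset.sum_Ico_consecutive _ c3 hlt.le,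
        ← Finset.sum_Ico_consecutive (fun t =>
          (M.y t ω - inner ℝ (M.x t ω) (o.betaHat M.n b (j + 1))) ^ 2) hlt.le s4] at hmin
      linarith
    have hcmp := fit_comparison (E := E) (F := 4 * √M.dstar * E) (Dv := -(M.β (j + 1) - M.β j))
      hC hjm' le_rfl (by omega) hlt hL.le hg
      (by simp only [norm_neg, inner_neg_right, neg_sq]; exact hg.2.2.2.1 j hj)
      (by
        simp only [norm_neg, inner_neg_right, mul_neg, Finset.sum_neg_distrib, abs_neg]
        exact hg.2.2.2.2 j hj) hT.le
      (by rw [neg_sub, add_sub_cancel]; exact hb1.1) (by rw [neg_sub, add_sub_cancel]; exact hb1.2)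
      hb2.1 hb2.2 hfit
    rw [norm_neg] at hcmp
    exact absurd hcmp (not_le.2 (signal_dominates hc hC hT hk hγ hE0 hE1 hEγ hγC hkC hkT hL w3 hν
      (hνj j hj) hd w2))
  · rw [heq, sub_self, abs_zero] at hcon
    exact absurd hcon (not_lt.2 (by positivity))
  · have hlt' : (o.tf j : ℝ) < M.cp j := by exact_mod_cast hlt
    rw [abs_sub_comm, abs_of_pos (by linarith)] at hcon
    obtain ⟨w1, w2, w3⟩ := hshort _ hcon
    have hg := hgood j hjm (o.tf j) (M.cp j) (by omega) hlt le_rfl w1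
    have hfit : ∑ t ∈ Ico (o.tf j) (M.cp j),
          (M.y t ω - inner ℝ (M.x t ω) (o.betaHat M.n b (j + 1))) ^ 2
        ≤ ∑ t ∈ Ico (o.tf j) (M.cp j),
          (M.y t ω - inner ℝ (M.x t ω) (o.betaHat M.n b j)) ^ 2 := by
      rw [← Finset.sum_Ico_consecutive _ s3 hlt.le,
        ← Finset.sum_Ico_consecutive (fun t =>
          (M.y t ω - inner ℝ (M.x t ω) (o.betaHat M.n b (j + 1))) ^ 2) hlt.le c4] at hmin
      linarith
    have hcmp := fit_comparison (E := E) (F := 4 * √M.dstar * E) (Dv := M.β (j + 1) - M.β j)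
      hC hjm (by omega) le_rfl hlt hL.le hg (hg.2.2.2.1 j hj) (hg.2.2.2.2 j hj) hT.le
      (by rw [add_sub_cancel]; exact hb2.1) (by rw [add_sub_cancel]; exact hb2.2)
      hb1.1 hb1.2 hfit
    exact absurd hcmp (not_le.2 (signal_dominates hc hC hT hk hγ hE0 hE1 hEγ hγC hkC hkT hL w3 hν
      (hνj j hj) hd w2))

end MLRModel

/-! ### The procedure on the good event -/

/-- A false positive has β_i = 0 and |v_i| > η ≥ a, so it contributes at least a to the ℓ¹ error. -/
lemma card_false_positives_mul_le {p : ℕ} {η a : ℝ} (ha : a ≤ η)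
    (v β : EuclideanSpace ℝ (Fin p)) :
    ((vsupp (hardThreshold η v) \ vsupp β).card : ℝ) * a ≤ l1norm (v - β) := by
  rw [← nsmul_eq_mul]
  refine (Finset.card_nsmul_le_sum _ (fun i => |(v - β) i|) a fun i hi => ?_).trans
    (Finset.sum_le_univ_sum_of_nonneg fun i => abs_nonneg _)
  obtain ⟨h1, h2⟩ := Finset.mem_sdiff.1 hi
  have hβ : β i = 0 := by simpa [vsupp] using h2
  have hv : η < |v i| := by
    by_contra hcon
    simp [vsupp, hardThreshold, hcon] at h1
  rw [PiLp.sub_apply, hβ, sub_zero]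
  linarith

namespace MLRModel

variable {Ω : Type*} {M : MLRModel Ω}

lemma nu_le {j : ℕ} (hj : j ∈ Icc 1 M.m) : M.nu ≤ ‖M.β (j + 1) - M.β j‖ :=
  ciInf_le (f := fun j : Icc 1 M.m => ‖M.β (j + 1) - M.β j‖) (Set.finite_range _).bddBelow ⟨j, hj⟩

lemma spacing_of_minSpacing {b D : ℕ} (hb : 0 < b) (h : (D : ℝ) ≤ M.minSpacing / b) :
    ∀ j ≤ M.m, M.cp j + D * b ≤ M.cp (j + 1) := by
  intro j hj
  have hb0 : (0 : ℝ) < b := by exact_mod_cast hb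
  rw [le_div_iff₀ hb0] at h
  have h1 : M.minSpacing ≤ (M.cp (j + 1) : ℝ) - (M.cp (j + 1 - 1) : ℝ) :=
    ciInf_le (f := fun j : Icc 1 (M.m + 1) => (M.cp j : ℝ) - (M.cp (j - 1) : ℝ))
      (Set.finite_range _).bddBelow ⟨j + 1, Finset.mem_Icc.2 ⟨by omega, by omega⟩⟩
  rw [Nat.add_sub_cancel] at h1
  have h2 : (M.cp j : ℝ) + D * b ≤ M.cp (j + 1) := by linarith
  exact_mod_cast h2

/-- A d*-sparse vector with entries bounded by B has squared norm at most B²d*, and the first jump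
is a difference of two such vectors. -/
lemma nu_sq_le {B : ℝ} (hβ : ∀ j ∈ Icc 1 (M.m + 1), ∀ i, |M.β j i| ≤ B)
    (hν : 0 ≤ M.nu) : M.nu ^ 2 ≤ 8 * B ^ 2 * M.dstar := by
  have hm := M.one_le_m
  have m1 : 1 ∈ Icc 1 (M.m + 1) := Finset.mem_Icc.2 ⟨le_rfl, by omega⟩
  have m2 : 1 + 1 ∈ Icc 1 (M.m + 1) := Finset.mem_Icc.2 ⟨by omega, by omega⟩
  have hsq : ∀ j ∈ Icc 1 (M.m + 1), ‖M.β j‖ ^ 2 ≤ B ^ 2 * M.dstar := by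
    intro j hj
    rw [EuclideanSpace.real_norm_sq_eq, ← Finset.sum_subset (Finset.subset_univ (vsupp (M.β j)))
      (fun i _ hi => by simpa [vsupp] using hi)]
    refine (Finset.sum_le_card_nsmul _ _ (B ^ 2) fun i _ => ?_).trans ?_
    · rw [← sq_abs]; exact pow_le_pow_left₀ (abs_nonneg _) (hβ j hj i) 2
    · rw [nsmul_eq_mul, mul_comm]
      have : ((vsupp (M.β j)).card : ℝ) ≤ M.dstar := by exact_mod_cast M.card_vsupp_le_dstar hj
      gcongr
  have h1 := M.nu_le (Finset.mem_Icc.2 ⟨le_rfl, hm⟩)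
  have h2 := h1.trans (norm_sub_le _ _)
  have h3 := pow_le_pow_left₀ hν h2 2
  have h4 := hsq 1 m1
  have h5 := hsq _ m2
  have h6 : 0 ≤ B ^ 2 * M.dstar := by positivity
  nlinarith [sq_nonneg (‖M.β (1 + 1)‖ - ‖M.β 1‖)]

/-- Everything that is needed about the outcome, on the good event. -/
lemma outcome {ω : Ω} {K₀ T c C C₁ C₂ k γ cw κ₁ κ₂ κmax E : ℝ} {b D : ℕ} {o : Output M.p}
    (hT : 0 < T) (hc : 0 < c) (hC : 0 < C) (hC₁ : 0 ≤ C₁) (hC₂ : 4 * C₁ + 8 * T ≤ C₂)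
    (hb : 0 < b) (hn : 2 ≤ M.n) (hgood : M.Good K₀ T c C ω)
    (hTBFL : o.IsTBFL M.n b
      (C₁ * √(M.logDim / (M.n : ℝ)) * √((b : ℝ) / (M.n : ℝ)))
      (C₂ * √(M.logDim / (M.n : ℝ)) * √((b : ℝ) / (M.n : ℝ)))
      (cw * M.nu) κ₁ κ₂ (fun t => M.x t ω) (fun t => M.y t ω))
    (hKb : K₀ * M.logDim ≤ b) (hdb : 32 * C * (M.dstar * M.logDim) ≤ c * b)
    (hD : 8 ≤ D) (hDκ : κmax + 2 ≤ D) (hsp : ∀ j ≤ M.m, M.cp j + D * b ≤ M.cp (j + 1))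
    (hκ₁ : κ₁ ≤ κmax) (hκ₂ : 1 ≤ κ₂) (hκ₂m : κ₂ ≤ κmax)
    (hE : E = 3 * C₂ / c * √(M.dstar * M.logDim / b)) (hE1 : E ≤ 1)
    (hν : 0 < M.nu) (hEγ : E ≤ γ * M.nu) (hγ : γ ≤ 1) (hγw : 2 * γ ≤ cw)
    (hγν : 2 * γ + 2 * cw < 1) (hγC : 32 * C * γ ^ 2 ≤ c)
    (hk : 0 < k) (hkC : 512 * C ≤ c * k ^ 2) (hkT : 256 * T ≤ c * k)
    (hK₀ : K₀ * M.nu ^ 2 ≤ k ^ 2 * M.dstar) :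
    o.mf = M.m ∧
    (∀ j ∈ Icc 1 (M.m + 1), ‖o.betaHat M.n b j - M.β j‖ ≤ E ∧
      l1norm (o.betaHat M.n b j - M.β j) ≤ 4 * √M.dstar * E) ∧
    ∀ j ∈ Icc 1 M.m,
      |(o.tf j : ℝ) - M.cp j| ≤ k ^ 2 * M.dstar * M.logDim / M.nu ^ 2 := by
  obtain ⟨hmin, hJ, hcl, htf⟩ := hTBFL
  have hacc : M.BlockAccurate b o.θ E (4 * √M.dstar * E) := by
    intro i hi j hj h1 h2
    obtain ⟨l1, l2⟩ := blockEnd_length hb hi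
    rw [hE]
    exact M.block_error hT hc hC hC₁ hC₂ hb hn hmin hgood hKb hdb hi hj h1 h2 l1 l2
  -- The threshold c_ω ν lies above the fluctuations 2E and, by the next line, low enough that a
  -- jump cannot hide in two θ's.
  have hEw : 2 * E ≤ cw * M.nu := by nlinarith
  have hEν : 2 * E + 2 * (cw * M.nu) < M.nu := by nlinarith
  have hνj : ∀ j ∈ Icc 1 M.m, M.nu ≤ ‖M.β (j + 1) - M.β j‖ := fun j hj => nu_le hj
  obtain ⟨hm, hnear⟩ := clusters_near hb hD hDκ hsp hacc hEw hνj hEν hκ₁ hκ₂ hκ₂m hJ hcl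
  have hclusters : M.ClustersNear b o :=
    ⟨hm, fun j hj => ⟨hJ.1 j (by rwa [hm]), hnear j hj⟩⟩
  have hβ := fun j (hj : j ∈ Icc 1 (M.m + 1)) => betaHat_accurate hb hD hsp hacc hclusters hj
  refine ⟨hm, hβ, fun j hj => ?_⟩
  obtain ⟨t1, t2⟩ := htf j (by rwa [hm])
  exact location_error hb hD hsp hclusters hβ hgood hn hc hC hT hk hγ hE1 hEγ hγC hkC hkT hν hνj
    hK₀ hj t1 (t2 _ (searchDomain_near hb hclusters hj).1)

end MLRModel

/-! ### Asymptotics -/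

section Asymptotics

variable {Ω : ℕ → Type*} [∀ r, MeasurableSpace (Ω r)] {P : ∀ r, Measure (Ω r)} {n : ℕ → ℕ}

lemma eventually_ofReal_div_le (hn : Filter.Tendsto n Filter.atTop Filter.atTop) (a : ℝ) {δ : ℝ}
    (hδ : 0 < δ) : ∀ᶠ r in Filter.atTop, ENNReal.ofReal (a / (n r : ℝ)) ≤ ENNReal.ofReal δ := by
  have h : Filter.Tendsto (fun r => a / (n r : ℝ)) Filter.atTop (nhds 0) :=
    (tendsto_const_div_atTop_nhds_zero_nat a).comp hn
  filter_upwards [h.eventually_le_const hδ] with r hr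
  exact ENNReal.ofReal_le_ofReal hr

lemma ProbTendsToOne.of_le_div (hn : Filter.Tendsto n Filter.atTop Filter.atTop) {a : ℝ}
    {E : ∀ r, Set (Ω r)}
    (h : ∀ᶠ r in Filter.atTop, P r (E r)ᶜ ≤ ENNReal.ofReal (a / (n r : ℝ))) :
    ProbTendsToOne P E := by
  have h0 : Filter.Tendsto (fun r => ENNReal.ofReal (a / (n r : ℝ))) Filter.atTop (nhds 0) := by
    rw [← ENNReal.ofReal_zero]
    exact ENNReal.tendsto_ofReal ((tendsto_const_div_atTop_nhds_zero_nat a).comp hn)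
  exact tendsto_of_tendsto_of_tendsto_of_le_of_le' tendsto_const_nhds h0
    (.of_forall fun _ => zero_le) h

/-- The failure probability vanishes for one fixed constant, so the same C serves for every δ. -/
lemma BoundedInProb.of_le_div (hn : Filter.Tendsto n Filter.atTop Filter.atTop) {a C : ℝ}
    (hC : 0 < C) {E : ℝ → ∀ r, Set (Ω r)}
    (h : ∀ᶠ r in Filter.atTop, P r (E C r)ᶜ ≤ ENNReal.ofReal (a / (n r : ℝ))) :
    BoundedInProb P E := by
  intro δ hδ
  refine ⟨C, hC, ?_⟩
  filter_upwards [h, eventually_ofReal_div_le hn a hδ] with r h1 h2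
  exact h1.trans h2

lemma measure_compl_le_of_good {Ω : Type*} [MeasurableSpace Ω] {P : Measure Ω} {G H : Ω → Prop}
    {E : Set Ω} {q : ENNReal} (hG : P {ω | ¬ G ω} ≤ q) (hH : ∀ᵐ ω ∂P, H ω)
    (h : ∀ ω, G ω → H ω → ω ∈ E) : P Eᶜ ≤ q := by
  have hsub : Eᶜ ⊆ {ω | ¬ G ω} ∪ {ω | ¬ H ω} := by
    intro ω hω
    by_contra hcon
    simp only [Set.mem_union, Set.mem_ofPred_eq, not_or, not_not] at hcon
    exact hω (h ω hcon.1 hcon.2)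
  refine (measure_mono hsub).trans ((measure_union_le _ _).trans ?_)
  rw [ae_iff.1 hH, add_zero]
  exact hG

end Asymptotics

end TBFL

/-! ### Choice of the constants and the asymptotic conclusions. -/

theorem mainTheorem5 :
    -- constants of the assumption on covariates and errors
    ∀ Cx Csx Cse : ℝ, 0 < Cx → 0 < Csx → 0 < Cse →
    -- sufficiently large constants in the regularization parameters
    ∃ A : ℝ, 0 < A ∧ ∀ C₁ C₂ : ℝ, 0 < C₁ → A * (1 + C₁) ≤ C₂ →
    -- the jump threshold is `cw * ν`; then a sufficiently large constant in `ν = Ω(⋯)`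
    ∀ cw : ℝ, 0 < cw → cw < 1 / 2 → ∃ cν : ℝ, 0 < cν ∧
    -- bound on the entries of the coefficient vectors
    ∀ Mβ : ℝ, 0 < Mβ → ∃ K : ℝ, 0 < K ∧
    -- a sequence of models, with sample sizes tending to infinity
    ∀ (Ω : ℕ → Type*) [∀ r, MeasurableSpace (Ω r)]
      (P : ∀ r, MeasureTheory.Measure (Ω r)) [∀ r, MeasureTheory.IsProbabilityMeasure (P r)]
      (M : ∀ r, TBFL.MLRModel (Ω r)) (b : ℕ → ℕ) (κ₁ κ₂ : ℕ → ℝ) (κmax : ℝ)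
      (o : ∀ r, Ω r → TBFL.Output (M r).p),
      Filter.Tendsto (fun r => (M r).n) Filter.atTop Filter.atTop →
      -- sub-Gaussian covariates and errors
      (∀ r, (M r).AssumptionE1 (P r) Cx Csx Cse) →
      -- sparse and bounded coefficient vectors
      Filter.Tendsto (fun r => ((M r).dstar : ℝ) / ((M r).p : ℝ)) Filter.atTop (nhds 0) →
      (∀ r, ∀ j ∈ Finset.Icc 1 ((M r).m + 1), ∀ i, |(M r).β j i| ≤ Mβ) →
      -- block size, spacing and jump size
      (∀ r, 0 < b r) →
      Filter.Tendsto (fun r => (M r).minSpacing / (b r : ℝ)) Filter.atTop Filter.atTop →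
      Filter.Tendsto (fun r => ((M r).dstar : ℝ) * (M r).logDim / (b r : ℝ))
        Filter.atTop (nhds 0) →
      (∀ᶠ r in Filter.atTop,
        cν * √(((M r).dstar : ℝ) * (M r).logDim / (b r : ℝ)) ≤ (M r).nu) →
      -- clustering parameters
      (∀ r, 0 ≤ κ₁ r ∧ κ₁ r ≤ κmax ∧ 1 ≤ κ₂ r ∧ κ₂ r ≤ κmax) →
      -- `o r ω` is the output of the procedure
      (∀ᶠ r in Filter.atTop, ∀ᵐ ω ∂(P r),
        (o r ω).IsTBFL (M r).n (b r)
          (C₁ * √((M r).logDim / ((M r).n : ℝ)) * √((b r : ℝ) / ((M r).n : ℝ)))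
          (C₂ * √((M r).logDim / ((M r).n : ℝ)) * √((b r : ℝ) / ((M r).n : ℝ)))
          (cw * (M r).nu) (κ₁ r) (κ₂ r)
          (fun t => (M r).x t ω) (fun t => (M r).y t ω)) →
      -- number and locations of the change points
      TBFL.ProbTendsToOne P (fun r => {ω | (o r ω).mf = (M r).m ∧
        ∀ j ∈ Finset.Icc 1 (M r).m, |((o r ω).tf j : ℝ) - ((M r).cp j : ℝ)|
          ≤ K * ((M r).dstar : ℝ) * (M r).logDim / (M r).nu ^ 2}) ∧
      -- coefficient vectors
      TBFL.BoundedInProb P (fun C r => {ω | (o r ω).mf = (M r).m ∧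
        ∀ j ∈ Finset.Icc 1 ((M r).m + 1), ‖(o r ω).betaHat (M r).n (b r) j - (M r).β j‖
          ≤ C * √(((M r).dstar : ℝ) * (M r).logDim / (b r : ℝ))}) ∧
      -- false positives of the thresholded coefficient vectors
      ∀ Cη : ℕ → ℝ,
        (∃ c : ℝ, 0 < c ∧ ∀ r, ∀ j ∈ Finset.Icc 1 ((M r).m + 1), c ≤ Cη j) →
        TBFL.BoundedInProb P (fun C r => {ω | (o r ω).mf = (M r).m ∧
          ∀ j ∈ Finset.Icc 1 ((M r).m + 1),
            ((TBFL.vsupp (TBFL.hardThreshold (Cη j * √((M r).logDim / (b r : ℝ)))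
                ((o r ω).betaHat (M r).n (b r) j)) \ TBFL.vsupp ((M r).β j)).card : ℝ)
              ≤ C * ((M r).dstar : ℝ)}) := by
  intro Cx Csx Cse hCx hCsx hCse
  obtain ⟨κ, hκpos, hκ1, hκ2⟩ : ∃ κ : ℝ, 0 < κ ∧ 4 * Real.exp 1 * κ * Csx ≤ 1 ∧
      4 * Real.exp 1 * κ * Cse ≤ 1 := by
    have he := Real.exp_pos 1
    refine ⟨1 / (4 * Real.exp 1 * (Csx + Cse)), by positivity, ?_, ?_⟩
    · rw [mul_one_div, div_mul_eq_mul_div, div_le_one (by positivity)]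
      gcongr; linarith
    · rw [mul_one_div, div_mul_eq_mul_div, div_le_one (by positivity)]
      gcongr; linarith
  obtain ⟨V, hV, hVx, hVκ⟩ : ∃ V : ℝ, 0 < V ∧ V ≤ 1 / Cx ∧ V * κ ≤ 1 :=
    ⟨min (1 / Cx) (1 / κ), by positivity, min_le_left _ _, by
      rw [← le_div_iff₀ hκpos]; exact min_le_right _ _⟩
  obtain ⟨ρ, hρ⟩ : ∃ ρ : ℝ, ρ = V ^ 2 * κ ^ 2 / 256 := ⟨_, rfl⟩
  have hρ0 : 0 < ρ := by rw [hρ]; positivity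
  set K₀ : ℝ := 8 / ρ with hK₀def
  set T : ℝ := 20 / κ with hTdef
  set c : ℝ := V / 2 with hcdef
  set C : ℝ := 32 / (κ * ρ) with hCdef
  have hK₀ : 0 < K₀ := by positivity
  have hT : 0 < T := by positivity
  have hc : 0 < c := by positivity
  have hC : 0 < C := by positivity
  -- A(1 + C₁) with A = 4 + 8T dominates 4C₁ + 8T, the penalty level needed in `block_error`.
  refine ⟨4 + 8 * T, by positivity, fun C₁ C₂ hC₁ hC₂A cw hcw hcw2 => ?_⟩
  have hC₂ : 4 * C₁ + 8 * T ≤ C₂ := by nlinarith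
  have hC₂0 : 0 < C₂ := by linarith
  obtain ⟨γ, hγ0, hγ1, hγw, hγν, hγC⟩ : ∃ γ : ℝ, 0 < γ ∧ γ ≤ 1 ∧ 2 * γ ≤ cw ∧
      2 * γ + 2 * cw < 1 ∧ 32 * C * γ ^ 2 ≤ c := by
    refine ⟨min (min 1 (cw / 2)) (min ((1 - 2 * cw) / 4) (c / (32 * C))), ?_, ?_, ?_, ?_, ?_⟩
    · have : 0 < (1 - 2 * cw) / 4 := by linarith
      positivity
    · exact (min_le_left _ _).trans (min_le_left _ _)
    · have := (min_le_left (min 1 (cw / 2)) (min ((1 - 2 * cw) / 4) (c / (32 * C)))).trans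
        (min_le_right _ _)
      linarith
    · have := (min_le_right (min 1 (cw / 2)) (min ((1 - 2 * cw) / 4) (c / (32 * C)))).trans
        (min_le_left _ _)
      linarith
    · set g := min (min 1 (cw / 2)) (min ((1 - 2 * cw) / 4) (c / (32 * C)))
      have h1 : g ≤ 1 := (min_le_left _ _).trans (min_le_left _ _)
      have h2 : g ≤ c / (32 * C) := (min_le_right _ _).trans (min_le_right _ _)
      have h0 : 0 ≤ g := by
        have : 0 ≤ (1 - 2 * cw) / 4 := by linarith
        positivity
      rw [le_div_iff₀ (by positivity)] at h2
      nlinarith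
  set Ce : ℝ := 3 * C₂ / c with hCedef
  have hCe : 0 < Ce := by positivity
  -- With c_ν = Ce/γ the jump condition says exactly that the block error is at most γν.
  refine ⟨Ce / γ, by positivity, fun Mβ hMβ => ?_⟩
  -- The bound on the entries enters only here: K₀·8M_β² ≤ k² makes windows longer than k²d*L/ν²
  -- long enough for the good event.
  obtain ⟨k, hk, hkC, hkT, hkM⟩ : ∃ k : ℝ, 0 < k ∧ 512 * C ≤ c * k ^ 2 ∧ 256 * T ≤ c * k ∧
      K₀ * (8 * Mβ ^ 2) ≤ k ^ 2 := by
    refine ⟨1 + 512 * C / c + 256 * T / c + K₀ * (8 * Mβ ^ 2), by positivity, ?_, ?_, ?_⟩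
    · have h1 : 0 ≤ 256 * T / c := by positivity
      have h2 : 0 ≤ K₀ * (8 * Mβ ^ 2) := by positivity
      have h3 : 0 ≤ 512 * C / c := by positivity
      have h4 : 512 * C / c ≤ (1 + 512 * C / c + 256 * T / c + K₀ * (8 * Mβ ^ 2)) ^ 2 := by
        nlinarith
      rw [div_le_iff₀ hc] at h4
      linarith
    · have h2 : 0 ≤ K₀ * (8 * Mβ ^ 2) := by positivity
      have h3 : 0 ≤ 512 * C / c := by positivity
      have h4 : 256 * T / c ≤ 1 + 512 * C / c + 256 * T / c + K₀ * (8 * Mβ ^ 2) := by linarith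
      rw [div_le_iff₀ hc] at h4
      linarith
    · have h1 : 0 ≤ 256 * T / c := by positivity
      have h2 : 0 ≤ K₀ * (8 * Mβ ^ 2) := by positivity
      have h3 : 0 ≤ 512 * C / c := by positivity
      nlinarith
  refine ⟨k ^ 2, by positivity, ?_⟩
  intro Ω _ P _ M b κ₁ κ₂ κmax o hn hE1 _ hβ hb hsp hdb hν hκ hTBFL
  obtain ⟨D, hD8, hDκ⟩ : ∃ D : ℕ, 8 ≤ D ∧ κmax + 2 ≤ D :=
    ⟨max 8 ⌈κmax + 2⌉₊, le_max_left _ _, (Nat.le_ceil _).trans (by exact_mod_cast le_max_right _ _)⟩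
  have hP : ∀ᶠ r in Filter.atTop, P r {ω | ¬ (M r).Good K₀ T c C ω}
      ≤ ENNReal.ofReal (8 / ((M r).n : ℝ)) := by
    filter_upwards [hn.eventually_ge_atTop 2] with r hr
    exact TBFL.MLRModel.measure_not_good_le (hE1 r) hκpos hκ1 hκ2 hV hVx hVκ hρ hr
  have hout : ∀ᶠ r in Filter.atTop, 2 ≤ (M r).n ∧ ∀ ω, (M r).Good K₀ T c C ω →
      (o r ω).IsTBFL (M r).n (b r)
          (C₁ * √((M r).logDim / ((M r).n : ℝ)) * √((b r : ℝ) / ((M r).n : ℝ)))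
          (C₂ * √((M r).logDim / ((M r).n : ℝ)) * √((b r : ℝ) / ((M r).n : ℝ)))
          (cw * (M r).nu) (κ₁ r) (κ₂ r)
          (fun t => (M r).x t ω) (fun t => (M r).y t ω) →
      (o r ω).mf = (M r).m ∧
      (∀ j ∈ Finset.Icc 1 ((M r).m + 1), ‖(o r ω).betaHat (M r).n (b r) j - (M r).β j‖
          ≤ Ce * √(((M r).dstar : ℝ) * (M r).logDim / (b r : ℝ)) ∧
        TBFL.l1norm ((o r ω).betaHat (M r).n (b r) j - (M r).β j)
          ≤ 4 * √(M r).dstar * (Ce * √(((M r).dstar : ℝ) * (M r).logDim / (b r : ℝ)))) ∧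
      ∀ j ∈ Finset.Icc 1 (M r).m, |((o r ω).tf j : ℝ) - (M r).cp j|
          ≤ k ^ 2 * (M r).dstar * (M r).logDim / (M r).nu ^ 2 := by
    -- Three smallness conditions on d*L/b: blocks are long enough to be good windows, the
    -- restricted eigenvalue bound holds on them, and the block error is at most 1.
    have hsmall : 0 < min (1 / K₀) (min (c / (32 * C)) (1 / Ce ^ 2)) := by positivity
    filter_upwards [hn.eventually_ge_atTop 2, hsp.eventually_ge_atTop (D : ℝ),
      hdb.eventually_le_const hsmall, hν] with r hn2 hspr hdbr hνr
    refine ⟨hn2, fun ω hgood htb => ?_⟩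
    have hL := TBFL.MLRModel.logDim_pos hn2
    have hd : (1 : ℝ) ≤ (M r).dstar := by exact_mod_cast (M r).one_le_dstar
    have hbr : (0 : ℝ) < b r := by exact_mod_cast hb r
    have hrate : 0 < √(((M r).dstar : ℝ) * (M r).logDim / (b r : ℝ)) :=
      Real.sqrt_pos.2 (by positivity)
    have hνpos : 0 < (M r).nu := lt_of_lt_of_le (by positivity) hνr
    have h1 := hdbr.trans (min_le_left _ _)
    have h2 := hdbr.trans ((min_le_right _ _).trans (min_le_left _ _))
    have h3 := hdbr.trans ((min_le_right _ _).trans (min_le_right _ _))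
    rw [div_le_div_iff₀ hbr hK₀] at h1
    rw [div_le_div_iff₀ hbr (by positivity)] at h2
    refine TBFL.MLRModel.outcome hT hc hC hC₁.le hC₂ (hb r) hn2 hgood htb ?_ (by linarith)
      hD8 hDκ (TBFL.MLRModel.spacing_of_minSpacing (hb r) hspr) (hκ r).2.1 (hκ r).2.2.1
      (hκ r).2.2.2 rfl ?_ hνpos ?_ hγ1 hγw hγν hγC hk hkC hkT ?_
    · have : 1 * ((M r).logDim * K₀) ≤ (M r).dstar * ((M r).logDim * K₀) := by gcongr
      linarith
    · rw [← le_div_iff₀' hCe, Real.sqrt_le_left (by positivity), div_pow, one_pow]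
      exact h3
    · have := mul_le_mul_of_nonneg_left hνr hγ0.le
      rwa [← mul_assoc, mul_div_cancel₀ _ hγ0.ne'] at this
    · have h4 := TBFL.MLRModel.nu_sq_le (hβ r) hνpos.le
      calc K₀ * (M r).nu ^ 2 ≤ K₀ * (8 * Mβ ^ 2 * (M r).dstar) := by gcongr
        _ = K₀ * (8 * Mβ ^ 2) * (M r).dstar := by ring
        _ ≤ k ^ 2 * (M r).dstar := by gcongr
  refine ⟨TBFL.ProbTendsToOne.of_le_div hn (a := 8) ?_,
    TBFL.BoundedInProb.of_le_div hn (a := 8) hCe ?_, ?_⟩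
  · filter_upwards [hP, hout, hTBFL] with r h1 h2 h3
    refine TBFL.measure_compl_le_of_good h1 h3 fun ω hg ht => ?_
    exact ⟨(h2.2 ω hg ht).1, (h2.2 ω hg ht).2.2⟩
  · filter_upwards [hP, hout, hTBFL] with r h1 h2 h3
    refine TBFL.measure_compl_le_of_good h1 h3 fun ω hg ht => ?_
    exact ⟨(h2.2 ω hg ht).1, fun j hj => ((h2.2 ω hg ht).2.1 j hj).1⟩
  · rintro Cη ⟨c0, hc0, hCη⟩
    refine TBFL.BoundedInProb.of_le_div hn (a := 8) (C := 4 * Ce / c0) (by positivity) ?_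
    filter_upwards [hP, hout, hTBFL] with r h1 h2 h3
    refine TBFL.measure_compl_le_of_good h1 h3 fun ω hg ht => ?_
    refine ⟨(h2.2 ω hg ht).1, fun j hj => ?_⟩
    have hL := TBFL.MLRModel.logDim_pos h2.1
    have hbr : (0 : ℝ) < b r := by exact_mod_cast hb r
    have hs : 0 < √((M r).logDim / (b r : ℝ)) := Real.sqrt_pos.2 (by positivity)
    have h4 := TBFL.card_false_positives_mul_le
      (mul_le_mul_of_nonneg_right (hCη r j hj) hs.le)
      ((o r ω).betaHat (M r).n (b r) j) ((M r).β j)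
    have h5 := h4.trans ((h2.2 ω hg ht).2.1 j hj).2
    have e1 : √(((M r).dstar : ℝ) * (M r).logDim / (b r : ℝ))
        = √(M r).dstar * √((M r).logDim / (b r : ℝ)) := by
      rw [mul_div_assoc, Real.sqrt_mul (Nat.cast_nonneg _)]
    -- The ℓ¹ error is a multiple of d*√(L/b), so dividing by a threshold of order √(L/b) leaves a
    -- multiple of d*.
    have e2 : 4 * √(M r).dstar * (Ce * (√(M r).dstar * √((M r).logDim / (b r : ℝ))))
        = 4 * Ce * (M r).dstar * √((M r).logDim / (b r : ℝ)) := by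
      have := Real.mul_self_sqrt (Nat.cast_nonneg (α := ℝ) (M r).dstar)
      linear_combination 4 * Ce * √((M r).logDim / (b r : ℝ)) * this
    rw [e1, e2, ← mul_assoc] at h5
    have h6 := le_of_mul_le_mul_right h5 hs
    rw [div_mul_eq_mul_div, le_div_iff₀ hc0]
    exact h6
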